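/- Let $n\ge 1$ and let $\Omega\subset\mathbb R^n$ be a (bounded or unbounded) Lipschitz domain: an open set whose boundary $\partial\Omega$ is compact and has a finite open cover $W_1,\dots,W_J$ such that, for each $j$, $W_j\cap\Omega=W_j\cap\Omega_j$, where $\Omega_j$ is the image under a rigid motion of a set $\{(x',x_n):x_n>\zeta_j(x')\}$ with $\zeta_j:\mathbb R^{n-1}\to\mathbb R$ Lipschitz. For $s\in\mathbb R$ let $H^s(\mathbb R^n)$ be the Bessel potential space of complex-valued tempered distributions $U$ with norm $\|U\|_{H^s(\mathbb R^n)}=\|\mathcal F^{-1}(1+|\xi|^2)^{s/2}\mathcal F U\|_{L^2(\mathbb R^n)}<\infty$, and let $H^s(\Omega)=\{U|_\Omega : U\in H^s(\mathbb R^n)\}$, a space of distributions on $\Omega$ with the quotient norm $\|u\|_{H^s(\Omega)}=\inf\{\|U\|_{H^s(\mathbb R^n)}:U|_\Omega=u\}$. Let $\mathcal D(\Omega)=C^\infty_{\mathrm{comp}}(\Omega)$, let $\widetilde H^s(\Omega)$ be the closure of $\mathcal D(\Omega)$ in $H^s(\mathbb R^n)$, and let $H^s_0(\Omega)$ be the closure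 of $\mathcal D(\Omega)$ in $H^s(\Omega)$. For $\tfrac12<s<\tfrac32$ let $\gamma^+$ be the trace operator on $H^s(\Omega)$, that is, the continuous extension to $H^s(\Omega)$ of the map $\varphi|_\Omega\mapsto\varphi|_{\partial\Omega}$, $\varphi\in\mathcal D(\mathbb R^n)$ (with values in $H^{s-1/2}(\partial\Omega)\subset L^2(\partial\Omega)$). If $\tfrac12<s<\tfrac32$, then $$H^s_0(\Omega)=\widetilde H^s(\Omega)=\{u\in H^s(\Omega):\gamma^+u=0\},$$ where $\widetilde H^s(\Omega)$ is identified with a subspace of $H^s(\Omega)$ by the restriction map $U\mapsto U|_\Omega$, which is injective on $\widetilde H^s(\Omega)$. -/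

import Mathlib

open MeasureTheory Set TopologicalSpace SchwartzMap TemperedDistribution
open scoped NNReal ENNReal Distributions

noncomputable section

namespace TraceSpaces

/-! ### Lipschitz domains -/

/-- `ℝⁿ` with the Euclidean norm. -/
abbrev Euc (n : ℕ) : Type := EuclideanSpace ℝ (Fin n)

/-- `ℝⁿ⁻¹ × ℝ` with the Euclidean norm, the space of points `x = (x', x_n)`. -/
abbrev GraphSpace (n : ℕ) : Type := WithLp 2 (Euc (n - 1) × ℝ)

/-- `H` is, up to a rigid motion, the region `{x : x_n > ζ(x')}` on one side of the graph of a
Lipschitz function `ζ : ℝⁿ⁻¹ → ℝ`. -/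
def IsLipschitzHypograph {n : ℕ} (H : Set (Euc n)) : Prop :=
  ∃ (κ : Euc n ≃ᵢ GraphSpace n) (ζ : Euc (n - 1) → ℝ) (K : ℝ≥0),
    LipschitzWith K ζ ∧ H = {x | ζ (κ x).fst < (κ x).snd}

/-- A (bounded or unbounded) Lipschitz domain: an open set with compact boundary, the boundary
having a finite open cover `W₁, …, W_J` such that inside each `W_j` the set coincides with a
(rotated and translated) Lipschitz hypograph. Connectedness is not required. -/
def IsLipschitzDomain {n : ℕ} (Ω : Opens (Euc n)) : Prop :=
  IsCompact (frontier (Ω : Set (Euc n))) ∧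
    ∃ (J : ℕ) (W H : Fin J → Set (Euc n)),
      (∀ j, IsOpen (W j)) ∧ (∀ j, IsLipschitzHypograph (H j)) ∧
      frontier (Ω : Set (Euc n)) ⊆ ⋃ j, W j ∧ ∀ j, W j ∩ (Ω : Set (Euc n)) = W j ∩ H j

/-- Surface measure on `∂Ω`: the `(n-1)`-dimensional Hausdorff measure (a constant multiple of
the classical surface measure), restricted to the boundary. -/
def surfaceMeasure {n : ℕ} (Ω : Opens (Euc n)) : Measure (Euc n) :=
  (Measure.hausdorffMeasure ((n - 1 : ℕ) : ℝ)).restrict (frontier (Ω : Set (Euc n)))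

lemma hausdorffMeasure_lt_top_of_isBounded {d : ℕ} {A : Set (Euc d)}
    (hA : Bornology.IsBounded A) :
    Measure.hausdorffMeasure (d : ℝ) A < ⊤ := by
  have h1 : LipschitzWith _ (WithLp.toLp 2 : (Fin d → ℝ) → Euc d) :=
    PiLp.lipschitzWith_toLp 2 (fun _ : Fin d => ℝ)
  have h2 : LipschitzWith _ (WithLp.ofLp : Euc d → (Fin d → ℝ)) :=
    PiLp.lipschitzWith_ofLp 2 (fun _ : Fin d => ℝ)
  have hb : Bornology.IsBounded ((WithLp.ofLp : Euc d → (Fin d → ℝ)) '' A) := h2.isBounded_image hA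
  have hA' : A = (WithLp.toLp 2 : (Fin d → ℝ) → Euc d) ''
      ((WithLp.ofLp : Euc d → (Fin d → ℝ)) '' A) := by
    rw [image_image]; simp
  rw [hA']
  refine (h1.hausdorffMeasure_image_le (d := (d : ℝ)) (by positivity) _).trans_lt ?_
  refine ENNReal.mul_lt_top (by simp) ?_
  have := hausdorffMeasure_pi_real (ι := Fin d)
  rw [Fintype.card_fin] at this
  rw [this]
  exact hb.measure_lt_top

lemma IsLipschitzHypograph.frontier_subset {n : ℕ} {H : Set (Euc n)} {κ : Euc n ≃ᵢ GraphSpace n}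
    {ζ : Euc (n - 1) → ℝ} (hζ : Continuous ζ) (hH : H = {x | ζ (κ x).fst < (κ x).snd}) :
    frontier H ⊆ {x | ζ (κ x).fst = (κ x).snd} := by
  rw [hH]
  have hκ : Continuous κ := κ.continuous
  exact frontier_lt_subset_eq
    (hζ.comp ((WithLp.continuous_fst 2 _ _).comp hκ)) ((WithLp.continuous_snd 2 _ _).comp hκ)

lemma isFiniteMeasure_surfaceMeasure {n : ℕ} {Ω : Opens (Euc n)} (hΩ : IsLipschitzDomain Ω) :
    IsFiniteMeasure (surfaceMeasure Ω) := by
  obtain ⟨hc, J, W, H, hW, hH, hcov, heq⟩ := hΩ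
  set Γ := frontier (Ω : Set (Euc n)) with hΓ
  have key : ∀ j, Measure.hausdorffMeasure ((n - 1 : ℕ) : ℝ) (Γ ∩ W j) < ⊤ := by
    intro j
    obtain ⟨κ, ζ, K, hζ, hHj⟩ := hH j
    have hsub : Γ ∩ W j ⊆ frontier (H j) := by
      rintro x ⟨hx, hxW⟩
      have h1 : x ∈ frontier ((Ω : Set (Euc n)) ∩ W j) ∩ W j := by
        rw [frontier_inter_open_inter (hW j)]
        exact ⟨hx, hxW⟩
      rw [inter_comm (Ω : Set (Euc n)), heq j, inter_comm (W j),
        frontier_inter_open_inter (hW j)] at h1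
      exact h1.1
    set g : Euc (n - 1) → Euc n := fun y => κ.symm (WithLp.toLp 2 (y, ζ y)) with hg
    have hgL : ∃ L : ℝ≥0, LipschitzWith L g := by
      refine ⟨_, κ.symm.isometry.lipschitz.comp
        ((WithLp.prod_lipschitzWith_toLp 2 _ _).comp (LipschitzWith.id.prodMk hζ))⟩
    obtain ⟨L, hgL⟩ := hgL
    have hproj : LipschitzWith 1 (fun x : Euc n => (κ x).fst) := by
      refine LipschitzWith.of_dist_le_mul fun x y => ?_
      rw [NNReal.coe_one, one_mul, ← κ.isometry.dist_eq x y, dist_eq_norm, dist_eq_norm,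
        ← WithLp.sub_fst]
      exact WithLp.norm_fst_le _ _
    set A : Set (Euc (n - 1)) := (fun x : Euc n => (κ x).fst) '' (Γ ∩ W j)
    have hA : Bornology.IsBounded A :=
      hproj.isBounded_image (hc.isBounded.subset inter_subset_left)
    have hcover : Γ ∩ W j ⊆ g '' A := by
      intro x hx
      refine ⟨_, ⟨x, hx, rfl⟩, ?_⟩
      have := IsLipschitzHypograph.frontier_subset hζ.continuous hHj (hsub hx)
      simp only [mem_ofPred_eq] at this
      simp only [hg, this]
      exact κ.symm_apply_apply x
    refine (measure_mono hcover).trans_lt ?_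
    refine (hgL.hausdorffMeasure_image_le (by positivity) A).trans_lt ?_
    exact ENNReal.mul_lt_top (by simp) (hausdorffMeasure_lt_top_of_isBounded hA)
  refine ⟨?_⟩
  rw [surfaceMeasure, Measure.restrict_apply_univ]
  have : Γ ⊆ ⋃ j, Γ ∩ W j := by rw [← inter_iUnion]; exact subset_inter subset_rfl hcov
  refine (measure_mono this).trans_lt ((measure_iUnion_fintype_le _ _).trans_lt ?_)
  exact ENNReal.sum_lt_top.2 fun j _ => key j

/-! ### Restriction of tempered distributions to `Ω` -/

/-- A test function on `Ω`, extended by zero, as a Schwartz function on `ℝⁿ`. -/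
def toSchwartz {n : ℕ} (Ω : Opens (Euc n)) : 𝓓(Ω, ℂ) →ₗ[ℂ] 𝓢(Euc n, ℂ) where
  toFun φ := φ.hasCompactSupport.toSchwartzMap φ.contDiff
  map_add' φ ψ := by ext x; rfl
  map_smul' c φ := by ext x; rfl

/-- A real test function, regarded as a complex Schwartz function. -/
def realToSchwartz {n : ℕ} (Ω : Opens (Euc n)) (φ : 𝓓(Ω, ℝ)) : 𝓢(Euc n, ℂ) :=
  (φ.hasCompactSupport.comp_left (g := ((↑) : ℝ → ℂ)) Complex.ofReal_zero).toSchwartzMap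
    (Complex.ofRealCLM.contDiff.comp φ.contDiff)

lemma continuous_realToSchwartz_comp {n : ℕ} {Ω : Opens (Euc n)} (K : Compacts (Euc n))
    (hK : (K : Set (Euc n)) ⊆ Ω) :
    Continuous (realToSchwartz Ω ∘ TestFunction.ofSupportedIn hK) := by
  let T : 𝓓^{⊤}_{K}(Euc n, ℝ) →ₗ[ℝ] 𝓢(Euc n, ℂ) :=
    { toFun := realToSchwartz Ω ∘ TestFunction.ofSupportedIn hK
      map_add' := fun f g => by ext x; exact Complex.ofReal_add _ _
      map_smul' := fun c f => by ext x; exact Complex.ofReal_mul _ _ }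
  change Continuous T
  obtain ⟨R, hR0, hR⟩ : ∃ R : ℝ, 0 ≤ R ∧ ∀ x ∈ K, ‖x‖ ≤ R := by
    obtain ⟨R, hR⟩ := K.isCompact.isBounded.exists_norm_le
    exact ⟨max R 0, le_max_right _ _, fun x hx => (hR x hx).trans (le_max_left _ _)⟩
  refine WithSeminorms.continuous_of_isBounded
    (ContDiffMapSupportedIn.withSeminorms ℝ (Euc n) ℝ ⊤ K)
    (schwartz_withSeminorms ℝ (Euc n) ℂ) T ?_
  rintro ⟨k, m⟩
  refine ⟨{m}, ⟨R ^ k, by positivity⟩, fun f => ?_⟩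
  refine SchwartzMap.seminorm_le_bound ℝ k m _ (by positivity) fun x => ?_
  have hT : ((T f : 𝓢(Euc n, ℂ)) : Euc n → ℂ) = Complex.ofRealCLM ∘ (f : Euc n → ℝ) := rfl
  have hnorm : ‖iteratedFDeriv ℝ m (T f) x‖ = ‖iteratedFDeriv ℝ m f x‖ := by
    rw [hT]
    exact Complex.ofRealLI.norm_iteratedFDeriv_comp_left (f.contDiff.contDiffAt)
      (mod_cast le_top)
  rw [hnorm]
  by_cases hx : x ∈ K
  · have h1 := ContDiffMapSupportedIn.norm_iteratedFDeriv_apply_le_seminorm_top ℝ (i := m)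
      (f := f) (x := x)
    calc _ ≤ R ^ k * N[ℝ]_{K, m} f := by gcongr; exact hR x hx
      _ = _ := by rw [Finset.sup_singleton]; rfl
  · have h0 : iteratedFDeriv ℝ m f x = 0 := f.iteratedFDeriv_zero_on_compl hx
    rw [h0]
    simp only [norm_zero, mul_zero]
    positivity

/-- The restriction `U|_Ω ∈ 𝓓'(Ω)` of a tempered distribution `U` on `ℝⁿ` to the open set `Ω`. -/
def restrictDistribution {n : ℕ} (Ω : Opens (Euc n)) : 𝓢'(Euc n, ℂ) →ₗ[ℂ] 𝓓'(Ω, ℂ) where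
  toFun U := TestFunction.mkCLM ℝ (fun φ => U (realToSchwartz Ω φ))
    (fun f g => by
      rw [← map_add]; congr 1; ext x; exact Complex.ofReal_add _ _)
    (fun c f => by
      rw [← Complex.coe_smul, ← map_smul]; congr 1; ext x; exact Complex.ofReal_mul _ _)
    (fun K hK => U.continuous.comp (continuous_realToSchwartz_comp K hK))
  map_add' U V := by ext φ; rfl
  map_smul' c U := by ext φ; rfl

/-! ### The Sobolev (Bessel potential) space `H^s(ℝⁿ)` -/

/-- `H^s(ℝⁿ)`: the tempered distributions `U` with `𝓙^s U ∈ L²(ℝⁿ)`, where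
`𝓙^s = 𝓕⁻¹ (1 + |ξ|²)^{s/2} 𝓕` is the Bessel potential operator. -/
def sobolevSubmodule (n : ℕ) (s : ℝ) : Submodule ℂ 𝓢'(Euc n, ℂ) where
  carrier := {U | MemSobolev s 2 U}
  add_mem' := MemSobolev.add
  zero_mem' := memSobolev_fun_zero _ _ s 2
  smul_mem' c _ h := h.smul c

/-- `H^s(ℝⁿ)` as a type of its own; it is normed by `‖U‖ = ‖𝓙^s U‖_{L²}`. -/
def Sob (n : ℕ) (s : ℝ) : Type := sobolevSubmodule n s

namespace Sob

variable {n : ℕ} {s : ℝ}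

instance : AddCommGroup (Sob n s) := inferInstanceAs (AddCommGroup (sobolevSubmodule n s))
instance : Module ℂ (Sob n s) := inferInstanceAs (Module ℂ (sobolevSubmodule n s))

/-- The tempered distribution underlying an element of `H^s(ℝⁿ)`. -/
def toDistribution (n : ℕ) (s : ℝ) : Sob n s →ₗ[ℂ] 𝓢'(Euc n, ℂ) := (sobolevSubmodule n s).subtype

lemma toDistribution_injective : Function.Injective (toDistribution n s) :=
  Subtype.val_injective

lemma toTemperedDistribution_injective :
    Function.Injective
      (Lp.toTemperedDistributionCLM ℂ (volume : Measure (Euc n)) 2) :=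
  LinearMap.ker_eq_bot.1 Lp.ker_toTemperedDistributionCLM_eq_bot

/-- The `L²` function `𝓙^s U` for `U ∈ H^s(ℝⁿ)`. -/
def besselFun (U : Sob n s) : Lp ℂ 2 (volume : Measure (Euc n)) := Classical.choose U.2

lemma besselFun_spec (U : Sob n s) :
    besselPotential (Euc n) ℂ s (toDistribution n s U) =
      Lp.toTemperedDistributionCLM ℂ (volume : Measure (Euc n)) 2 (besselFun U) :=
  Classical.choose_spec U.2

/-- `𝓙^s : H^s(ℝⁿ) → L²(ℝⁿ)` as a linear map. -/
def bessel (n : ℕ) (s : ℝ) : Sob n s →ₗ[ℂ] Lp ℂ 2 (volume : Measure (Euc n)) where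
  toFun := besselFun
  map_add' U V := toTemperedDistribution_injective (by
    simp only [map_add, ← besselFun_spec])
  map_smul' c U := toTemperedDistribution_injective (by
    simp only [map_smul, ← besselFun_spec, RingHom.id_apply])

lemma toDistribution_eq (U : Sob n s) :
    toDistribution n s U = besselPotential (Euc n) ℂ (-s)
      (Lp.toTemperedDistributionCLM ℂ (volume : Measure (Euc n)) 2 (bessel n s U)) := by
  rw [show bessel n s U = besselFun U from rfl, ← besselFun_spec]
  simp

lemma bessel_injective : Function.Injective (bessel n s) := fun U V h =>
  toDistribution_injective (by rw [toDistribution_eq, h, ← toDistribution_eq])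

instance : NormedAddCommGroup (Sob n s) :=
  NormedAddCommGroup.induced (Sob n s) (Lp ℂ 2 (volume : Measure (Euc n))) (bessel n s)
    bessel_injective

instance : NormedSpace ℂ (Sob n s) := NormedSpace.induced ℂ (Sob n s) _ (bessel n s)

lemma norm_def (U : Sob n s) : ‖U‖ = ‖bessel n s U‖ := rfl

lemma continuous_bessel : Continuous (bessel n s) := continuous_induced_dom

lemma continuous_toDistribution : Continuous (toDistribution n s) := by
  have : ⇑(toDistribution n s) = fun U => besselPotential (Euc n) ℂ (-s)
      (Lp.toTemperedDistributionCLM ℂ (volume : Measure (Euc n)) 2 (bessel n s U)) :=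
    funext toDistribution_eq
  rw [this]
  exact (ContinuousLinearMap.continuous _).comp
    ((ContinuousLinearMap.continuous _).comp continuous_bessel)

/-- A test function on `Ω`, extended by zero, as an element of `H^s(ℝⁿ)`. -/
def ofTest (Ω : Opens (Euc n)) (s : ℝ) : 𝓓(Ω, ℂ) →ₗ[ℂ] Sob n s :=
  ((SchwartzMap.toTemperedDistributionCLM (Euc n) ℂ volume).toLinearMap ∘ₗ
    toSchwartz Ω).codRestrict (sobolevSubmodule n s) fun φ => (toSchwartz Ω φ).memSobolev

end Sob

/-! ### The spaces `H^s(Ω)`, `H̃^s(Ω)` and `H_0^s(Ω)` -/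

/-- Restriction to `Ω` of elements of `H^s(ℝⁿ)`, as distributions on `Ω`. -/
def restrictMap {n : ℕ} (Ω : Opens (Euc n)) (s : ℝ) : Sob n s →ₗ[ℂ] 𝓓'(Ω, ℂ) :=
  restrictDistribution Ω ∘ₗ Sob.toDistribution n s

lemma isClosed_ker_restrictMap {n : ℕ} (Ω : Opens (Euc n)) (s : ℝ) :
    IsClosed ((restrictMap Ω s).ker : Set (Sob n s)) := by
  have : ((restrictMap Ω s).ker : Set (Sob n s)) =
      ⋂ φ : 𝓓(Ω, ℝ), {U | Sob.toDistribution n s U (realToSchwartz Ω φ) = 0} := by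
    ext U
    simp only [SetLike.mem_coe, LinearMap.mem_ker, mem_iInter]
    constructor
    · intro h φ
      exact DFunLike.congr_fun h φ
    · intro h
      ext φ
      exact h φ
  rw [this]
  refine isClosed_iInter fun φ => isClosed_eq ?_ continuous_const
  exact (PointwiseConvergenceCLM.evalCLM _ _ _).continuous.comp Sob.continuous_toDistribution

instance {n : ℕ} (Ω : Opens (Euc n)) (s : ℝ) :
    IsClosed ((restrictMap Ω s).ker : Set (Sob n s)) := isClosed_ker_restrictMap Ω s

/-- `H^s(Ω) = {U|_Ω : U ∈ H^s(ℝⁿ)}`, a space of distributions on `Ω`. -/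
def SobOn {n : ℕ} (Ω : Opens (Euc n)) (s : ℝ) : Type := LinearMap.range (restrictMap Ω s)

namespace SobOn

variable {n : ℕ} {Ω : Opens (Euc n)} {s : ℝ}

instance : AddCommGroup (SobOn Ω s) :=
  inferInstanceAs (AddCommGroup (LinearMap.range (restrictMap Ω s)))
instance : Module ℂ (SobOn Ω s) :=
  inferInstanceAs (Module ℂ (LinearMap.range (restrictMap Ω s)))

/-- The canonical isomorphism of `H^s(Ω)` with the quotient of `H^s(ℝⁿ)` by the elements that
vanish on `Ω`. -/
def equivQuot (Ω : Opens (Euc n)) (s : ℝ) : SobOn Ω s ≃ₗ[ℂ] (Sob n s ⧸ (restrictMap Ω s).ker) :=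
  (restrictMap Ω s).quotKerEquivRange.symm

/-- `H^s(Ω)` carries the quotient norm `‖u‖ = inf {‖U‖ : U ∈ H^s(ℝⁿ), U|_Ω = u}`. -/
instance : NormedAddCommGroup (SobOn Ω s) :=
  NormedAddCommGroup.induced (SobOn Ω s) (Sob n s ⧸ (restrictMap Ω s).ker) (equivQuot Ω s)
    (equivQuot Ω s).injective

instance : NormedSpace ℂ (SobOn Ω s) := NormedSpace.induced ℂ (SobOn Ω s) _ (equivQuot Ω s)

end SobOn

/-- The restriction operator `H^s(ℝⁿ) → H^s(Ω)`, `U ↦ U|_Ω`. -/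
def restr {n : ℕ} (Ω : Opens (Euc n)) (s : ℝ) : Sob n s →ₗ[ℂ] SobOn Ω s :=
  (restrictMap Ω s).rangeRestrict

/-- `H̃^s(Ω)`: the closure of `𝓓(Ω)` in `H^s(ℝⁿ)`. -/
def HTilde {n : ℕ} (Ω : Opens (Euc n)) (s : ℝ) : Submodule ℂ (Sob n s) :=
  (LinearMap.range (Sob.ofTest Ω s)).topologicalClosure

/-- `H_0^s(Ω)`: the closure of `𝓓(Ω)` in `H^s(Ω)`. -/
def HZero {n : ℕ} (Ω : Opens (Euc n)) (s : ℝ) : Submodule ℂ (SobOn Ω s) :=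
  (LinearMap.range (restr Ω s ∘ₗ Sob.ofTest Ω s)).topologicalClosure

/-! ### The trace operator -/

/-- `L²(∂Ω)`. -/
abbrev BoundaryL2 {n : ℕ} (Ω : Opens (Euc n)) : Type := Lp ℂ 2 (surfaceMeasure Ω)

lemma memLp_boundary {n : ℕ} {Ω : Opens (Euc n)} (hΩ : IsLipschitzDomain Ω)
    (φ : 𝓓((⊤ : Opens (Euc n)), ℂ)) : MemLp φ 2 (surfaceMeasure Ω) := by
  have := isFiniteMeasure_surfaceMeasure hΩ
  exact (φ.memLp_top (μ := surfaceMeasure Ω)).mono_exponent le_top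

/-- The restriction `φ ↦ φ|_∂Ω` of test functions on `ℝⁿ` to the boundary. -/
def boundaryValue {n : ℕ} {Ω : Opens (Euc n)} (hΩ : IsLipschitzDomain Ω) :
    𝓓((⊤ : Opens (Euc n)), ℂ) →ₗ[ℂ] BoundaryL2 Ω where
  toFun φ := (memLp_boundary hΩ φ).toLp φ
  map_add' φ ψ := MemLp.toLp_add (memLp_boundary hΩ φ) (memLp_boundary hΩ ψ)
  map_smul' c φ := MemLp.toLp_const_smul c (memLp_boundary hΩ φ)

/-- The trace operator `γ⁺` on `H^s(Ω)`, `1/2 < s < 3/2`: the extension by continuity of the map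
`φ|_Ω ↦ φ|_∂Ω`, `φ ∈ 𝓓(ℝⁿ)`, from the dense subspace of restrictions of test functions to all of
`H^s(Ω)`. The traces are regarded as elements of `L²(∂Ω)`, in which the range space
`H^{s-1/2}(∂Ω)` is continuously embedded. -/
def trace {n : ℕ} {Ω : Opens (Euc n)} (hΩ : IsLipschitzDomain Ω) (s : ℝ) :
    SobOn Ω s →L[ℂ] BoundaryL2 Ω :=
  (boundaryValue hΩ).extendOfNorm (restr Ω s ∘ₗ Sob.ofTest ⊤ s)

end TraceSpaces

end

noncomputable section
namespace TraceSpaces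

/-! ### The measures `|t|^p dt` on the line -/

/-! The inclusions of `(HTilde Ω s).map (restr Ω s)` in `HZero Ω s`, and of that in the kernel of
the trace, only use that restriction and trace are continuous and that test functions on `Ω` vanish
on `∂Ω`. The content is the return: if `U|_Ω` has zero trace, then its extension by zero lies in
`H̃^s(Ω)`.

For `0 < s < 2` the `H^s` norm is equivalent to the `L²` norm plus the integrals of `|f(x+te) -
2f(x) + f(x-te)|² |t|^{-1-2s}` over the coordinate directions `e` (`gagliardo_eq`,
`Sob.exists_toL2_eq_of_gagliardo`). Second differences treat the whole range of `s` at once, with no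
separate case for `s ≥ 1`.

Hardy's inequality on the line, `∫ |v(t) - v(0)|² |t|^{-2s} dt ≤ C [v]_s²` for `1/2 < s < 3/2`
(`exists_hardy_le`), is integrated over the vertical lines of a boundary chart. In the limit `∫∫ |U
- γU|² |t|^{-2s} < ∞` over the chart (`IsGraphChart.lintegral_sub_trace_ne_top`). This serves three
purposes: the same estimate for test functions bounds the trace; if `U = 0` on `Ω`, divergence of `∫
|t|^{-2s}` at `0` forces `γU = 0`, so the trace only depends on `U|_Ω`; and if `γU = 0`, then `∫
|U|² dist(x, ∂Ω)^{-2s} < ∞`.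

This weighted integral pays for cutting off. Multiplication by `1_Ω θ_k`, with `θ_k` vanishing near
`∂Ω` and near infinity and varying at the scale of the distance, is bounded in `H^s` uniformly in
`k` (`exists_gagliardo_mul_le`). The cross term of the product rule, a weighted first difference, is
absorbed by doubling the step, which requires `s < 3/2`. The products have compact support in `Ω`,
hence lie in `H̃^s(Ω)` by mollification; a weak limit exists in this weakly closed space and agrees
with `U` on `Ω` (`Sob.exists_mem_HTilde`). -/

/-- The measure `|t|^p dt` on the line. -/
def powMeasure (p : ℝ) : Measure ℝ := volume.withDensity fun t => ENNReal.ofReal (|t| ^ p)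

lemma measurable_powWeight (p : ℝ) : Measurable fun t : ℝ => ENNReal.ofReal (|t| ^ p) := by
  fun_prop

instance (p : ℝ) : SFinite (powMeasure p) := by unfold powMeasure; infer_instance

lemma lintegral_powMeasure (p : ℝ) (G : ℝ → ℝ≥0∞) :
    ∫⁻ t, G t ∂powMeasure p = ∫⁻ t, ENNReal.ofReal (|t| ^ p) * G t := by
  rw [powMeasure, lintegral_withDensity_eq_lintegral_mul_non_measurable _ (measurable_powWeight p)
    (Filter.Eventually.of_forall fun _ => ENNReal.ofReal_lt_top)]
  rfl

lemma lintegral_comp_mul_left {a : ℝ} (ha : a ≠ 0) (G : ℝ → ℝ≥0∞) :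
    ∫⁻ t, G (a * t) = ENNReal.ofReal |a⁻¹| * ∫⁻ t, G t := by
  have h := (Homeomorph.mulLeft₀ a ha).toMeasurableEquiv.measurableEmbedding.lintegral_map
    (μ := volume) G
  rw [show ⇑(Homeomorph.mulLeft₀ a ha).toMeasurableEquiv = (a * ·) from rfl,
    Real.map_volume_mul_left ha, lintegral_smul_measure] at h
  exact h.symm

lemma lintegral_powMeasure_comp_mul {a : ℝ} (ha : a ≠ 0) (p : ℝ) (G : ℝ → ℝ≥0∞) :
    ∫⁻ t, G (a * t) ∂powMeasure p = ENNReal.ofReal (|a| ^ (-p - 1)) * ∫⁻ t, G t ∂powMeasure p := by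
  have ha' : 0 < |a| := abs_pos.2 ha
  rw [lintegral_powMeasure, lintegral_powMeasure]
  have h1 : ∀ t, ENNReal.ofReal (|t| ^ p) * G (a * t) = ENNReal.ofReal (|a| ^ (-p)) *
      (ENNReal.ofReal (|a * t| ^ p) * G (a * t)) := by
    intro t
    rw [← mul_assoc, ← ENNReal.ofReal_mul (by positivity), abs_mul,
      Real.mul_rpow (abs_nonneg _) (abs_nonneg _), ← mul_assoc, ← Real.rpow_add ha']
    simp
  simp_rw [h1]
  rw [lintegral_const_mul' _ _ ENNReal.ofReal_ne_top,
    lintegral_comp_mul_left ha (fun t => ENNReal.ofReal (|t| ^ p) * G t), ← mul_assoc,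
    ← ENNReal.ofReal_mul (by positivity)]
  congr 2
  rw [abs_inv, Real.rpow_sub ha', Real.rpow_one, div_eq_mul_inv]

lemma lintegral_comp_abs (g : ℝ → ℝ≥0∞) : ∫⁻ t, g |t| = 2 * ∫⁻ t in Ioi (0 : ℝ), g t := by
  rw [← lintegral_add_compl (fun t => g |t|) (measurableSet_Ioi (a := (0 : ℝ))), compl_Ioi,
    two_mul]
  congr 1
  · exact setLIntegral_congr_fun measurableSet_Ioi fun t ht => by rw [abs_of_pos ht]
  · rw [← setLIntegral_congr (Iio_ae_eq_Iic (a := (0 : ℝ)) (μ := volume))]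
    have h := (Measure.measurePreserving_neg (volume : Measure ℝ)).setLIntegral_comp_preimage_emb
        (Homeomorph.neg ℝ).measurableEmbedding g (Ioi 0)
    rw [← h, neg_preimage, neg_Ioi, neg_zero]
    exact setLIntegral_congr_fun measurableSet_Iio fun t ht => by rw [abs_of_neg ht]

/-- The integrand behaves like `|t|^{p+k}` at `0` and like `|t|^p` at infinity. Finiteness of the
constants in the later estimates reduces to this. -/
lemma lintegral_min_powMeasure_lt_top {p k : ℝ} (hp : p < -1) (hk : -1 < p + k) :
    ∫⁻ t, ENNReal.ofReal (min 1 (|t| ^ k)) ∂powMeasure p < ⊤ := by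
  have hk0 : 0 < k := by linarith
  rw [lintegral_powMeasure]
  have h := lintegral_comp_abs fun t =>
    ENNReal.ofReal (t ^ p) * ENNReal.ofReal (min 1 (t ^ k))
  rw [h]
  refine ENNReal.mul_lt_top (by simp) ?_
  rw [← Ioc_union_Ioi_eq_Ioi (zero_le_one (α := ℝ)),
    lintegral_union measurableSet_Ioi (Ioc_disjoint_Ioi le_rfl)]
  refine ENNReal.add_lt_top.2 ⟨?_, ?_⟩
  · have hi : IntegrableOn (fun t : ℝ => t ^ (p + k)) (Ioc 0 1) := by
      have := intervalIntegral.intervalIntegrable_rpow' (a := 0) (b := 1) hk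
      rwa [intervalIntegrable_iff_integrableOn_Ioc_of_le zero_le_one] at this
    refine lt_of_le_of_lt (setLIntegral_mono' measurableSet_Ioc fun t ht => ?_)
      hi.lintegral_lt_top
    rw [← ENNReal.ofReal_mul (Real.rpow_nonneg ht.1.le _), Real.rpow_add ht.1]
    exact ENNReal.ofReal_le_ofReal (mul_le_mul_of_nonneg_left (min_le_right _ _)
      (Real.rpow_nonneg ht.1.le _))
  · have hi : IntegrableOn (fun t : ℝ => t ^ p) (Ioi 1) :=
      integrableOn_Ioi_rpow_of_lt hp zero_lt_one
    refine lt_of_le_of_lt (setLIntegral_mono' measurableSet_Ioi fun t ht => ?_)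
      hi.lintegral_lt_top
    have ht' : (0 : ℝ) < t := zero_lt_one.trans ht
    rw [← ENNReal.ofReal_mul (Real.rpow_nonneg ht'.le _)]
    exact ENNReal.ofReal_le_ofReal (mul_le_of_le_one_right
      (Real.rpow_nonneg ht'.le _) (min_le_left _ _))

lemma lintegral_powMeasure_comp_div {s d : ℝ} (hd : 0 < d) (G : ℝ → ℝ≥0∞) :
    ∫⁻ t, G (t / d) ∂powMeasure (-1 - 2 * s) =
      ENNReal.ofReal d ^ (-2 * s) * ∫⁻ t, G t ∂powMeasure (-1 - 2 * s) := by
  have h := lintegral_powMeasure_comp_mul (inv_ne_zero hd.ne') (-1 - 2 * s) G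
  simp_rw [inv_mul_eq_div] at h
  rw [h, ENNReal.ofReal_rpow_of_pos hd, abs_of_pos (inv_pos.2 hd), Real.inv_rpow hd.le,
    ← Real.rpow_neg hd.le]
  congr 3
  ring

/-- The part of the line where `|t|` is at least comparable to `d` has `|t|^{-1-2s} dt` measure at
most `C d^{-2s}`. -/
lemma exists_powMeasure_le_far {s b : ℝ} (hs : 0 < s) (hb : 0 < b) :
    ∃ C : ℝ≥0∞, C ≠ ⊤ ∧ ∀ d : ℝ, 0 ≤ d →
      powMeasure (-1 - 2 * s) {t | d ≤ b * |t|} ≤ C * ENNReal.ofReal d ^ (-2 * s) := by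
  set A := ∫⁻ t, ENNReal.ofReal (min 1 (|t| ^ (2 * s + 1))) ∂powMeasure (-1 - 2 * s) with hA
  have hAt : A < ⊤ := lintegral_min_powMeasure_lt_top (by linarith) (by linarith)
  -- Where `d ≤ b|t|` one has `|t/d| ≥ 1/b`, so `K · min(1, |t/d|^{2s+1}) ≥ 1`. The exponent only
  -- has to exceed `2s`, for integrability at `0`.
  set K : ℝ := (min 1 ((b⁻¹) ^ (2 * s + 1)))⁻¹ with hK
  have hm : 0 < min 1 ((b⁻¹) ^ (2 * s + 1)) := by positivity
  -- The summand `1` keeps the constant nonzero: at `d = 0` the bound is `C * ⊤`, which has to be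
  -- `⊤`.
  refine ⟨ENNReal.ofReal K * A + 1, ENNReal.add_ne_top.2
    ⟨ENNReal.mul_ne_top ENNReal.ofReal_ne_top hAt.ne, by simp⟩, fun d hd => ?_⟩
  rcases hd.eq_or_lt with rfl | hd
  · rw [ENNReal.ofReal_zero, ENNReal.zero_rpow_of_neg (by linarith), ENNReal.mul_top (by simp)]
    exact le_top
  have h1 : powMeasure (-1 - 2 * s) {t | d ≤ b * |t|} ≤
      ∫⁻ t, ENNReal.ofReal K * ENNReal.ofReal (min 1 (|t / d| ^ (2 * s + 1)))
        ∂powMeasure (-1 - 2 * s) := by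
    have hmeas : MeasurableSet {t : ℝ | d ≤ b * |t|} :=
      measurableSet_le measurable_const (by fun_prop)
    rw [← lintegral_indicator_one hmeas]
    refine lintegral_mono fun t => ?_
    by_cases ht : d ≤ b * |t|
    · rw [indicator_of_mem (by exact ht), ← ENNReal.ofReal_mul (by positivity), Pi.one_apply,
        ← ENNReal.ofReal_one]
      refine ENNReal.ofReal_le_ofReal ?_
      rw [hK, inv_mul_eq_div, one_le_div hm]
      refine min_le_min le_rfl (Real.rpow_le_rpow (by positivity) ?_ (by linarith))
      rw [abs_div, abs_of_pos hd, inv_eq_one_div, div_le_div_iff₀ hb hd]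
      linarith
    · rw [indicator_of_notMem (by exact ht)]; exact zero_le
  refine h1.trans ?_
  rw [lintegral_const_mul' _ _ ENNReal.ofReal_ne_top, lintegral_powMeasure_comp_div hd
    (fun t => ENNReal.ofReal (min 1 (|t| ^ (2 * s + 1)))), mul_left_comm, mul_comm]
  gcongr
  exact le_self_add

/-- The fourth power comes from squaring the second difference of a cutoff; it is integrable against
`|t|^{-1-2s}` at the origin exactly when `s < 2`. -/
lemma exists_lintegral_powMeasure_le_near {s : ℝ} (hs : 0 < s) (hs2 : s < 2) :
    ∃ C : ℝ≥0∞, C ≠ ⊤ ∧ ∀ d : ℝ, 0 ≤ d →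
      ∫⁻ t, {t : ℝ | |t| < d}.indicator (fun t => ENNReal.ofReal ((|t| / d) ^ 4)) t
        ∂powMeasure (-1 - 2 * s) ≤ C * ENNReal.ofReal d ^ (-2 * s) := by
  set A := ∫⁻ t, ENNReal.ofReal (min 1 (|t| ^ (4 : ℝ))) ∂powMeasure (-1 - 2 * s) with hA
  have hAt : A < ⊤ := lintegral_min_powMeasure_lt_top (by linarith) (by linarith)
  refine ⟨A, hAt.ne, fun d hd => ?_⟩
  rcases hd.eq_or_lt with rfl | hd
  · have : {t : ℝ | |t| < 0} = ∅ := by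
      ext t; simp
    simp [this]
  have h1 : ∫⁻ t, {t : ℝ | |t| < d}.indicator (fun t => ENNReal.ofReal ((|t| / d) ^ 4)) t
        ∂powMeasure (-1 - 2 * s) ≤
      ∫⁻ t, ENNReal.ofReal (min 1 (|t / d| ^ (4 : ℝ))) ∂powMeasure (-1 - 2 * s) := by
    refine lintegral_mono (indicator_le' (fun t ht => ?_) (fun _ _ => zero_le))
    refine ENNReal.ofReal_le_ofReal ?_
    have hlt : |t| / d ≤ 1 := by rw [div_le_one hd]; exact le_of_lt ht
    rw [abs_div, abs_of_pos hd]
    refine le_min (pow_le_one₀ (by positivity) hlt) ?_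
    norm_cast
  refine h1.trans ?_
  rw [lintegral_powMeasure_comp_div hd (fun t => ENNReal.ofReal (min 1 (|t| ^ (4 : ℝ)))), mul_comm]

end TraceSpaces
end

noncomputable section
namespace TraceSpaces

open scoped FourierTransform RealInnerProductSpace

/-! ### Second differences and the Fourier transform -/

/-- The second difference `f(x+h) - 2 f(x) + f(x-h)`. -/
def sdiff {E : Type*} [AddGroup E] (f : E → ℂ) (h x : E) : ℂ := f (x + h) - 2 * f x + f (x - h)

/-- The symbol of the operator `f ↦ sdiff f h`, as a function of `⟪h, ξ⟫`. -/
def sdiffSymbol (a : ℝ) : ℝ := 2 * Real.cos (2 * Real.pi * a) - 2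

lemma sdiffSymbol_eq (a : ℝ) : sdiffSymbol a = -4 * Real.sin (Real.pi * a) ^ 2 := by
  rw [sdiffSymbol, show 2 * Real.pi * a = 2 * (Real.pi * a) by ring, Real.cos_two_mul,
    Real.sin_sq]
  ring

lemma continuous_sdiffSymbol : Continuous sdiffSymbol := by unfold sdiffSymbol; fun_prop

lemma abs_sdiffSymbol_le (a : ℝ) : |sdiffSymbol a| ≤ 4 := by
  rw [sdiffSymbol_eq, abs_mul, abs_of_nonneg (sq_nonneg (Real.sin _))]
  have := Real.sin_sq_le_one (Real.pi * a)
  norm_num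
  exact (sq_le_one_iff_abs_le_one _).1 this

lemma lintegral_enorm_sq {α : Type*} [MeasurableSpace α] {μ : Measure α} (f : Lp ℂ 2 μ) :
    ∫⁻ x, ‖f x‖ₑ ^ 2 ∂μ = ‖f‖ₑ ^ 2 := by
  rw [Lp.enorm_def, eLpNorm_eq_lintegral_rpow_enorm_toReal (by simp) (by simp)]
  simp only [ENNReal.toReal_ofNat, ENNReal.rpow_ofNat]
  rw [← ENNReal.rpow_natCast, ← ENNReal.rpow_mul]
  norm_num

section
variable {E : Type*} [NormedAddCommGroup E] [InnerProductSpace ℝ E] [FiniteDimensional ℝ E]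
  [MeasurableSpace E] [BorelSpace E]

/-- Translation on `L²`. -/
def translateL (h : E) : Lp ℂ 2 (volume : Measure E) →L[ℂ] Lp ℂ 2 (volume : Measure E) :=
  (Lp.compMeasurePreservingₗᵢ ℂ (fun x => x + h)
    (measurePreserving_add_right volume h)).toContinuousLinearMap

lemma coeFn_translateL (h : E) (f : Lp ℂ 2 (volume : Measure E)) :
    translateL h f =ᵐ[volume] fun x => f (x + h) :=
  Lp.coeFn_compMeasurePreserving f (measurePreserving_add_right volume h)

/-- Second differences on `L²`. -/
def sdiffL (h : E) : Lp ℂ 2 (volume : Measure E) →L[ℂ] Lp ℂ 2 (volume : Measure E) :=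
  translateL h - (2 : ℂ) • ContinuousLinearMap.id ℂ _ + translateL (-h)

lemma coeFn_sdiffL (h : E) (f : Lp ℂ 2 (volume : Measure E)) :
    sdiffL h f =ᵐ[volume] sdiff f h := by
  have : sdiffL h f = translateL h f - (2 : ℂ) • f + translateL (-h) f := rfl
  rw [this]
  filter_upwards [Lp.coeFn_add (translateL h f - (2 : ℂ) • f) (translateL (-h) f),
    Lp.coeFn_sub (translateL h f) ((2 : ℂ) • f), Lp.coeFn_smul (2 : ℂ) f, coeFn_translateL h f,
    coeFn_translateL (-h) f] with x h1 h2 h3 h4 h5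
  rw [h1, Pi.add_apply, h2, Pi.sub_apply, h3, h4, h5, sdiff]
  simp [sub_eq_add_neg]

lemma memLp_sdiffSymbol (h : E) :
    MemLp (fun ξ : E => (sdiffSymbol ⟪h, ξ⟫ : ℂ)) ⊤ volume := by
  refine memLp_top_of_bound (Continuous.aestronglyMeasurable ?_) 4
    (Filter.Eventually.of_forall fun ξ => ?_)
  · exact Complex.continuous_ofReal.comp (continuous_sdiffSymbol.comp (by fun_prop))
  · rw [Complex.norm_real]; exact abs_sdiffSymbol_le _

/-- The Schwartz function `sdiff f h`. -/
def sdiffSchwartz (h : E) (f : 𝓢(E, ℂ)) : 𝓢(E, ℂ) :=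
  f.compSubConstCLM ℂ (-h) + (-2 : ℂ) • f + f.compSubConstCLM ℂ h

lemma sdiffSchwartz_apply (h : E) (f : 𝓢(E, ℂ)) (x : E) :
    sdiffSchwartz h f x = sdiff f h x := by
  simp [sdiffSchwartz, sdiff, sub_eq_add_neg]

lemma fourier_compSubConst (h : E) (f : 𝓢(E, ℂ)) (ξ : E) :
    𝓕 (f.compSubConstCLM ℂ h) ξ = Real.fourierChar (-⟪h, ξ⟫) * 𝓕 f ξ := by
  rw [fourier_coe, fourier_coe]
  have := congrFun (VectorFourier.fourierIntegral_comp_add_right Real.fourierChar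
    (volume : Measure E) (innerₗ E) f (-h)) ξ
  rw [Real.fourier_eq, Real.fourier_eq]
  simp only [VectorFourier.fourierIntegral, Function.comp_def, innerₗ_apply_apply] at this
  simp only [compSubConstCLM_apply, sub_eq_add_neg]
  rw [this, inner_neg_left, Circle.smul_def, smul_eq_mul]

lemma fourier_sdiffSchwartz (h : E) (f : 𝓢(E, ℂ)) (ξ : E) :
    𝓕 (sdiffSchwartz h f) ξ = sdiffSymbol ⟪h, ξ⟫ * 𝓕 f ξ := by
  have h1 : 𝓕 (sdiffSchwartz h f) = 𝓕 (f.compSubConstCLM ℂ (-h)) + (-2 : ℂ) • 𝓕 f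
      + 𝓕 (f.compSubConstCLM ℂ h) := by
    rw [sdiffSchwartz, FourierTransform.fourier_add, FourierTransform.fourier_add,
      FourierTransform.fourier_smul]
  rw [h1]
  simp only [add_apply, smul_apply, fourier_compSubConst, inner_neg_left, neg_neg,
    Real.fourierChar_apply, smul_eq_mul]
  rw [sdiffSymbol]
  push_cast
  rw [Complex.cos]
  ring_nf

/-- Multiplication by the symbol of second differences. -/
def symbolL (h : E) : Lp ℂ 2 (volume : Measure E) →L[ℂ] Lp ℂ 2 (volume : Measure E) :=
  (ContinuousLinearMap.mul ℂ ℂ).holderL volume ⊤ 2 2 (memLp_sdiffSymbol h).toLp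

lemma coeFn_symbolL (h : E) (f : Lp ℂ 2 (volume : Measure E)) :
    symbolL h f =ᵐ[volume] fun ξ => (sdiffSymbol ⟪h, ξ⟫ : ℂ) * f ξ := by
  filter_upwards [(ContinuousLinearMap.mul ℂ ℂ).coeFn_holder (r := 2)
    (memLp_sdiffSymbol h).toLp f, (memLp_sdiffSymbol h).coeFn_toLp] with ξ h3 h4
  rw [symbolL, ContinuousLinearMap.holderL_apply_apply, h3, h4, ContinuousLinearMap.mul_apply']

lemma sdiffL_toLp (h : E) (g : 𝓢(E, ℂ)) : sdiffL h (g.toLp 2) = (sdiffSchwartz h g).toLp 2 := by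
  refine Lp.ext ?_
  have ha := (measurePreserving_add_right (volume : Measure E) h).quasiMeasurePreserving.tendsto_ae.eventually
    (g.coeFn_toLp 2 volume)
  have hb := (measurePreserving_sub_right (volume : Measure E) h).quasiMeasurePreserving.tendsto_ae.eventually
    (g.coeFn_toLp 2 volume)
  filter_upwards [coeFn_sdiffL h (g.toLp 2), (sdiffSchwartz h g).coeFn_toLp 2, g.coeFn_toLp 2,
    ha, hb] with x h1 h2 h3 h4 h5
  rw [h1, h2, sdiffSchwartz_apply, sdiff, sdiff, h3, h4, h5]

lemma symbolL_toLp (h : E) (g : 𝓢(E, ℂ)) :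
    symbolL h ((𝓕 g).toLp 2) = (𝓕 (sdiffSchwartz h g)).toLp 2 := by
  refine Lp.ext ?_
  filter_upwards [(𝓕 (sdiffSchwartz h g)).coeFn_toLp 2, (𝓕 g).coeFn_toLp 2,
    coeFn_symbolL h ((𝓕 g).toLp 2)] with ξ h1 h2 h3
  rw [h1, fourier_sdiffSchwartz, h3, h2]

lemma fourier_sdiffL (h : E) (f : Lp ℂ 2 (volume : Measure E)) :
    𝓕 (sdiffL h f) = symbolL h (𝓕 f) := by
  have hd : DenseRange (SchwartzMap.toLpCLM ℂ ℂ 2 (volume : Measure E)) :=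
    SchwartzMap.denseRange_toLpCLM ENNReal.ofNat_ne_top
  have hF : Continuous fun f : Lp ℂ 2 (volume : Measure E) => 𝓕 f :=
    (Lp.fourierTransformₗᵢ E ℂ).continuous
  have hc1 : Continuous fun f => 𝓕 (sdiffL h f) := hF.comp (sdiffL h).continuous
  have hc2 : Continuous fun f : Lp ℂ 2 (volume : Measure E) => symbolL h (𝓕 f) :=
    (symbolL h).continuous.comp hF
  refine hd.induction_on (p := fun f => 𝓕 (sdiffL h f) = symbolL h (𝓕 f)) f
    (isClosed_eq hc1 hc2) fun g => ?_
  rw [toLpCLM_apply, sdiffL_toLp, SchwartzMap.toLp_fourier_eq, SchwartzMap.toLp_fourier_eq,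
    symbolL_toLp]

/-- Plancherel for second differences. -/
lemma lintegral_sdiff (h : E) (f : Lp ℂ 2 (volume : Measure E)) :
    ∫⁻ x, ‖sdiff f h x‖ₑ ^ 2 =
      ∫⁻ ξ, ENNReal.ofReal (sdiffSymbol ⟪h, ξ⟫ ^ 2) * ‖(𝓕 f : Lp ℂ 2 (volume : Measure E)) ξ‖ₑ ^ 2 := by
  have h1 : ∫⁻ x, ‖sdiff f h x‖ₑ ^ 2 = ∫⁻ x, ‖sdiffL h f x‖ₑ ^ 2 :=
    lintegral_congr_ae ((coeFn_sdiffL h f).mono fun x hx => by simp only [hx])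
  have h2 : ‖sdiffL h f‖ₑ = ‖𝓕 (sdiffL h f)‖ₑ := by
    rw [enorm_eq_iff_norm_eq, Lp.norm_fourier_eq]
  rw [h1, lintegral_enorm_sq, h2, ← lintegral_enorm_sq, fourier_sdiffL]
  refine lintegral_congr_ae ?_
  filter_upwards [coeFn_symbolL h (𝓕 f)] with ξ h3
  rw [h3, enorm_mul, mul_pow]
  congr 1
  rw [← ofReal_norm, Complex.norm_real, ← ENNReal.ofReal_pow (norm_nonneg _), Real.norm_eq_abs,
    sq_abs]

end

end TraceSpaces
end

noncomputable section
namespace TraceSpaces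

open scoped FourierTransform RealInnerProductSpace

/-! ### The second difference seminorms -/

lemma sdiffSymbol_sq_le (t : ℝ) :
    sdiffSymbol t ^ 2 ≤ 16 * Real.pi ^ 4 * min 1 (|t| ^ (4 : ℝ)) := by
  have h1 : |Real.sin (Real.pi * t)| ≤ 1 := Real.abs_sin_le_one _
  have h2 : |Real.sin (Real.pi * t)| ≤ Real.pi * |t| := by
    have := Real.abs_sin_le_abs (x := Real.pi * t)
    rwa [abs_mul, abs_of_pos Real.pi_pos] at this
  have hs : sdiffSymbol t ^ 2 = 16 * |Real.sin (Real.pi * t)| ^ 4 := by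
    rw [sdiffSymbol_eq, show |Real.sin (Real.pi * t)| ^ 4 = (|Real.sin (Real.pi * t)| ^ 2) ^ 2 by
      ring, sq_abs]
    ring
  rw [hs, mul_assoc]
  refine mul_le_mul_of_nonneg_left ?_ (by norm_num)
  rcases min_choice 1 (|t| ^ (4 : ℝ)) with h | h <;> rw [h]
  · rw [mul_one]
    exact (pow_le_one₀ (abs_nonneg _) h1).trans
      (one_le_pow₀ (by linarith [Real.pi_gt_three]))
  · calc _ ≤ (Real.pi * |t|) ^ 4 := by gcongr
      _ = _ := by rw [mul_pow]; norm_cast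

/-- The constant `∫ 16 sin⁴(πt) |t|^{-1-2s} dt`. -/
def sdiffConst (s : ℝ) : ℝ≥0∞ :=
  ∫⁻ t, ENNReal.ofReal (sdiffSymbol t ^ 2) ∂powMeasure (-1 - 2 * s)

lemma measurable_sdiffSymbol_sq : Measurable fun t => ENNReal.ofReal (sdiffSymbol t ^ 2) :=
  (continuous_sdiffSymbol.pow 2).measurable.ennreal_ofReal

/-- The squared symbol vanishes to fourth order at `0`, which allows `s < 2`; first differences
would stop at `s < 1`. -/
lemma sdiffConst_ne_top {s : ℝ} (hs : 0 < s) (hs2 : s < 2) : sdiffConst s ≠ ⊤ := by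
  have h := lintegral_min_powMeasure_lt_top (p := -1 - 2 * s) (k := 4) (by linarith) (by linarith)
  refine ne_top_of_le_ne_top (b := ENNReal.ofReal (16 * Real.pi ^ 4) * _)
    (ENNReal.mul_ne_top ENNReal.ofReal_ne_top h.ne) ?_
  rw [← lintegral_const_mul' _ _ ENNReal.ofReal_ne_top]
  refine lintegral_mono fun t => ?_
  rw [← ENNReal.ofReal_mul (by positivity)]
  exact ENNReal.ofReal_le_ofReal (sdiffSymbol_sq_le t)

lemma sdiffConst_ne_zero (s : ℝ) : sdiffConst s ≠ 0 := by
  intro h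
  have hm : Measurable fun t => ENNReal.ofReal (|t| ^ (-1 - 2 * s)) *
      ENNReal.ofReal (sdiffSymbol t ^ 2) := (measurable_powWeight _).mul measurable_sdiffSymbol_sq
  rw [sdiffConst, lintegral_powMeasure, lintegral_eq_zero_iff hm] at h
  have h2 : ∀ᵐ t : ℝ, t ∉ Ioo (0 : ℝ) 1 := by
    filter_upwards [h] with t ht hmem
    have hsin : 0 < Real.sin (Real.pi * t) :=
      Real.sin_pos_of_pos_of_lt_pi (mul_pos Real.pi_pos hmem.1)
        (mul_lt_of_lt_one_right Real.pi_pos hmem.2)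
    have ht0 : 0 < |t| := abs_pos.2 hmem.1.ne'
    have hsym : 0 < sdiffSymbol t ^ 2 := by rw [sdiffSymbol_eq]; positivity
    simp only [Pi.zero_apply, mul_eq_zero, ENNReal.ofReal_eq_zero] at ht
    rcases ht with ht | ht
    · exact absurd ht (not_le.2 (by positivity))
    · exact absurd ht (not_le.2 hsym)
  have h3 : volume (Ioo (0 : ℝ) 1) = 0 := measure_eq_zero_iff_ae_notMem.2 h2
  simp at h3

section
variable {E : Type*} [NormedAddCommGroup E] [InnerProductSpace ℝ E] [FiniteDimensional ℝ E]
  [MeasurableSpace E] [BorelSpace E]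

/-- The Fourier transform on `L²`. -/
abbrev FL2 (f : Lp ℂ 2 (volume : Measure E)) : Lp ℂ 2 (volume : Measure E) := 𝓕 f

variable (E) in
/-- The measure `|t|^{-1-2s} dt dx` on `ℝ × E`. -/
def diffMeasure (s : ℝ) : Measure (ℝ × E) := (powMeasure (-1 - 2 * s)).prod volume

/-- The integral `∫∫ |f(x+te) - 2f(x) + f(x-te)|² |t|^{-1-2s} dx dt`. -/
def gagliardo (s : ℝ) (e : E) (f : E → ℂ) : ℝ≥0∞ :=
  ∫⁻ p, ‖sdiff f (p.1 • e) p.2‖ₑ ^ 2 ∂diffMeasure E s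

lemma measurable_sdiff {f : E → ℂ} (hf : Measurable f) (e : E) :
    Measurable fun p : ℝ × E => sdiff f (p.1 • e) p.2 := by
  unfold sdiff; fun_prop

lemma lintegral_diffMeasure (s : ℝ) {G : ℝ × E → ℝ≥0∞} (hG : Measurable G) :
    ∫⁻ p, G p ∂diffMeasure E s = ∫⁻ t, (∫⁻ x, G (t, x)) ∂powMeasure (-1 - 2 * s) :=
  lintegral_prod _ hG.aemeasurable

lemma lintegral_diffMeasure_symm (s : ℝ) {G : ℝ × E → ℝ≥0∞} (hG : Measurable G) :
    ∫⁻ p, G p ∂diffMeasure E s = ∫⁻ x, ∫⁻ t, G (t, x) ∂powMeasure (-1 - 2 * s) :=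
  lintegral_prod_symm _ hG.aemeasurable

lemma gagliardo_congr {s : ℝ} {e : E} {f g : E → ℂ} (hf : Measurable f) (hg : Measurable g)
    (h : f =ᵐ[volume] g) : gagliardo s e f = gagliardo s e g := by
  rw [gagliardo, gagliardo, lintegral_diffMeasure s ((measurable_sdiff hf e).enorm.pow_const 2),
    lintegral_diffMeasure s ((measurable_sdiff hg e).enorm.pow_const 2)]
  refine lintegral_congr fun t => lintegral_congr_ae ?_
  filter_upwards [h, (measurePreserving_add_right (volume : Measure E)
    (t • e)).quasiMeasurePreserving.tendsto_ae.eventually h, (measurePreserving_sub_right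
    (volume : Measure E) (t • e)).quasiMeasurePreserving.tendsto_ae.eventually h] with x h1 h2 h3
  simp only [sdiff, h1, h2, h3]

/-- Plancherel in `x`, then Tonelli; for fixed `ξ` the substitution `t ↦ ⟪e, ξ⟫ t` extracts the
factor `|⟪e, ξ⟫|^{2s}` and leaves a constant. -/
lemma gagliardo_eq {s : ℝ} (hs : 0 < s) (e : E) (f : Lp ℂ 2 (volume : Measure E)) :
    gagliardo s e f = sdiffConst s * ∫⁻ ξ, ENNReal.ofReal (|⟪e, ξ⟫| ^ (2 * s)) *
      ‖FL2 f ξ‖ₑ ^ 2 := by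
  have hgm : Measurable (FL2 f) := (Lp.stronglyMeasurable _).measurable
  have hfm : Measurable f := (Lp.stronglyMeasurable f).measurable
  rw [gagliardo, lintegral_diffMeasure s ((measurable_sdiff hfm e).enorm.pow_const 2)]
  have h1 : ∀ t : ℝ, ∫⁻ x, ‖sdiff f (t • e) x‖ₑ ^ 2 =
      ∫⁻ ξ, ENNReal.ofReal (sdiffSymbol ⟪t • e, ξ⟫ ^ 2) * ‖FL2 f ξ‖ₑ ^ 2 :=
    fun t => lintegral_sdiff (t • e) f
  simp_rw [h1]
  have hsm := continuous_sdiffSymbol.measurable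
  have hm : Measurable fun p : ℝ × E =>
      ENNReal.ofReal (sdiffSymbol ⟪p.1 • e, p.2⟫ ^ 2) * ‖FL2 f p.2‖ₑ ^ 2 := by
    fun_prop
  rw [lintegral_lintegral_swap hm.aemeasurable, ← lintegral_const_mul _ (by fun_prop)]
  refine lintegral_congr fun ξ => ?_
  rw [lintegral_mul_const _ (by fun_prop), ← mul_assoc]
  congr 1
  by_cases ha : ⟪e, ξ⟫ = 0
  · simp [inner_smul_left, ha, sdiffSymbol, Real.zero_rpow (mul_pos two_pos hs).ne']
  · have h2 := lintegral_powMeasure_comp_mul ha (-1 - 2 * s)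
      fun t => ENNReal.ofReal (sdiffSymbol t ^ 2)
    have h3 : ∀ t : ℝ, ⟪t • e, ξ⟫ = ⟪e, ξ⟫ * t := fun t => by
      rw [real_inner_smul_left, mul_comm]
    simp_rw [h3]
    rw [h2, mul_comm, sdiffConst]
    congr 4
    ring

end
end TraceSpaces
end

noncomputable section
namespace TraceSpaces

open scoped FourierTransform RealInnerProductSpace

/-! ### Elements of `H^s(ℝⁿ)`, `s ≥ 0`, as functions -/

namespace Sob
variable {n : ℕ} {s : ℝ}

/-- The element `𝓙^{-s} b` of `H^s(ℝⁿ)`. -/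
def ofBessel (s : ℝ) (b : Lp ℂ 2 (volume : Measure (Euc n))) : Sob n s :=
  ⟨besselPotential (Euc n) ℂ (-s) (Lp.toTemperedDistributionCLM ℂ volume 2 b), b, by simp⟩

lemma bessel_ofBessel (b : Lp ℂ 2 (volume : Measure (Euc n))) : bessel n s (ofBessel s b) = b :=
  toTemperedDistribution_injective (by
    rw [show bessel n s (ofBessel s b) = besselFun (ofBessel s b) from rfl, ← besselFun_spec]
    change besselPotential (Euc n) ℂ s (besselPotential (Euc n) ℂ (-s) _) = _
    simp)

/-- `𝓙^s` as an isometric isomorphism of `H^s(ℝⁿ)` with `L²`. -/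
def besselEquiv (n : ℕ) (s : ℝ) : Sob n s ≃ₗᵢ[ℂ] Lp ℂ 2 (volume : Measure (Euc n)) :=
  LinearIsometryEquiv.ofSurjective ⟨bessel n s, fun U => (norm_def U).symm⟩
    fun b => ⟨ofBessel s b, bessel_ofBessel b⟩

lemma hasTemperateGrowth_weight (r : ℝ) :
    Function.HasTemperateGrowth fun ξ : Euc n => (((1 + ‖ξ‖ ^ 2) ^ r : ℝ) : ℂ) := by
  fun_prop

lemma memLp_weight {r : ℝ} (hr : r ≤ 0) :
    MemLp (fun ξ : Euc n => (((1 + ‖ξ‖ ^ 2) ^ r : ℝ) : ℂ)) ⊤ volume := by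
  refine memLp_top_of_bound (hasTemperateGrowth_weight r).1.continuous.aestronglyMeasurable 1
    (Filter.Eventually.of_forall fun ξ => ?_)
  rw [Complex.norm_real, Real.norm_of_nonneg (by positivity)]
  exact Real.rpow_le_one_of_one_le_of_nonpos (by nlinarith [sq_nonneg ‖ξ‖]) hr

/-- For `s ≥ 0` the weight `(1+|ξ|²)^{-s/2}` is bounded, so undoing the Bessel potential on the
Fourier side stays in `L²`. -/
lemma exists_l2 (hs : 0 ≤ s) (U : Sob n s) : ∃ f : Lp ℂ 2 (volume : Measure (Euc n)),
    Lp.toTemperedDistributionCLM ℂ volume 2 f = toDistribution n s U ∧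
    FL2 f =ᵐ[volume] fun ξ => (((1 + ‖ξ‖ ^ 2) ^ (-s / 2) : ℝ) : ℂ) * FL2 (bessel n s U) ξ := by
  have hw := memLp_weight (n := n) (r := -s / 2) (by linarith)
  set g : Lp ℂ 2 (volume : Measure (Euc n)) := hw.toLp • FL2 (bessel n s U) with hg
  refine ⟨𝓕⁻ g, ?_, ?_⟩
  · have hinj : Function.Injective (fun T : 𝓢'(Euc n, ℂ) => 𝓕 T) := fun S T h => by
      have := congrArg (fun T : 𝓢'(Euc n, ℂ) => 𝓕⁻ T) h
      simpa using this
    refine hinj ?_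
    simp only
    rw [toDistribution_eq, fourier_besselPotential_eq_smulLeftCLM_fourier_apply,
      Lp.toTemperedDistributionCLM_apply, Lp.toTemperedDistributionCLM_apply,
      Lp.fourier_toTemperedDistribution_eq, Lp.fourier_toTemperedDistribution_eq,
      FourierTransform.fourier_fourierInv_eq, hg,
      Lp.toTemperedDistribution_smul_eq (hasTemperateGrowth_weight _)]
  · rw [FL2, FourierTransform.fourier_fourierInv_eq, hg]
    filter_upwards [Lp.coeFn_lpSMul (r := 2) hw.toLp (FL2 (bessel n s U)), hw.coeFn_toLp]
      with ξ h1 h2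
    rw [h1, Pi.smul_apply', h2, smul_eq_mul]

lemma exists_toL2 (hs : 0 ≤ s) :
    ∃ T : Sob n s →ₗ[ℂ] Lp ℂ 2 (volume : Measure (Euc n)), ∀ U,
      Lp.toTemperedDistributionCLM ℂ volume 2 (T U) = toDistribution n s U ∧
      FL2 (T U) =ᵐ[volume]
        fun ξ => (((1 + ‖ξ‖ ^ 2) ^ (-s / 2) : ℝ) : ℂ) * FL2 (bessel n s U) ξ := by
  choose T hT using exists_l2 (n := n) hs
  refine ⟨⟨⟨T, fun U V => toTemperedDistribution_injective ?_⟩,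
    fun c U => toTemperedDistribution_injective ?_⟩, hT⟩
  · rw [map_add, (hT _).1, (hT _).1, (hT _).1, map_add]
  · simp only
    rw [map_smul, (hT _).1, (hT _).1, map_smul, RingHom.id_apply]

/-- The `L²` function underlying `U ∈ H^s(ℝⁿ)`, `s ≥ 0`. -/
def toL2 (hs : 0 ≤ s) : Sob n s →ₗ[ℂ] Lp ℂ 2 (volume : Measure (Euc n)) :=
  (exists_toL2 hs).choose

lemma toL2_spec (hs : 0 ≤ s) (U : Sob n s) :
    Lp.toTemperedDistributionCLM ℂ volume 2 (toL2 hs U) = toDistribution n s U :=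
  ((exists_toL2 hs).choose_spec U).1

lemma toDistribution_apply (hs : 0 ≤ s) (U : Sob n s) (ψ : 𝓢(Euc n, ℂ)) :
    toDistribution n s U ψ = ∫ x, ψ x * toL2 hs U x := by
  rw [← toL2_spec hs, Lp.toTemperedDistributionCLM_apply, Lp.toTemperedDistribution_apply]
  rfl

lemma fourier_toL2 (hs : 0 ≤ s) (U : Sob n s) : FL2 (toL2 hs U) =ᵐ[volume]
    fun ξ => (((1 + ‖ξ‖ ^ 2) ^ (-s / 2) : ℝ) : ℂ) * FL2 (bessel n s U) ξ :=
  ((exists_toL2 hs).choose_spec U).2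

lemma enorm_sq_eq (hs : 0 ≤ s) (U : Sob n s) : ‖U‖ₑ ^ 2 =
    ∫⁻ ξ, ENNReal.ofReal ((1 + ‖ξ‖ ^ 2) ^ s) * ‖FL2 (toL2 hs U) ξ‖ₑ ^ 2 := by
  have h1 : ‖U‖ₑ = ‖FL2 (bessel n s U)‖ₑ := by
    rw [enorm_eq_iff_norm_eq, FL2, Lp.norm_fourier_eq, norm_def]
  rw [h1, ← lintegral_enorm_sq]
  refine lintegral_congr_ae ?_
  filter_upwards [fourier_toL2 hs U] with ξ hξ
  rw [hξ, enorm_mul, mul_pow, ← mul_assoc, ← ofReal_norm (Complex.ofReal _), Complex.norm_real,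
    Real.norm_of_nonneg (by positivity), ← ENNReal.ofReal_pow (by positivity),
    ← ENNReal.ofReal_mul (by positivity), ← Real.rpow_mul_natCast (by positivity),
    ← Real.rpow_add (by positivity)]
  norm_num

lemma enorm_toL2_le (hs : 0 ≤ s) (U : Sob n s) : ‖toL2 hs U‖ₑ ≤ ‖U‖ₑ := by
  have h : ‖toL2 hs U‖ₑ ^ 2 ≤ ‖U‖ₑ ^ 2 := by
    have h1 : ‖toL2 hs U‖ₑ = ‖FL2 (toL2 hs U)‖ₑ := by
      rw [enorm_eq_iff_norm_eq, FL2, Lp.norm_fourier_eq]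
    rw [h1, ← lintegral_enorm_sq, enorm_sq_eq hs]
    refine lintegral_mono fun ξ => le_mul_of_one_le_left' ?_
    rw [ENNReal.one_le_ofReal]
    exact Real.one_le_rpow (by nlinarith [sq_nonneg ‖ξ‖]) hs
  exact (ENNReal.pow_le_pow_left_iff two_ne_zero).1 h

lemma toL2_injective (hs : 0 ≤ s) : Function.Injective (toL2 (n := n) hs) := fun U V h =>
  toDistribution_injective (by rw [← toL2_spec hs, h, toL2_spec hs])

lemma continuous_toL2 (hs : 0 ≤ s) : Continuous (toL2 (n := n) hs) :=
  AddMonoidHomClass.continuous_of_bound (toL2 hs) 1 fun U => by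
    rw [one_mul, ← toReal_enorm, ← toReal_enorm U]
    exact ENNReal.toReal_mono (by simp) (enorm_toL2_le hs U)

lemma exists_toL2_eq (hs : 0 ≤ s) (f : Lp ℂ 2 (volume : Measure (Euc n)))
    (hf : ∫⁻ ξ, ENNReal.ofReal ((1 + ‖ξ‖ ^ 2) ^ s) * ‖FL2 f ξ‖ₑ ^ 2 ≠ ⊤) :
    ∃ U : Sob n s, toL2 hs U = f := by
  set g : Euc n → ℂ := fun ξ => (((1 + ‖ξ‖ ^ 2) ^ (s / 2) : ℝ) : ℂ) * FL2 f ξ with hg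
  have hgL : MemLp g 2 volume := by
    refine ⟨(hasTemperateGrowth_weight _).1.continuous.aestronglyMeasurable.mul
      (Lp.aestronglyMeasurable _), ?_⟩
    rw [eLpNorm_lt_top_iff_lintegral_rpow_enorm_lt_top (by simp) (by simp)]
    refine lt_of_eq_of_lt (lintegral_congr fun ξ => ?_) hf.lt_top
    simp only [ENNReal.toReal_ofNat, ENNReal.rpow_ofNat]
    rw [hg, enorm_mul, mul_pow, ← ofReal_norm, Complex.norm_real,
      Real.norm_of_nonneg (by positivity), ← ENNReal.ofReal_pow (by positivity),
      ← Real.rpow_natCast, ← Real.rpow_mul (by positivity)]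
    norm_num
  refine ⟨ofBessel s (𝓕⁻ hgL.toLp), ?_⟩
  have hF : FL2 (toL2 hs (ofBessel s (𝓕⁻ hgL.toLp))) = FL2 f := by
    refine Lp.ext ?_
    have h1 := fourier_toL2 hs (ofBessel s (𝓕⁻ hgL.toLp))
    rw [bessel_ofBessel, FL2, FL2, FourierTransform.fourier_fourierInv_eq] at h1
    filter_upwards [h1, hgL.coeFn_toLp] with ξ h2 h3
    rw [h2, h3, hg]
    simp only
    rw [← mul_assoc, ← Complex.ofReal_mul, ← Real.rpow_add (by positivity)]
    rw [show -s / 2 + s / 2 = 0 by ring]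
    simp
  exact (Lp.fourierTransformₗᵢ (Euc n) ℂ).injective hF

end Sob
end TraceSpaces
end

noncomputable section
namespace TraceSpaces

open scoped FourierTransform RealInnerProductSpace

/-! ### `H^s(ℝⁿ)`, `0 < s < 2`, by second differences -/

/-- The `i`-th unit vector. -/
def unitVec {n : ℕ} (i : Fin n) : Euc n := EuclideanSpace.single i 1

lemma norm_unitVec {n : ℕ} (i : Fin n) : ‖unitVec i‖ = 1 := by simp [unitVec]

lemma inner_unitVec {n : ℕ} (i : Fin n) (ξ : Euc n) : ⟪unitVec i, ξ⟫ = ξ i := by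
  simp [unitVec, EuclideanSpace.inner_single_left]

namespace Sob
variable {n : ℕ} {s : ℝ}

lemma gagliardo_toL2_le (hs : 0 < s) (U : Sob n s) {e : Euc n} (he : ‖e‖ ≤ 1) :
    gagliardo s e (toL2 hs.le U) ≤ sdiffConst s * ‖U‖ₑ ^ 2 := by
  rw [gagliardo_eq hs, enorm_sq_eq hs.le]
  gcongr with ξ
  have h1 : |⟪e, ξ⟫| ≤ ‖ξ‖ :=
    (abs_real_inner_le_norm _ _).trans (mul_le_of_le_one_left (norm_nonneg _) he)
  calc |⟪e, ξ⟫| ^ (2 * s) = (|⟪e, ξ⟫| ^ 2) ^ s := by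
        rw [← Real.rpow_natCast_mul (abs_nonneg _)]; norm_num
    _ ≤ (1 + ‖ξ‖ ^ 2) ^ s := by
        refine Real.rpow_le_rpow (by positivity) ?_ hs.le
        nlinarith [pow_le_pow_left₀ (abs_nonneg _) h1 2]

lemma weight_le (hs : 0 < s) (ξ : Euc n) : (1 + ‖ξ‖ ^ 2) ^ s ≤
    (n + 1 : ℝ) ^ s * (1 + ∑ i, |⟪unitVec i, ξ⟫| ^ (2 * s)) := by
  simp_rw [inner_unitVec]
  have hn : ‖ξ‖ ^ 2 = ∑ i, |ξ i| ^ 2 := by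
    rw [EuclideanSpace.norm_sq_eq]; simp
  -- `m` is the maximum of `1` and all `|ξ i|^2`.
  obtain ⟨m, hm1, hm2, hm3⟩ : ∃ m : ℝ, 1 ≤ m ∧ (∀ i, |ξ i| ^ 2 ≤ m) ∧
      m ^ s ≤ 1 + ∑ i, |ξ i| ^ (2 * s) := by
    have hpow : ∀ i, (|ξ i| ^ 2) ^ s = |ξ i| ^ (2 * s) := fun i => by
      rw [← Real.rpow_natCast_mul (abs_nonneg _)]; norm_num
    have hsum : ∀ i, |ξ i| ^ (2 * s) ≤ ∑ i, |ξ i| ^ (2 * s) := fun i =>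
      Finset.single_le_sum (f := fun i => |ξ i| ^ (2 * s)) (fun i _ => by positivity)
        (Finset.mem_univ i)
    have hnn : 0 ≤ ∑ i, |ξ i| ^ (2 * s) := Finset.sum_nonneg fun i _ => by positivity
    by_cases h : ∀ i, |ξ i| ^ 2 ≤ 1
    · exact ⟨1, le_rfl, h, by rw [Real.one_rpow]; linarith⟩
    · push Not at h
      obtain ⟨j, hj⟩ := h
      obtain ⟨i, -, hi⟩ := Finset.exists_max_image Finset.univ (fun i => |ξ i| ^ 2) ⟨j, by simp⟩
      refine ⟨|ξ i| ^ 2, hj.le.trans (hi j (by simp)), fun k => hi k (by simp), ?_⟩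
      rw [hpow]
      linarith [hsum i]
  have h2 : 1 + ‖ξ‖ ^ 2 ≤ (n + 1) * m := by
    rw [hn]
    have : ∑ i, |ξ i| ^ 2 ≤ ∑ _i : Fin n, m := Finset.sum_le_sum fun i _ => hm2 i
    simp only [Finset.sum_const, Finset.card_univ, Fintype.card_fin, nsmul_eq_mul] at this
    linarith
  calc (1 + ‖ξ‖ ^ 2) ^ s ≤ ((n + 1) * m) ^ s := Real.rpow_le_rpow (by positivity) h2 hs.le
    _ = (n + 1 : ℝ) ^ s * m ^ s := Real.mul_rpow (by positivity) (by positivity)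
    _ ≤ _ := mul_le_mul_of_nonneg_left hm3 (by positivity)

/-- The criterion by which mollified and truncated functions are recognised as elements of `H^s` and
bounded there: finite second differences along the axes control the full Fourier weight. -/
lemma exists_toL2_eq_of_gagliardo (n : ℕ) (hs : 0 < s) (hs2 : s < 2) :
    ∃ C : ℝ≥0∞, C ≠ ⊤ ∧ ∀ f : Lp ℂ 2 (volume : Measure (Euc n)),
      ‖f‖ₑ ^ 2 + ∑ i, gagliardo s (unitVec i) f ≠ ⊤ →
      ∃ U : Sob n s, toL2 hs.le U = f ∧
        ‖U‖ₑ ^ 2 ≤ C * (‖f‖ₑ ^ 2 + ∑ i, gagliardo s (unitVec i) f) := by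
  have hc0 := sdiffConst_ne_zero s
  have hct := sdiffConst_ne_top hs hs2
  set K : ℝ≥0∞ := ENNReal.ofReal ((n + 1 : ℝ) ^ s)
  refine ⟨K * (1 + (sdiffConst s)⁻¹), ENNReal.mul_ne_top ENNReal.ofReal_ne_top
    (ENNReal.add_ne_top.2 ⟨by simp, ENNReal.inv_ne_top.2 hc0⟩), fun f hf => ?_⟩
  have hfm : Measurable (FL2 f) := (Lp.stronglyMeasurable _).measurable
  have key : ∫⁻ ξ, ENNReal.ofReal ((1 + ‖ξ‖ ^ 2) ^ s) * ‖FL2 f ξ‖ₑ ^ 2 ≤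
      K * (1 + (sdiffConst s)⁻¹) * (‖f‖ₑ ^ 2 + ∑ i, gagliardo s (unitVec i) f) := by
    have h1 : ∀ ξ, ENNReal.ofReal ((1 + ‖ξ‖ ^ 2) ^ s) * ‖FL2 f ξ‖ₑ ^ 2 ≤
        K * (‖FL2 f ξ‖ₑ ^ 2 + ∑ i, ENNReal.ofReal (|⟪unitVec i, ξ⟫| ^ (2 * s)) *
          ‖FL2 f ξ‖ₑ ^ 2) := fun ξ => by
      rw [← Finset.sum_mul, ← one_add_mul, ← mul_assoc]
      gcongr
      rw [← ENNReal.ofReal_sum_of_nonneg (fun i _ => by positivity), ← ENNReal.ofReal_one,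
        ← ENNReal.ofReal_add zero_le_one (Finset.sum_nonneg fun i _ => by positivity),
        ← ENNReal.ofReal_mul (by positivity)]
      exact ENNReal.ofReal_le_ofReal (weight_le hs ξ)
    refine (lintegral_mono h1).trans ?_
    rw [lintegral_const_mul' _ _ ENNReal.ofReal_ne_top, lintegral_add_left (by fun_prop),
      lintegral_finsetSum _ (fun i _ => by fun_prop), mul_assoc]
    gcongr
    have h2 : ∫⁻ ξ, ‖FL2 f ξ‖ₑ ^ 2 = ‖f‖ₑ ^ 2 := by
      rw [lintegral_enorm_sq]
      congr 1
      rw [enorm_eq_iff_norm_eq, FL2, Lp.norm_fourier_eq]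
    have h3 : ∀ i, ∫⁻ ξ, ENNReal.ofReal (|⟪unitVec i, ξ⟫| ^ (2 * s)) * ‖FL2 f ξ‖ₑ ^ 2 =
        (sdiffConst s)⁻¹ * gagliardo s (unitVec i) f := fun i => by
      rw [gagliardo_eq hs, ← mul_assoc, ENNReal.inv_mul_cancel hc0 hct, one_mul]
    rw [h2]
    simp_rw [h3]
    rw [← Finset.mul_sum, add_mul, one_mul, mul_add]
    exact add_le_add le_self_add le_add_self
  obtain ⟨U, hU⟩ := exists_toL2_eq hs.le f (ne_top_of_le_ne_top (ENNReal.mul_ne_top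
    (ENNReal.mul_ne_top ENNReal.ofReal_ne_top
    (ENNReal.add_ne_top.2 ⟨by simp, ENNReal.inv_ne_top.2 hc0⟩)) hf) key)
  refine ⟨U, hU, ?_⟩
  rw [enorm_sq_eq hs.le, hU]
  exact key

end Sob

/-! ### Weak limits -/

/-- Banach–Alaoglu through the Riesz identification. A limit along an ultrafilter suffices, because
only functionals that already converge along the whole sequence are evaluated. The limit stays in
`K` because `K = Kᗮᗮ`. -/
lemma exists_weak_limit {H : Type*} [NormedAddCommGroup H] [InnerProductSpace ℂ H]
    [CompleteSpace H] (K : Submodule ℂ H) (hK : IsClosed (K : Set H)) (b : ℕ → H)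
    (hb : ∀ k, b k ∈ K) (C : ℝ) (hC : ∀ k, ‖b k‖ ≤ C) :
    ∃ x ∈ K, ∀ (l : H →L[ℂ] ℂ) (c : ℂ),
      Filter.Tendsto (fun k => l (b k)) Filter.atTop (nhds c) → l x = c := by
  have hcomp := WeakDual.isCompact_closedBall (𝕜 := ℂ) (0 : StrongDual ℂ H) C
  set y : ℕ → WeakDual ℂ H := fun k =>
    StrongDual.toWeakDual (InnerProductSpace.toDual ℂ H (b k)) with hy
  have hyC : ∀ k, y k ∈ WeakDual.toStrongDual ⁻¹' Metric.closedBall (0 : StrongDual ℂ H) C := by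
    intro k
    rw [mem_preimage, mem_closedBall_zero_iff]
    exact (LinearIsometryEquiv.norm_map (InnerProductSpace.toDual ℂ H) (b k)).trans_le (hC k)
  obtain ⟨z, -, hz⟩ := hcomp.exists_mapClusterPt (f := Filter.atTop) (u := y)
    (Filter.tendsto_principal.2 (Filter.Eventually.of_forall hyC))
  obtain ⟨G, hG, hGz⟩ := mapClusterPt_iff_ultrafilter.1 hz
  set x : H := (InnerProductSpace.toDual ℂ H).symm (WeakDual.toStrongDual z) with hx
  have hlim : ∀ w, Filter.Tendsto (fun k => inner ℂ (b k) w) G (nhds (inner ℂ x w)) := by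
    intro w
    have h1 := ((WeakDual.eval_continuous w).tendsto z).comp hGz
    have h2 : inner ℂ x w = z w := by
      rw [hx, InnerProductSpace.toDual_symm_apply]; rfl
    rw [h2]
    exact h1
  refine ⟨x, ?_, fun l c hl => ?_⟩
  · have : CompleteSpace K := hK.completeSpace_coe
    rw [← Submodule.orthogonal_orthogonal K, Submodule.mem_orthogonal']
    intro w hw
    have h0 : ∀ k, inner ℂ (b k) w = 0 := fun k => (Submodule.mem_orthogonal _ _).1 hw _ (hb k)
    have := hlim w
    simp_rw [h0] at this
    exact tendsto_nhds_unique this tendsto_const_nhds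
  · set w := (InnerProductSpace.toDual ℂ H).symm l with hw
    have hlw : ∀ v, l v = (starRingEnd ℂ) (inner ℂ v w) := fun v => by
      rw [inner_conj_symm, hw, InnerProductSpace.toDual_symm_apply]
    have h1 := (Complex.continuous_conj.tendsto _).comp (hlim w)
    rw [← hlw] at h1
    refine tendsto_nhds_unique h1 ?_
    refine (hl.mono_left hG).congr fun k => ?_
    exact hlw _

lemma Sob.exists_weak_limit {n : ℕ} {s : ℝ} (K : Submodule ℂ (Sob n s))
    (hK : IsClosed (K : Set (Sob n s))) (V : ℕ → Sob n s) (hV : ∀ k, V k ∈ K) (C : ℝ)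
    (hC : ∀ k, ‖V k‖ ≤ C) :
    ∃ W ∈ K, ∀ (ψ : 𝓢(Euc n, ℂ)) (c : ℂ), Filter.Tendsto
      (fun k => Sob.toDistribution n s (V k) ψ) Filter.atTop (nhds c) →
        Sob.toDistribution n s W ψ = c := by
  set J := besselEquiv n s
  obtain ⟨x, hx, hlim⟩ := TraceSpaces.exists_weak_limit (K.map (J.toLinearEquiv : Sob n s →ₗ[ℂ] _))
    (by
      exact J.toHomeomorph.isClosedMap _ hK)
    (fun k => J (V k)) (fun k => ⟨V k, hV k, rfl⟩) C
    (fun k => (J.norm_map (V k)).trans_le (hC k))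
  obtain ⟨W, hW, rfl⟩ := hx
  refine ⟨W, hW, fun ψ c hψ => ?_⟩
  let l : Lp ℂ 2 (volume : Measure (Euc n)) →L[ℂ] ℂ :=
    { toFun := fun b => Sob.toDistribution n s (J.symm b) ψ
      map_add' := fun a b => by rw [map_add, map_add]; rfl
      map_smul' := fun c b => by rw [map_smul, map_smul]; rfl
      cont := ((PointwiseConvergenceCLM.evalCLM _ _ ψ).continuous.comp
        Sob.continuous_toDistribution).comp J.symm.continuous }
  have hl : ∀ U, l (J U) = Sob.toDistribution n s U ψ := fun U => by
    change Sob.toDistribution n s (J.symm (J U)) ψ = _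
    rw [J.symm_apply_apply]
  rw [← hl]
  exact hlim l c (hψ.congr fun k => (hl _).symm)

end TraceSpaces
end

noncomputable section
namespace TraceSpaces

open scoped FourierTransform RealInnerProductSpace

/-! ### Mollification -/

lemma lintegral_mul_sq_le {α : Type*} [MeasurableSpace α] (μ : Measure α) {f g : α → ℝ≥0∞}
    (hf : AEMeasurable f μ) (hg : AEMeasurable g μ) :
    (∫⁻ x, f x * g x ∂μ) ^ 2 ≤ (∫⁻ x, f x ^ 2 ∂μ) * ∫⁻ x, g x ^ 2 ∂μ := by
  have h := ENNReal.lintegral_mul_le_Lp_mul_Lq μ (p := 2) (q := 2) .two_two hf hg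
  simp only [ENNReal.rpow_ofNat] at h
  refine (pow_le_pow_left' h 2).trans_eq ?_
  rw [mul_pow, ← ENNReal.rpow_mul_natCast, ← ENNReal.rpow_mul_natCast]
  norm_num

section
variable {n : ℕ}

open scoped Convolution

/-- The mollification of `f` by the bump function `φ`. -/
def mollify (φ : ContDiffBump (0 : Euc n)) (f : Euc n → ℂ) : Euc n → ℂ :=
  φ.normed volume ⋆[ContinuousLinearMap.lsmul ℝ ℝ, volume] f

lemma mollify_apply (φ : ContDiffBump (0 : Euc n)) (f : Euc n → ℂ) (x : Euc n) :
    mollify φ f x = ∫ y, φ.normed volume y • f (x - y) := rfl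

lemma integrable_mollify (φ : ContDiffBump (0 : Euc n)) {f : Euc n → ℂ}
    (hf : LocallyIntegrable f) (x : Euc n) :
    Integrable fun y => φ.normed volume y • f (x - y) :=
  HasCompactSupport.convolutionExists_left (ContinuousLinearMap.lsmul ℝ ℝ)
    φ.hasCompactSupport_normed (φ.contDiff_normed (n := 0)).continuous hf x

lemma contDiff_mollify (φ : ContDiffBump (0 : Euc n)) {f : Euc n → ℂ}
    (hf : LocallyIntegrable f) : ContDiff ℝ (⊤ : ℕ∞) (mollify φ f) :=
  HasCompactSupport.contDiff_convolution_left _ φ.hasCompactSupport_normed φ.contDiff_normed hf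

lemma sdiff_mollify (φ : ContDiffBump (0 : Euc n)) {f : Euc n → ℂ}
    (hf : LocallyIntegrable f) (h : Euc n) :
    sdiff (mollify φ f) h = mollify φ (sdiff f h) := by
  ext x
  have h1 := integrable_mollify φ hf (x + h)
  have h2 := integrable_mollify φ hf x
  have h3 := integrable_mollify φ hf (x - h)
  have h4 : Integrable fun y => φ.normed volume y • f (x + h - y) -
    2 * φ.normed volume y • f (x - y) := h1.sub (h2.const_mul 2)
  rw [sdiff, mollify_apply, mollify_apply, mollify_apply, mollify_apply, ← integral_const_mul,
    ← integral_sub h1 (h2.const_mul 2), ← integral_add h4 h3]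
  refine integral_congr_ae (Filter.Eventually.of_forall fun y => ?_)
  simp only [sdiff, Complex.real_smul]
  rw [show x + h - y = x - y + h by abel, show x - h - y = x - y - h by abel]
  ring

/-- The kernel is a probability density: Cauchy–Schwarz against it, then Tonelli. Since second
differences commute with mollification (`sdiff_mollify`), the same contraction holds for
`gagliardo`. -/
lemma lintegral_mollify_le (φ : ContDiffBump (0 : Euc n)) {f : Euc n → ℂ} (hf : Measurable f) :
    ∫⁻ x, ‖mollify φ f x‖ₑ ^ 2 ≤ ∫⁻ x, ‖f x‖ₑ ^ 2 := by
  set w : Euc n → ℝ≥0∞ := fun y => ENNReal.ofReal (φ.normed volume y) with hw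
  have hwm : Measurable w := (φ.contDiff_normed (n := 0)).continuous.measurable.ennreal_ofReal
  have hw1 : ∫⁻ y, w y = 1 := by
    rw [hw, ← ofReal_integral_eq_lintegral_ofReal φ.integrable_normed
      (Filter.Eventually.of_forall fun y => φ.nonneg_normed y), φ.integral_normed,
      ENNReal.ofReal_one]
  have h1 : ∀ x, ‖mollify φ f x‖ₑ ^ 2 ≤ ∫⁻ y, w y * ‖f (x - y)‖ₑ ^ 2 := by
    intro x
    have h2 : ‖mollify φ f x‖ₑ ≤ ∫⁻ y, ‖f (x - y)‖ₑ ∂(volume.withDensity w) := by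
      rw [lintegral_withDensity_eq_lintegral_mul _ hwm (by fun_prop), mollify_apply]
      refine (enorm_integral_le_lintegral_enorm _).trans_eq (lintegral_congr fun y => ?_)
      rw [enorm_smul, Real.enorm_of_nonneg (φ.nonneg_normed y)]
      rfl
    have h3 := lintegral_mul_sq_le (volume.withDensity w) (f := fun _ => 1)
      (g := fun y => ‖f (x - y)‖ₑ) aemeasurable_const (by fun_prop)
    simp only [one_mul, one_pow, lintegral_one] at h3
    rw [withDensity_apply _ MeasurableSet.univ, Measure.restrict_univ, hw1, one_mul] at h3
    refine (pow_le_pow_left' h2 2).trans (h3.trans_eq ?_)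
    rw [lintegral_withDensity_eq_lintegral_mul _ hwm (by fun_prop)]
    rfl
  refine (lintegral_mono h1).trans ?_
  rw [lintegral_lintegral_swap (by fun_prop)]
  have h4 : ∀ y, ∫⁻ x, w y * ‖f (x - y)‖ₑ ^ 2 = w y * ∫⁻ x, ‖f x‖ₑ ^ 2 := fun y => by
    rw [lintegral_const_mul _ (by fun_prop),
      lintegral_sub_right_eq_self (fun x => ‖f x‖ₑ ^ 2) y]
  simp_rw [h4]
  rw [lintegral_mul_const _ hwm, hw1, one_mul]

/-- The pairing is the mollification at `0` of `A y = ∫ ψ(x) f(x + y) dx`, and `A` is continuous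
because the translation can be moved onto `ψ`. -/
lemma tendsto_integral_mollify {φ : ℕ → ContDiffBump (0 : Euc n)}
    (hφ : Filter.Tendsto (fun k => (φ k).rOut) Filter.atTop (nhds 0)) {f : Euc n → ℂ}
    (hf : Integrable f) (ψ : 𝓢(Euc n, ℂ)) :
    Filter.Tendsto (fun k => ∫ x, ψ x * mollify (φ k) f x) Filter.atTop
      (nhds (∫ x, ψ x * f x)) := by
  obtain ⟨M, hM⟩ : ∃ M, ∀ x, ‖ψ x‖ ≤ M :=
    ⟨_, fun x => SchwartzMap.norm_le_seminorm ℂ ψ x⟩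
  set A : Euc n → ℂ := fun y => ∫ x, ψ x * f (x + y) with hA
  have hA' : ∀ y, A y = ∫ x, ψ (x - y) * f x := fun y => by
    rw [← integral_add_right_eq_self (fun x => ψ (x - y) * f x) y]
    simp [hA]
  have hAc : Continuous A := by
    rw [show A = fun y => ∫ x, ψ (x - y) * f x from funext hA']
    refine continuous_of_dominated (bound := fun x => M * ‖f x‖) (fun y => ?_) (fun y => ?_)
      (hf.norm.const_mul M) (Filter.Eventually.of_forall fun x => ?_)
    · exact (by fun_prop : Continuous fun x => ψ (x - y)).aestronglyMeasurable.mul hf.1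
    · refine Filter.Eventually.of_forall fun x => ?_
      rw [norm_mul]
      exact mul_le_mul_of_nonneg_right (hM _) (norm_nonneg _)
    · fun_prop
  have h1 := ContDiffBump.convolution_tendsto_right_of_continuous (μ := volume) hφ hAc 0
  have h2 : A 0 = ∫ x, ψ x * f x := by simp [hA]
  rw [h2] at h1
  refine h1.congr fun k => ?_
  change ∫ y, (φ k).normed volume y • A (0 - y) = _
  simp_rw [hA, ← integral_smul, mollify_apply, ← integral_const_mul]
  rw [integral_integral_swap]
  · refine integral_congr_ae (Filter.Eventually.of_forall fun x => ?_)
    refine integral_congr_ae (Filter.Eventually.of_forall fun y => ?_)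
    simp only [Complex.real_smul, zero_sub, ← sub_eq_add_neg]
    ring
  · have h3 := (Integrable.convolution_integrand (ContinuousLinearMap.lsmul ℝ ℝ)
      ((φ k).integrable_normed (μ := (volume : Measure (Euc n)))) hf).swap
    have h4 : Integrable (fun p : Euc n × Euc n => ψ p.2 * ((φ k).normed volume p.1 •
        f (p.2 - p.1))) (volume.prod volume) :=
      Integrable.bdd_mul (c := M) h3
        (by fun_prop : Continuous fun p : Euc n × Euc n => ψ p.2).aestronglyMeasurable
        (Filter.Eventually.of_forall fun p => hM _)
    refine h4.congr (Filter.Eventually.of_forall fun p => ?_)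
    simp only [Function.uncurry, Complex.real_smul, zero_sub, ← sub_eq_add_neg]
    ring

/-- A bump function of radius `1 / (k + 1)`. -/
def smallBump (n k : ℕ) : ContDiffBump (0 : Euc n) where
  rIn := 1 / (k + 1) / 2
  rOut := 1 / (k + 1)
  rIn_pos := by positivity
  rIn_lt_rOut := half_lt_self (by positivity)

lemma exists_testFunction_mollify {Ω : Opens (Euc n)} {K : Set (Euc n)} (hK : IsCompact K)
    (hKΩ : K ⊆ Ω) {f : Euc n → ℂ} (hf : Integrable f) (hfK : ∀ x ∉ K, f x = 0) :
    ∃ N : ℕ, ∀ k, ∃ g : 𝓓(Ω, ℂ), (g : Euc n → ℂ) = mollify (smallBump n (k + N)) f := by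
  -- Mollifying at radius below `δ` keeps the support in this thickening of `K`; the shift by `N`
  -- discards the larger radii.
  obtain ⟨δ, hδ, hδΩ⟩ := hK.exists_cthickening_subset_open Ω.isOpen hKΩ
  obtain ⟨N, hN⟩ := exists_nat_one_div_lt hδ
  refine ⟨N, fun k => ?_⟩
  have hsub : Function.support (mollify (smallBump n (k + N)) f) ⊆ Metric.cthickening δ K := by
    intro x hx
    by_contra hxK
    refine hx ?_
    rw [mollify_apply]
    refine integral_eq_zero_of_ae (Filter.Eventually.of_forall fun y => ?_)
    simp only [Pi.zero_apply]
    by_cases hy : y ∈ Metric.ball (0 : Euc n) (smallBump n (k + N)).rOut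
    · have : x - y ∉ K := by
        intro hmem
        refine hxK (Metric.mem_cthickening_of_dist_le x (x - y) δ K hmem ?_)
        rw [dist_eq_norm, sub_sub_cancel]
        rw [mem_ball_zero_iff] at hy
        refine hy.le.trans (le_trans ?_ hN.le)
        change 1 / (((k + N : ℕ) : ℝ) + 1) ≤ _
        gcongr
        linarith [(Nat.cast_nonneg k : (0 : ℝ) ≤ k)]
      rw [hfK _ this, smul_zero]
    · rw [← (smallBump n (k + N)).support_normed_eq (μ := volume), Function.notMem_support] at hy
      rw [hy, zero_smul]
  have hts : tsupport (mollify (smallBump n (k + N)) f) ⊆ Metric.cthickening δ K :=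
    closure_minimal hsub Metric.isClosed_cthickening
  exact ⟨⟨_, contDiff_mollify _ hf.locallyIntegrable,
    hK.cthickening.of_isClosed_subset (isClosed_tsupport _) hts, hts.trans hδΩ⟩, rfl⟩

end

namespace Sob
variable {n : ℕ} {s : ℝ}

lemma toL2_ofTest (hs : 0 ≤ s) (Ω : Opens (Euc n)) (g : 𝓓(Ω, ℂ)) :
    toL2 hs (ofTest Ω s g) =ᵐ[volume] g := by
  have h : toL2 hs (ofTest Ω s g) = (toSchwartz Ω g).toLp 2 := by
    refine toTemperedDistribution_injective ?_
    rw [toL2_spec, Lp.toTemperedDistributionCLM_apply, Lp.toTemperedDistribution_toLp_eq]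
    rfl
  rw [h]
  exact (toSchwartz Ω g).coeFn_toLp 2 volume

/-- The mollifications are eventually test functions on `Ω`, bounded in `H^s` by contraction, and
converge to `W` as distributions. As `H̃^s(Ω)` is weakly closed, norm convergence is not needed. -/
lemma mem_HTilde_of_compact (hs : 0 < s) (hs2 : s < 2) {Ω : Opens (Euc n)} {K : Set (Euc n)}
    (hK : IsCompact K) (hKΩ : K ⊆ Ω) (W : Sob n s)
    (hW : ∀ᵐ x, x ∉ K → toL2 hs.le W x = 0) : W ∈ HTilde Ω s := by
  set f : Euc n → ℂ := K.indicator (toL2 hs.le W) with hf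
  have hfm : Measurable f := (Lp.stronglyMeasurable _).measurable.indicator hK.measurableSet
  have hfW : f =ᵐ[volume] toL2 hs.le W := by
    filter_upwards [hW] with x hx
    by_cases hxK : x ∈ K
    · rw [hf, indicator_of_mem hxK]
    · rw [hf, indicator_of_notMem hxK, hx hxK]
  have hfi : Integrable f := by
    rw [hf, integrable_indicator_iff hK.measurableSet]
    have := isFiniteMeasure_restrict.2 (hK.measure_ne_top (μ := (volume : Measure (Euc n))))
    have h2 : MemLp (toL2 hs.le W) 2 (volume.restrict K) := (Lp.memLp _).restrict K
    exact h2.integrable (by norm_num)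
  obtain ⟨N, hN⟩ := exists_testFunction_mollify hK hKΩ hfi
    (fun x hx => indicator_of_notMem hx _)
  choose g hg using hN
  obtain ⟨C, hC, hCf⟩ := exists_toL2_eq_of_gagliardo n hs hs2
  set M : ℝ≥0∞ := ‖toL2 hs.le W‖ₑ ^ 2 + ∑ i, gagliardo s (unitVec i) (toL2 hs.le W) with hM
  have hMt : M ≠ ⊤ := by
    refine ENNReal.add_ne_top.2 ⟨by simp, (ENNReal.sum_lt_top.2 fun i _ => ?_).ne⟩
    exact (gagliardo_toL2_le hs W (norm_unitVec i).le).trans_lt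
      (ENNReal.mul_lt_top (sdiffConst_ne_top hs hs2).lt_top (by simp))
  have hbound : ∀ k, ‖ofTest Ω s (g k)‖ₑ ^ 2 ≤ C * M := by
    intro k
    set F := toL2 hs.le (ofTest Ω s (g k))
    have hFg : F =ᵐ[volume] mollify (smallBump n (k + N)) f := by
      rw [← hg k]; exact toL2_ofTest hs.le Ω (g k)
    have hmm : Measurable (mollify (smallBump n (k + N)) f) :=
      (contDiff_mollify _ hfi.locallyIntegrable).continuous.measurable
    have h1 : ‖F‖ₑ ^ 2 ≤ ‖toL2 hs.le W‖ₑ ^ 2 := by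
      have e1 : ∫⁻ x, ‖F x‖ₑ ^ 2 = ∫⁻ x, ‖mollify (smallBump n (k + N)) f x‖ₑ ^ 2 :=
        lintegral_congr_ae (hFg.mono fun x hx => by simp only [hx])
      have e2 : ∫⁻ x, ‖f x‖ₑ ^ 2 = ∫⁻ x, ‖toL2 hs.le W x‖ₑ ^ 2 :=
        lintegral_congr_ae (hfW.mono fun x hx => by simp only [hx])
      rw [← lintegral_enorm_sq, ← lintegral_enorm_sq, e1, ← e2]
      exact lintegral_mollify_le _ hfm
    have h2 : ∀ i, gagliardo s (unitVec i) F ≤ gagliardo s (unitVec i) (toL2 hs.le W) := by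
      intro i
      rw [gagliardo_congr (Lp.stronglyMeasurable _).measurable hmm hFg,
        ← gagliardo_congr hfm (Lp.stronglyMeasurable _).measurable hfW, gagliardo, gagliardo,
        lintegral_diffMeasure s ((measurable_sdiff hmm _).enorm.pow_const 2),
        lintegral_diffMeasure s ((measurable_sdiff hfm _).enorm.pow_const 2)]
      refine lintegral_mono fun t => ?_
      simp only
      rw [sdiff_mollify _ hfi.locallyIntegrable]
      exact lintegral_mollify_le _ (by unfold sdiff; fun_prop)
    have h3 : ‖F‖ₑ ^ 2 + ∑ i, gagliardo s (unitVec i) F ≤ M :=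
      add_le_add h1 (Finset.sum_le_sum fun i _ => h2 i)
    obtain ⟨U, hU, hUn⟩ := hCf F (ne_top_of_le_ne_top hMt h3)
    rw [← toL2_injective hs.le hU]
    exact hUn.trans (by gcongr)
  have hbound' : ∀ k, ‖ofTest Ω s (g k)‖ ≤ (C * M).toReal + 1 := by
    intro k
    have h1 : ‖ofTest Ω s (g k)‖ ^ 2 ≤ (C * M).toReal := by
      rw [← toReal_enorm, ← ENNReal.toReal_pow]
      exact ENNReal.toReal_mono (ENNReal.mul_ne_top hC hMt) (hbound k)
    nlinarith [sq_nonneg (‖ofTest Ω s (g k)‖ - 1), norm_nonneg (ofTest Ω s (g k))]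
  obtain ⟨V, hV, hlim⟩ := Sob.exists_weak_limit (HTilde Ω s)
    (Submodule.isClosed_topologicalClosure _) (fun k => ofTest Ω s (g k))
    (fun k => Submodule.le_topologicalClosure _ ⟨g k, rfl⟩) _ hbound'
  suffices h : V = W from h ▸ hV
  refine toDistribution_injective ?_
  ext ψ
  refine hlim ψ _ ?_
  have hr : Filter.Tendsto (fun k => (smallBump n (k + N)).rOut) Filter.atTop (nhds 0) :=
    (Filter.tendsto_add_atTop_iff_nat N).2 tendsto_one_div_add_atTop_nhds_zero_nat
  have h1 := tendsto_integral_mollify hr hfi ψ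
  have h2 : ∫ x, ψ x * f x = toDistribution n s W ψ := by
    rw [toDistribution_apply hs.le]
    exact integral_congr_ae (hfW.mono fun x hx => by simp only [hx])
  rw [← h2]
  refine h1.congr fun k => ?_
  rw [toDistribution_apply hs.le, ← hg k]
  exact integral_congr_ae ((toL2_ofTest hs.le Ω (g k)).mono fun x hx => by simp only [hx])

end Sob
end TraceSpaces
end

noncomputable section
namespace TraceSpaces

open scoped FourierTransform RealInnerProductSpace

/-! ### Cut-off functions adapted to the distance to the boundary -/

lemma enorm_sq_eq_ofReal (z : ℂ) : ‖z‖ₑ ^ 2 = ENNReal.ofReal (‖z‖ ^ 2) := by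
  rw [ENNReal.ofReal_pow (norm_nonneg _), ofReal_norm]

section
variable {E : Type*} [NormedAddCommGroup E] [InnerProductSpace ℝ E] [FiniteDimensional ℝ E]
  [MeasurableSpace E] [BorelSpace E]

/-- The Hardy integral `∫ |f|² D^{-2s}`. -/
def hardyInt (s : ℝ) (D : E → ℝ) (f : E → ℂ) : ℝ≥0∞ :=
  ∫⁻ x, ‖f x‖ₑ ^ 2 * ENNReal.ofReal (D x) ^ (-2 * s)

lemma lintegral_diffMeasure_shift (s : ℝ) (e : E) {G : ℝ × E → ℝ≥0∞} (hG : Measurable G) :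
    ∫⁻ p, G (p.1, p.2 + p.1 • e) ∂diffMeasure E s = ∫⁻ p, G p ∂diffMeasure E s := by
  rw [lintegral_diffMeasure s hG, lintegral_diffMeasure s (by fun_prop)]
  refine lintegral_congr fun t => ?_
  exact lintegral_add_right_eq_self (fun x => G (t, x)) (t • e)

lemma lintegral_diffMeasure_scale (s : ℝ) {a : ℝ} (ha : 0 < a) {G : ℝ × E → ℝ≥0∞}
    (hG : Measurable G) :
    ∫⁻ p, G (a * p.1, p.2) ∂diffMeasure E s =
      ENNReal.ofReal (a ^ (2 * s)) * ∫⁻ p, G p ∂diffMeasure E s := by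
  rw [lintegral_diffMeasure s hG, lintegral_diffMeasure s (by fun_prop),
    lintegral_powMeasure_comp_mul ha.ne' _ (fun t => ∫⁻ x, G (t, x)), abs_of_pos ha]
  congr 3
  ring

/-- For steps at least comparable to `D` no cancellation is needed: integrating over `t` first costs
a factor `D^{-2s}`, which is the Hardy weight. -/
lemma exists_lintegral_far_le {s b : ℝ} (hs : 0 < s) (hb : 0 < b) :
    ∃ C : ℝ≥0∞, C ≠ ⊤ ∧ ∀ (D : E → ℝ) (f : E → ℂ), Continuous D → (∀ x, 0 ≤ D x) →
      Measurable f →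
      ∫⁻ p, {p : ℝ × E | D p.2 ≤ b * |p.1|}.indicator (fun p => ‖f p.2‖ₑ ^ 2) p
        ∂diffMeasure E s ≤ C * hardyInt s D f := by
  obtain ⟨C, hC, hCd⟩ := exists_powMeasure_le_far hs hb
  refine ⟨C, hC, fun D f hD hD0 hf => ?_⟩
  have hS : MeasurableSet {p : ℝ × E | D p.2 ≤ b * |p.1|} :=
    measurableSet_le (by fun_prop) (by fun_prop)
  have hfm : Measurable fun p : ℝ × E => ‖f p.2‖ₑ ^ 2 := by fun_prop
  rw [lintegral_diffMeasure_symm s (hfm.indicator hS), hardyInt,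
    ← lintegral_const_mul' _ _ hC]
  refine lintegral_mono fun x => ?_
  have h1 : ∀ t : ℝ, {p : ℝ × E | D p.2 ≤ b * |p.1|}.indicator (fun p => ‖f p.2‖ₑ ^ 2) (t, x) =
      ‖f x‖ₑ ^ 2 * {t : ℝ | D x ≤ b * |t|}.indicator 1 t := by
    intro t
    by_cases h : D x ≤ b * |t|
    · rw [indicator_of_mem (by exact h), indicator_of_mem (by exact h), Pi.one_apply, mul_one]
    · rw [indicator_of_notMem (by exact h), indicator_of_notMem (by exact h), mul_zero]
  have hT : MeasurableSet {t : ℝ | D x ≤ b * |t|} := measurableSet_le (by fun_prop) (by fun_prop)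
  simp_rw [h1]
  rw [lintegral_const_mul _ (measurable_one.indicator hT), lintegral_indicator_one hT,
    mul_left_comm]
  gcongr
  exact hCd _ (hD0 x)

lemma exists_lintegral_near_le {s : ℝ} (hs : 0 < s) (hs2 : s < 2) :
    ∃ C : ℝ≥0∞, C ≠ ⊤ ∧ ∀ (D : E → ℝ) (f : E → ℂ), Continuous D → (∀ x, 0 ≤ D x) →
      Measurable f →
      ∫⁻ p, {p : ℝ × E | |p.1| < D p.2}.indicator
        (fun p => ENNReal.ofReal ((|p.1| / D p.2) ^ 4) * ‖f p.2‖ₑ ^ 2) p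
        ∂diffMeasure E s ≤ C * hardyInt s D f := by
  obtain ⟨C, hC, hCd⟩ := exists_lintegral_powMeasure_le_near hs hs2
  refine ⟨C, hC, fun D f hD hD0 hf => ?_⟩
  have hS : MeasurableSet {p : ℝ × E | |p.1| < D p.2} :=
    measurableSet_lt (by fun_prop) (by fun_prop)
  have hDm := hD.measurable
  have hfm : Measurable fun p : ℝ × E => ENNReal.ofReal ((|p.1| / D p.2) ^ 4) * ‖f p.2‖ₑ ^ 2 := by
    fun_prop
  rw [lintegral_diffMeasure_symm s (hfm.indicator hS), hardyInt,
    ← lintegral_const_mul' _ _ hC]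
  refine lintegral_mono fun x => ?_
  have h1 : ∀ t : ℝ, {p : ℝ × E | |p.1| < D p.2}.indicator
      (fun p => ENNReal.ofReal ((|p.1| / D p.2) ^ 4) * ‖f p.2‖ₑ ^ 2) (t, x) =
      ‖f x‖ₑ ^ 2 * {t : ℝ | |t| < D x}.indicator
        (fun t => ENNReal.ofReal ((|t| / D x) ^ 4)) t := by
    intro t
    by_cases h : |t| < D x
    · rw [indicator_of_mem (by exact h), indicator_of_mem (by exact h), mul_comm]
    · rw [indicator_of_notMem (by exact h), indicator_of_notMem (by exact h), mul_zero]
  have hT : MeasurableSet {t : ℝ | |t| < D x} := measurableSet_lt (by fun_prop) (by fun_prop)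
  simp_rw [h1]
  rw [lintegral_const_mul _ (Measurable.indicator (by fun_prop) hT), mul_left_comm]
  gcongr
  exact hCd _ (hD0 x)

/-- The weighted first difference appearing in the product rule for second differences. -/
def weightedDiff (D : E → ℝ) (f : E → ℂ) (e : E) (p : ℝ × E) : ℝ≥0∞ :=
  ENNReal.ofReal ((|p.1| / D p.2) ^ 2) * ‖f (p.2 + p.1 • e) - f (p.2 - p.1 • e)‖ₑ ^ 2

lemma measurable_weightedDiff {D : E → ℝ} (hD : Measurable D) {f : E → ℂ} (hf : Measurable f)
    (e : E) : Measurable (weightedDiff D f e) := by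
  unfold weightedDiff; fun_prop

lemma lipschitz_shift_le {D : E → ℝ} (hD : LipschitzWith 1 D) (x h : E) :
    D (x + h) ≤ D x + ‖h‖ := by
  have := hD.dist_le_mul (x + h) x
  rw [Real.dist_eq, dist_eq_norm, add_sub_cancel_left, NNReal.coe_one, one_mul] at this
  linarith [le_abs_self (D (x + h) - D x)]

/-- Doubling of the step: with `h = te` and `Δ` the second difference of step `h`, `2(f(x+h) -
f(x-h)) = (f(x+2h) - f(x-2h)) - (Δf(x+h) - Δf(x-h))`. Either the step `2t` is still short compared
to `D x`, or `D ≤ 6|t|` at both points `x ± 2h` and the Hardy integral takes over. -/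
lemma weightedDiff_le {D : E → ℝ} (hD : LipschitzWith 1 D) {e : E}
    (he : ‖e‖ = 1) (f : E → ℂ) {τ : ℝ} (p : ℝ × E) :
    {p : ℝ × E | τ ≤ |p.1| ∧ 2 * |p.1| < D p.2}.indicator (weightedDiff D f e) p ≤
      ENNReal.ofReal (3 / 32) * ({p : ℝ × E | τ ≤ |p.1| ∧ 2 * |p.1| < D p.2}.indicator
        (weightedDiff D f e) (2 * p.1, p.2) +
        2 * ({p : ℝ × E | D p.2 ≤ 6 * |p.1|}.indicator (fun p => ‖f p.2‖ₑ ^ 2)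
          (p.1, p.2 + p.1 • ((2 : ℝ) • e)) +
        {p : ℝ × E | D p.2 ≤ 6 * |p.1|}.indicator (fun p => ‖f p.2‖ₑ ^ 2)
          (p.1, p.2 + p.1 • ((-2 : ℝ) • e)))) +
      ENNReal.ofReal (3 / 2) * (‖sdiff f (p.1 • e) (p.2 + p.1 • e)‖ₑ ^ 2 +
        ‖sdiff f (p.1 • e) (p.2 + p.1 • -e)‖ₑ ^ 2) := by
  obtain ⟨t, x⟩ := p
  by_cases hp : τ ≤ |t| ∧ 2 * |t| < D x
  swap
  · rw [indicator_of_notMem (by exact hp)]; exact zero_le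
  rw [indicator_of_mem (by exact hp)]
  have hDx : 0 < D x := lt_of_le_of_lt (by positivity) hp.2
  set w : ℝ := |t| / D x with hw
  have hw1 : w ≤ 1 := by rw [hw, div_le_one hDx]; linarith [abs_nonneg t, hp.2]
  have hw0 : 0 ≤ w := by positivity
  set a : ℂ := f (x + (2 * t) • e) - f (x - (2 * t) • e) with ha
  set b := sdiff f (t • e) (x + t • e) with hb
  set c := sdiff f (t • e) (x + t • -e) with hc
  have hid : f (x + t • e) - f (x - t • e) = (1 / 2 : ℂ) * a - (1 / 2 : ℂ) * (b - c) := by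
    rw [ha, hb, hc, sdiff, sdiff, smul_neg, ← sub_eq_add_neg, add_sub_cancel_right,
      sub_add_cancel, mul_smul, two_smul, ← add_assoc, ← sub_sub]
    ring
  -- Young's inequality with factor `3/2` on the first square gives `3/8 = (3/2)(1/4)`. Writing `|t|
  -- = |2t|/2` in the weight gains another `1/4`, hence `3/32`, which has to stay below `1/8` for
  -- the absorption.
  have hnorm : ‖f (x + t • e) - f (x - t • e)‖ ^ 2 ≤
      3 / 8 * ‖a‖ ^ 2 + 3 / 2 * (‖b‖ ^ 2 + ‖c‖ ^ 2) := by
    have h1 : ‖f (x + t • e) - f (x - t • e)‖ ≤ 1 / 2 * ‖a‖ + 1 / 2 * (‖b‖ + ‖c‖) := by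
      rw [hid]
      refine (norm_sub_le _ _).trans (add_le_add ?_ ?_)
      · rw [norm_mul]; norm_num
      · rw [norm_mul]; norm_num; exact norm_sub_le _ _
    refine (pow_le_pow_left₀ (norm_nonneg _) h1 2).trans ?_
    nlinarith [sq_nonneg (‖a‖ - 2 * (‖b‖ + ‖c‖)), sq_nonneg (‖b‖ - ‖c‖)]
  have hmain : weightedDiff D f e (t, x) ≤ ENNReal.ofReal (3 / 32) *
      (ENNReal.ofReal ((|2 * t| / D x) ^ 2) * ‖a‖ₑ ^ 2) +
      ENNReal.ofReal (3 / 2) * (‖b‖ₑ ^ 2 + ‖c‖ₑ ^ 2) := by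
    simp only [weightedDiff, enorm_sq_eq_ofReal]
    rw [← ENNReal.ofReal_mul (by positivity), ← ENNReal.ofReal_mul (by positivity),
      ← ENNReal.ofReal_mul (by positivity), ← ENNReal.ofReal_add (by positivity) (by positivity),
      ← ENNReal.ofReal_mul (by positivity), ← ENNReal.ofReal_add (by positivity) (by positivity)]
    refine ENNReal.ofReal_le_ofReal ?_
    have h2 : |2 * t| / D x = 2 * w := by rw [abs_mul, hw]; norm_num; ring
    rw [h2, ← hw]
    have hw2 : w ^ 2 ≤ 1 := pow_le_one₀ hw0 hw1
    have hbc : 0 ≤ ‖b‖ ^ 2 + ‖c‖ ^ 2 := by positivity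
    calc w ^ 2 * ‖f (x + t • e) - f (x - t • e)‖ ^ 2
        ≤ w ^ 2 * (3 / 8 * ‖a‖ ^ 2 + 3 / 2 * (‖b‖ ^ 2 + ‖c‖ ^ 2)) :=
          mul_le_mul_of_nonneg_left hnorm (sq_nonneg _)
      _ ≤ _ := by nlinarith [mul_le_mul_of_nonneg_right hw2 hbc]
  refine hmain.trans ?_
  gcongr
  by_cases h2 : 2 * |2 * t| < D x
  · have hmem : ((2 * t, x) : ℝ × E) ∈ {p : ℝ × E | τ ≤ |p.1| ∧ 2 * |p.1| < D p.2} := by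
      refine ⟨?_, h2⟩
      simp only [abs_mul]
      norm_num
      linarith [abs_nonneg t, hp.1]
    rw [indicator_of_mem hmem]
    exact le_self_add
  · push Not at h2
    have h2' : D x ≤ 4 * |t| := by rw [abs_mul] at h2; norm_num at h2; linarith
    have hm1 : ∀ r : ℝ, |r| = 2 → D (x + t • (r • e)) ≤ 6 * |t| := fun r hr => by
      have := lipschitz_shift_le hD x (t • (r • e))
      rw [norm_smul, norm_smul, he, Real.norm_eq_abs, Real.norm_eq_abs, hr] at this
      linarith
    rw [indicator_of_mem (s := {p : ℝ × E | D p.2 ≤ 6 * |p.1|})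
        (by exact hm1 2 (by norm_num)),
      indicator_of_mem (s := {p : ℝ × E | D p.2 ≤ 6 * |p.1|})
        (by exact hm1 (-2) (by norm_num))]
    refine le_trans ?_ le_add_self
    simp only [enorm_sq_eq_ofReal]
    rw [← ENNReal.ofReal_mul (by positivity), ← ENNReal.ofReal_add (by positivity) (by positivity),
      show (2 : ℝ≥0∞) = ENNReal.ofReal 2 by simp, ← ENNReal.ofReal_mul (by positivity)]
    refine ENNReal.ofReal_le_ofReal ?_
    have h3 : |2 * t| / D x ≤ 1 := by
      rw [div_le_one hDx, abs_mul]; norm_num; exact hp.2.le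
    have h4 : (|2 * t| / D x) ^ 2 ≤ 1 := pow_le_one₀ (by positivity) h3
    have e1 : x + t • ((2 : ℝ) • e) = x + (2 * t) • e := by rw [smul_smul, mul_comm]
    have e2 : x + t • ((-2 : ℝ) • e) = x - (2 * t) • e := by
      rw [smul_smul, sub_eq_add_neg, ← neg_smul]; congr 2; ring
    rw [e1, e2]
    calc _ ≤ 1 * ‖a‖ ^ 2 := by gcongr
      _ ≤ 1 * (‖f (x + (2 * t) • e)‖ + ‖f (x - (2 * t) • e)‖) ^ 2 := by
        gcongr; exact norm_sub_le _ _
      _ ≤ _ := by nlinarith [sq_nonneg (‖f (x + (2 * t) • e)‖ - ‖f (x - (2 * t) • e)‖)]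

end
end TraceSpaces
end

/-! ### The weighted first difference is controlled by second differences and the Hardy integral. -/

noncomputable section
namespace TraceSpaces

open scoped FourierTransform RealInnerProductSpace

section
variable {E : Type*} [NormedAddCommGroup E] [InnerProductSpace ℝ E] [FiniteDimensional ℝ E]
  [MeasurableSpace E] [BorelSpace E]

lemma lintegral_gagliardo_shift (s : ℝ) (e e' : E) {f : E → ℂ} (hf : Measurable f) :
    ∫⁻ p, ‖sdiff f (p.1 • e) (p.2 + p.1 • e')‖ₑ ^ 2 ∂diffMeasure E s = gagliardo s e f :=
  lintegral_diffMeasure_shift s e' (G := fun p => ‖sdiff f (p.1 • e) p.2‖ₑ ^ 2)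
    ((measurable_sdiff hf e).enorm.pow_const 2)

lemma measurableSet_near {D : E → ℝ} (hD : Continuous D) (τ : ℝ) :
    MeasurableSet {p : ℝ × E | τ ≤ |p.1| ∧ 2 * |p.1| < D p.2} := by
  have h1 : MeasurableSet {p : ℝ × E | τ ≤ |p.1|} :=
    measurableSet_le (by fun_prop) (by fun_prop)
  have h2 : MeasurableSet {p : ℝ × E | 2 * |p.1| < D p.2} :=
    measurableSet_lt (by fun_prop) (by fun_prop)
  exact h1.inter h2

/-- A priori finiteness, without which the absorption could not subtract: on the region `|t|` has a
positive lower bound, so the measure in `t` is finite, and the weight is at most `1`. -/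
lemma lintegral_weightedDiff_ne_top {s : ℝ} (hs : 0 < s) {D : E → ℝ} (e : E)
    {f : E → ℂ} (hf : Measurable f) (hf2 : ∫⁻ x, ‖f x‖ₑ ^ 2 ≠ ⊤) {τ : ℝ} (hτ : 0 < τ) :
    ∫⁻ p, {p : ℝ × E | τ ≤ |p.1| ∧ 2 * |p.1| < D p.2}.indicator (weightedDiff D f e) p
      ∂diffMeasure E s ≠ ⊤ := by
  obtain ⟨C, hC, hCd⟩ := exists_powMeasure_le_far hs one_pos
  have hT : MeasurableSet {t : ℝ | τ ≤ 1 * |t|} := measurableSet_le (by fun_prop) (by fun_prop)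
  have hμ : powMeasure (-1 - 2 * s) {t | τ ≤ 1 * |t|} ≠ ⊤ := by
    refine ne_top_of_le_ne_top (ENNReal.mul_ne_top hC ?_) (hCd τ hτ.le)
    rw [ENNReal.ofReal_rpow_of_pos hτ]
    exact ENNReal.ofReal_ne_top
  set F : ℝ × E → ℝ≥0∞ := fun p =>
    {t : ℝ | τ ≤ 1 * |t|}.indicator 1 p.1 * ‖f p.2‖ₑ ^ 2 with hF
  have hFm : Measurable F := by
    have h1 : Measurable ({t : ℝ | τ ≤ 1 * |t|}.indicator (1 : ℝ → ℝ≥0∞)) :=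
      measurable_one.indicator hT
    exact (h1.comp measurable_fst).mul (by fun_prop)
  have hFi : ∫⁻ p, F p ∂diffMeasure E s ≠ ⊤ := by
    rw [lintegral_diffMeasure s hFm]
    simp only [hF]
    have h1 : ∀ t, ∫⁻ x, {t : ℝ | τ ≤ 1 * |t|}.indicator (1 : ℝ → ℝ≥0∞) t * ‖f x‖ₑ ^ 2 =
        {t : ℝ | τ ≤ 1 * |t|}.indicator (1 : ℝ → ℝ≥0∞) t * ∫⁻ x, ‖f x‖ₑ ^ 2 := fun t =>
      lintegral_const_mul _ (by fun_prop)
    simp_rw [h1]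
    rw [lintegral_mul_const _ (measurable_one.indicator hT), lintegral_indicator_one hT]
    exact ENNReal.mul_ne_top hμ hf2
  refine ne_top_of_le_ne_top (b := ∫⁻ p, (2 * F (p.1, p.2 + p.1 • e) +
    2 * F (p.1, p.2 + p.1 • -e)) ∂diffMeasure E s) ?_ (lintegral_mono fun p => ?_)
  · rw [lintegral_add_left (by fun_prop), lintegral_const_mul _ (by fun_prop),
      lintegral_const_mul _ (by fun_prop), lintegral_diffMeasure_shift s e hFm,
      lintegral_diffMeasure_shift s (-e) hFm]
    exact ENNReal.add_ne_top.2 ⟨ENNReal.mul_ne_top (by simp) hFi, ENNReal.mul_ne_top (by simp) hFi⟩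
  · obtain ⟨t, x⟩ := p
    by_cases hp : τ ≤ |t| ∧ 2 * |t| < D x
    swap
    · rw [indicator_of_notMem (by exact hp)]; exact zero_le
    rw [indicator_of_mem (by exact hp)]
    simp only [hF]
    rw [indicator_of_mem (by rw [mem_ofPred_eq, one_mul]; exact hp.1), Pi.one_apply, one_mul, one_mul,
      weightedDiff]
    simp only [enorm_sq_eq_ofReal]
    rw [show (2 : ℝ≥0∞) = ENNReal.ofReal 2 by simp, ← ENNReal.ofReal_mul (by positivity),
      ← ENNReal.ofReal_mul (by positivity), ← ENNReal.ofReal_mul (by positivity),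
      ← ENNReal.ofReal_add (by positivity) (by positivity)]
    refine ENNReal.ofReal_le_ofReal ?_
    have hDx : 0 < D x := lt_of_le_of_lt (by positivity) hp.2
    have h3 : |t| / D x ≤ 1 := by
      rw [div_le_one hDx]; linarith [abs_nonneg t, hp.2]
    have h4 : (|t| / D x) ^ 2 ≤ 1 := pow_le_one₀ (by positivity) h3
    rw [smul_neg, ← sub_eq_add_neg]
    calc _ ≤ 1 * ‖f (x + t • e) - f (x - t • e)‖ ^ 2 := by gcongr
      _ ≤ 1 * (‖f (x + t • e)‖ + ‖f (x - t • e)‖) ^ 2 := by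
        gcongr; exact norm_sub_le _ _
      _ ≤ _ := by nlinarith [sq_nonneg (‖f (x + t • e)‖ - ‖f (x - t • e)‖)]

/-- By scaling, the term with the doubled step is at most `(3/32) 2^{2s} ≤ 3/4` times the left-hand
side, as `2s < 3`, and is absorbed there. This is done for `|t| ≥ τ`; monotone convergence removes
`τ`. -/
lemma exists_lintegral_weightedDiff_le {s : ℝ} (hs : 0 < s) (hs2 : s < 3 / 2) :
    ∃ C : ℝ≥0∞, C ≠ ⊤ ∧ ∀ (D : E → ℝ) (f : E → ℂ) (e : E), LipschitzWith 1 D → (∀ x, 0 ≤ D x) →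
      Measurable f → ∫⁻ x, ‖f x‖ₑ ^ 2 ≠ ⊤ → ‖e‖ = 1 →
      ∫⁻ p, {p : ℝ × E | 2 * |p.1| < D p.2}.indicator (weightedDiff D f e) p
        ∂diffMeasure E s ≤ C * (gagliardo s e f + hardyInt s D f) := by
  obtain ⟨B, hB, hBf⟩ := exists_lintegral_far_le (E := E) (b := 6) hs (by norm_num)
  -- After absorbing `3/4` of the left side the rest is multiplied by `4`: the second differences
  -- contribute `4 · 3 = 12`, the far terms `4 · (3/8) B ≤ 2B`.
  refine ⟨12 + 2 * B, ENNReal.add_ne_top.2 ⟨by simp, ENNReal.mul_ne_top (by simp) hB⟩,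
    fun D f e hD hD0 hf hf2 he => ?_⟩
  have hDc := hD.continuous
  have hwm : Measurable (weightedDiff D f e) := measurable_weightedDiff hDc.measurable hf e
  set R : ℝ≥0∞ := gagliardo s e f + hardyInt s D f with hR
  have main : ∀ τ : ℝ, 0 < τ →
      ∫⁻ p, {p : ℝ × E | τ ≤ |p.1| ∧ 2 * |p.1| < D p.2}.indicator (weightedDiff D f e) p
        ∂diffMeasure E s ≤ (12 + 2 * B) * R := by
    intro τ hτ
    set G : ℝ × E → ℝ≥0∞ :=
      {p : ℝ × E | τ ≤ |p.1| ∧ 2 * |p.1| < D p.2}.indicator (weightedDiff D f e) with hG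
    have hGm : Measurable G := hwm.indicator (measurableSet_near hDc τ)
    set Q := ∫⁻ p, G p ∂diffMeasure E s with hQ
    have hQt : Q ≠ ⊤ := lintegral_weightedDiff_ne_top hs e hf hf2 hτ
    set F : ℝ × E → ℝ≥0∞ :=
      {p : ℝ × E | D p.2 ≤ 6 * |p.1|}.indicator (fun p => ‖f p.2‖ₑ ^ 2) with hF
    have hFm : Measurable F := Measurable.indicator (by fun_prop)
      (measurableSet_le (by fun_prop) (by fun_prop))
    have hFi : ∫⁻ p, F p ∂diffMeasure E s ≤ B * hardyInt s D f := hBf D f hDc hD0 hf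
    have hsm : ∀ e' : E, Measurable fun p : ℝ × E =>
        ‖sdiff f (p.1 • e) (p.2 + p.1 • e')‖ₑ ^ 2 := fun e' => by unfold sdiff; fun_prop
    have h1 : Q ≤ ENNReal.ofReal (3 / 32) * (ENNReal.ofReal (2 ^ (2 * s)) * Q +
        2 * (B * hardyInt s D f + B * hardyInt s D f)) +
        ENNReal.ofReal (3 / 2) * (gagliardo s e f + gagliardo s e f) := by
      have hpt : ∀ p : ℝ × E, G p ≤ ENNReal.ofReal (3 / 32) * (G (2 * p.1, p.2) +
          2 * (F (p.1, p.2 + p.1 • ((2 : ℝ) • e)) + F (p.1, p.2 + p.1 • ((-2 : ℝ) • e)))) +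
          ENNReal.ofReal (3 / 2) * (‖sdiff f (p.1 • e) (p.2 + p.1 • e)‖ₑ ^ 2 +
            ‖sdiff f (p.1 • e) (p.2 + p.1 • -e)‖ₑ ^ 2) := weightedDiff_le hD he f
      clear_value G F
      have hm1 := hsm e
      have hm2 := hsm (-e)
      refine (lintegral_mono hpt).trans ?_
      rw [lintegral_add_left (by fun_prop), lintegral_const_mul _ (by fun_prop),
        lintegral_const_mul _ (by fun_prop), lintegral_add_left (by fun_prop),
        lintegral_const_mul _ (by fun_prop), lintegral_add_left (by fun_prop),
        lintegral_add_left (by fun_prop), lintegral_gagliardo_shift s e _ hf,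
        lintegral_gagliardo_shift s e _ hf]
      gcongr
      · exact (lintegral_diffMeasure_scale s two_pos hGm).le
      · exact (lintegral_diffMeasure_shift s _ hFm).trans_le hFi
      · exact (lintegral_diffMeasure_shift s _ hFm).trans_le hFi
    have h2 : ENNReal.ofReal (3 / 32) * (ENNReal.ofReal (2 ^ (2 * s)) * Q) ≤
        ENNReal.ofReal (3 / 4) * Q := by
      rw [← mul_assoc, ← ENNReal.ofReal_mul (by norm_num)]
      gcongr
      have : (2 : ℝ) ^ (2 * s) ≤ 2 ^ (3 : ℝ) :=
        Real.rpow_le_rpow_of_exponent_le (by norm_num) (by linarith)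
      norm_num at this
      linarith
    have h3 : Q ≤ ENNReal.ofReal (3 / 4) * Q + (ENNReal.ofReal (1 / 4) * ((12 + 2 * B) * R)) := by
      refine h1.trans ?_
      rw [mul_add, add_assoc]
      refine add_le_add h2 ?_
      have e1 : ENNReal.ofReal (3 / 32) * (2 * (B * hardyInt s D f + B * hardyInt s D f)) ≤
          ENNReal.ofReal (1 / 4) * (2 * B * hardyInt s D f) := by
        rw [← two_mul, ← mul_assoc, ← mul_assoc, ← mul_assoc, ← mul_assoc, ← mul_assoc,
          show (2 : ℝ≥0∞) = ENNReal.ofReal 2 by simp, ← ENNReal.ofReal_mul (by norm_num),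
          ← ENNReal.ofReal_mul (by norm_num), ← ENNReal.ofReal_mul (by norm_num)]
        gcongr
        norm_num
      have e2 : ENNReal.ofReal (3 / 2) * (gagliardo s e f + gagliardo s e f) =
          ENNReal.ofReal (1 / 4) * (12 * gagliardo s e f) := by
        rw [← two_mul, ← mul_assoc, ← mul_assoc, show (2 : ℝ≥0∞) = ENNReal.ofReal 2 by simp,
          show (12 : ℝ≥0∞) = ENNReal.ofReal 12 by simp, ← ENNReal.ofReal_mul (by norm_num),
          ← ENNReal.ofReal_mul (by norm_num)]
        norm_num
      rw [e2]
      refine (add_le_add_left e1 _).trans ?_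
      rw [← mul_add]
      gcongr
      rw [add_mul, add_comm]
      gcongr
      · exact le_self_add
      · exact le_add_self
    have h4 : ENNReal.ofReal (1 / 4) * Q ≤ ENNReal.ofReal (1 / 4) * ((12 + 2 * B) * R) := by
      have h5 : ENNReal.ofReal (3 / 4) * Q + ENNReal.ofReal (1 / 4) * Q ≤
          ENNReal.ofReal (3 / 4) * Q + (ENNReal.ofReal (1 / 4) * ((12 + 2 * B) * R)) := by
        rw [← add_mul, ← ENNReal.ofReal_add (by norm_num) (by norm_num)]
        norm_num
        norm_num at h3
        exact h3
      exact (ENNReal.add_le_add_iff_left (ENNReal.mul_ne_top ENNReal.ofReal_ne_top hQt)).1 h5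
    exact (ENNReal.mul_le_mul_iff_right (by simp) ENNReal.ofReal_ne_top).1 h4
  have hmono : Monotone fun k : ℕ =>
      {p : ℝ × E | 1 / ((k : ℝ) + 1) ≤ |p.1| ∧ 2 * |p.1| < D p.2}.indicator
        (weightedDiff D f e) := by
    intro k l hkl
    refine indicator_le_indicator_of_subset (fun p hp => ⟨?_, hp.2⟩) (fun _ => zero_le)
    exact (one_div_le_one_div_of_le (by positivity) (by gcongr)).trans hp.1
  have hle : ∀ p, {p : ℝ × E | 2 * |p.1| < D p.2}.indicator (weightedDiff D f e) p ≤
      ⨆ k : ℕ, {p : ℝ × E | 1 / ((k : ℝ) + 1) ≤ |p.1| ∧ 2 * |p.1| < D p.2}.indicator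
        (weightedDiff D f e) p := by
    intro p
    by_cases hp : 2 * |p.1| < D p.2
    swap
    · rw [indicator_of_notMem (by exact hp)]; exact zero_le
    rw [indicator_of_mem (by exact hp)]
    -- No truncated region contains `t = 0`, but the weight vanishes there.
    by_cases ht : p.1 = 0
    · simp [weightedDiff, ht]
    · obtain ⟨k, hk⟩ := exists_nat_one_div_lt (abs_pos.2 ht)
      refine le_trans (le_of_eq ?_) (le_iSup _ k)
      rw [indicator_of_mem (by exact ⟨hk.le, hp⟩)]
  refine (lintegral_mono hle).trans ?_
  rw [lintegral_iSup (fun k => hwm.indicator (measurableSet_near hDc _)) hmono]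
  exact iSup_le fun k => main _ (by positivity)

end
end TraceSpaces
end

/-! ### Multiplication by cutoffs in terms of second differences. -/

noncomputable section
namespace TraceSpaces

open scoped FourierTransform RealInnerProductSpace

section
variable {E : Type*} [NormedAddCommGroup E] [InnerProductSpace ℝ E] [FiniteDimensional ℝ E]
  [MeasurableSpace E] [BorelSpace E]

/-- A bounded function whose first and second differences with step `h` at `x` are
`O(‖h‖ / D x)` and `O((‖h‖ / D x)²)`. -/
structure IsCutoff (L : ℝ) (D θ : E → ℝ) : Prop where
  abs_le_one : ∀ x, |θ x| ≤ 1
  first : ∀ x h, 2 * ‖h‖ < D x → |θ (x + h) - θ x| ≤ L * (‖h‖ / D x)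
  second : ∀ x h, 2 * ‖h‖ < D x → |θ (x + h) - 2 * θ x + θ (x - h)| ≤ L * (‖h‖ / D x) ^ 2

/-- For short steps this is the product rule. For `2|t| ≥ D x` all three points have `D ≤ 3|t|`, and
`|θ| ≤ 1` suffices. -/
lemma enorm_sdiff_mul_le {L : ℝ} {D θ : E → ℝ} (hD : LipschitzWith 1 D)
    (hθ : IsCutoff L D θ) (f : E → ℂ) {e : E} (he : ‖e‖ = 1) (p : ℝ × E) :
    ‖sdiff (fun x => (θ x : ℂ) * f x) (p.1 • e) p.2‖ₑ ^ 2 ≤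
      3 * ‖sdiff f (p.1 • e) p.2‖ₑ ^ 2 +
      (ENNReal.ofReal (3 * L ^ 2) * {p : ℝ × E | 2 * |p.1| < D p.2}.indicator (weightedDiff D f e) p
      + (ENNReal.ofReal (3 * L ^ 2 * (3 / 2) ^ 4) * {p : ℝ × E | |p.1| < D p.2}.indicator
        (fun p => ENNReal.ofReal ((|p.1| / D p.2) ^ 4) * ‖f p.2‖ₑ ^ 2) (p.1, p.2 + p.1 • -e)
      + 6 * ({p : ℝ × E | D p.2 ≤ 3 * |p.1|}.indicator (fun p => ‖f p.2‖ₑ ^ 2)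
          (p.1, p.2 + p.1 • e) +
        ({p : ℝ × E | D p.2 ≤ 3 * |p.1|}.indicator (fun p => ‖f p.2‖ₑ ^ 2) p +
        {p : ℝ × E | D p.2 ≤ 3 * |p.1|}.indicator (fun p => ‖f p.2‖ₑ ^ 2)
          (p.1, p.2 + p.1 • -e))))) := by
  obtain ⟨t, x⟩ := p
  have hte : ‖t • e‖ = |t| := by rw [norm_smul, he, mul_one, Real.norm_eq_abs]
  have hte' : ‖t • -e‖ = |t| := by rw [smul_neg, norm_neg, hte]
  have hsub : ∀ z : E, z + t • -e = z - t • e := fun z => by rw [smul_neg, sub_eq_add_neg]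
  by_cases hp : 2 * |t| < D x
  · rw [indicator_of_mem (s := {p : ℝ × E | 2 * |p.1| < D p.2}) (by exact hp)]
    have h1 : D (x + t • -e) ≤ 3 / 2 * D x := by
      have := lipschitz_shift_le hD x (t • -e)
      rw [hte'] at this; linarith
    have h2 : |t| < D (x + t • -e) := by
      have := lipschitz_shift_le hD (x + t • -e) (t • e)
      rw [hte, add_assoc, ← smul_add, neg_add_cancel, smul_zero, add_zero] at this; linarith
    rw [indicator_of_mem (s := {p : ℝ × E | |p.1| < D p.2}) (by exact h2)]
    have hDx : 0 < D x := lt_of_le_of_lt (by positivity) hp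
    have hDy : 0 < D (x + t • -e) := lt_of_le_of_lt (by positivity) h2
    rw [← add_assoc, ← add_assoc]
    refine le_trans ?_ le_self_add
    simp only [weightedDiff]
    rw [hsub] at *
    set w := |t| / D x with hw
    -- The weight is moved to the point `x - te` where `f` is evaluated, so that translation
    -- invariance applies.
    have hw4 : w ^ 4 ≤ (3 / 2) ^ 4 * (|t| / D (x - t • e)) ^ 4 := by
      rw [← mul_pow]
      refine pow_le_pow_left₀ (by positivity) ?_ 4
      rw [hw, ← mul_div_assoc, div_le_div_iff₀ hDx hDy]
      nlinarith [mul_le_mul_of_nonneg_left h1 (abs_nonneg t)]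
    have hf1 := hθ.first x (t • e) (by rw [hte]; exact hp)
    have hf2 := hθ.second x (t • e) (by rw [hte]; exact hp)
    rw [hte, ← hw] at hf1 hf2
    have hL : 0 ≤ L * w ^ 2 := (abs_nonneg _).trans hf2
    have hL' : 0 ≤ L * w := (abs_nonneg _).trans hf1
    set a := f (x + t • e) - f (x - t • e) with ha
    -- The product rule is arranged so that only the centred difference `f(x+h) - f(x-h)` occurs,
    -- the one in `weightedDiff`.
    have hid : sdiff (fun x => (θ x : ℂ) * f x) (t • e) x = (θ x : ℂ) * sdiff f (t • e) x +
        ((θ (x + t • e) - θ x : ℝ) : ℂ) * a +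
        ((θ (x + t • e) - 2 * θ x + θ (x - t • e) : ℝ) : ℂ) * f (x - t • e) := by
      rw [ha, sdiff, sdiff]; push_cast; ring
    have hn : ‖sdiff (fun x => (θ x : ℂ) * f x) (t • e) x‖ ≤ ‖sdiff f (t • e) x‖ +
        L * w * ‖a‖ + L * w ^ 2 * ‖f (x - t • e)‖ := by
      rw [hid]
      refine (norm_add₃_le).trans ?_
      rw [norm_mul, norm_mul, norm_mul, Complex.norm_real, Complex.norm_real, Complex.norm_real]
      refine add_le_add (add_le_add ?_ ?_) ?_
      · exact mul_le_of_le_one_left (norm_nonneg _) (hθ.abs_le_one x)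
      · exact mul_le_mul_of_nonneg_right hf1 (norm_nonneg _)
      · exact mul_le_mul_of_nonneg_right hf2 (norm_nonneg _)
    simp only [enorm_sq_eq_ofReal]
    rw [show (3 : ℝ≥0∞) = ENNReal.ofReal 3 by simp, ← ENNReal.ofReal_mul (by positivity),
      ← ENNReal.ofReal_mul (by positivity), ← ENNReal.ofReal_mul (by positivity),
      ← ENNReal.ofReal_mul (by positivity), ← ENNReal.ofReal_mul (by positivity),
      ← ENNReal.ofReal_add (by positivity) (by positivity),
      ← ENNReal.ofReal_add (by positivity) (by positivity)]
    refine ENNReal.ofReal_le_ofReal ((pow_le_pow_left₀ (norm_nonneg _) hn 2).trans ?_)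
    have h3 : ∀ u v z : ℝ, (u + v + z) ^ 2 ≤ 3 * u ^ 2 + 3 * v ^ 2 + 3 * z ^ 2 := fun u v z => by
      nlinarith [sq_nonneg (u - v), sq_nonneg (v - z), sq_nonneg (u - z)]
    refine (h3 _ _ _).trans ?_
    refine add_le_add (add_le_add le_rfl (le_of_eq (by ring))) ?_
    calc 3 * (L * w ^ 2 * ‖f (x - t • e)‖) ^ 2
        = 3 * L ^ 2 * ‖f (x - t • e)‖ ^ 2 * w ^ 4 := by ring
      _ ≤ 3 * L ^ 2 * ‖f (x - t • e)‖ ^ 2 * ((3 / 2) ^ 4 * (|t| / D (x - t • e)) ^ 4) := by gcongr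
      _ = _ := by ring
  · push Not at hp
    have h1 : D (x + t • e) ≤ 3 * |t| := by
      have := lipschitz_shift_le hD x (t • e)
      rw [hte] at this; linarith
    have h2 : D (x + t • -e) ≤ 3 * |t| := by
      have := lipschitz_shift_le hD x (t • -e)
      rw [hte'] at this; linarith
    have h3 : D x ≤ 3 * |t| := by linarith [abs_nonneg t]
    rw [indicator_of_mem (s := {p : ℝ × E | D p.2 ≤ 3 * |p.1|}) (by exact h1),
      indicator_of_mem (s := {p : ℝ × E | D p.2 ≤ 3 * |p.1|}) (by exact h3),
      indicator_of_mem (s := {p : ℝ × E | D p.2 ≤ 3 * |p.1|}) (by exact h2)]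
    rw [← add_assoc, ← add_assoc]
    refine le_trans ?_ le_add_self
    simp only [enorm_sq_eq_ofReal]
    rw [show (6 : ℝ≥0∞) = ENNReal.ofReal 6 by simp,
      ← ENNReal.ofReal_add (by positivity) (by positivity),
      ← ENNReal.ofReal_add (by positivity) (by positivity), ← ENNReal.ofReal_mul (by positivity)]
    refine ENNReal.ofReal_le_ofReal ?_
    rw [hsub]
    have hb : ∀ z, ‖(θ z : ℂ) * f z‖ ≤ ‖f z‖ := fun z => by
      rw [norm_mul, Complex.norm_real]
      exact mul_le_of_le_one_left (norm_nonneg _) (hθ.abs_le_one z)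
    have hn : ‖sdiff (fun x => (θ x : ℂ) * f x) (t • e) x‖ ≤
        ‖f (x + t • e)‖ + 2 * ‖f x‖ + ‖f (x - t • e)‖ := by
      rw [sdiff]
      refine (norm_add_le _ _).trans (add_le_add ((norm_sub_le _ _).trans
        (add_le_add (hb _) ?_)) (hb _))
      rw [norm_mul]
      norm_num
      simpa using hb x
    refine (pow_le_pow_left₀ (norm_nonneg _) hn 2).trans ?_
    nlinarith [sq_nonneg (2 * ‖f (x + t • e)‖ - ‖f x‖), sq_nonneg (2 * ‖f (x - t • e)‖ - ‖f x‖),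
      sq_nonneg (‖f (x + t • e)‖ - ‖f (x - t • e)‖)]

/-- The constant depends on the cutoff only through `L`, so cutoffs approaching the boundary at ever
smaller scales stay under control. -/
lemma exists_gagliardo_mul_le {s : ℝ} (hs : 0 < s) (hs2 : s < 3 / 2) (L : ℝ) :
    ∃ C : ℝ≥0∞, C ≠ ⊤ ∧ ∀ (D θ : E → ℝ) (f : E → ℂ) (e : E), LipschitzWith 1 D →
      (∀ x, 0 ≤ D x) → IsCutoff L D θ → Measurable f → ∫⁻ x, ‖f x‖ₑ ^ 2 ≠ ⊤ → ‖e‖ = 1 →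
      gagliardo s e (fun x => (θ x : ℂ) * f x) ≤ C * (gagliardo s e f + hardyInt s D f) := by
  obtain ⟨A, hA, hAf⟩ := exists_lintegral_weightedDiff_le (E := E) hs hs2
  obtain ⟨B, hB, hBf⟩ := exists_lintegral_far_le (E := E) (b := 3) hs (by norm_num)
  obtain ⟨N, hN, hNf⟩ := exists_lintegral_near_le (E := E) hs (by linarith : s < 2)
  refine ⟨3 + (ENNReal.ofReal (3 * L ^ 2) * A + (ENNReal.ofReal (3 * L ^ 2 * (3 / 2) ^ 4) * N +
    6 * (B + (B + B)))), ?_, fun D θ f e hD hD0 hθ hf hf2 he => ?_⟩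
  · simp [ENNReal.mul_eq_top, hA, hB, hN]
  have hDc := hD.continuous
  have hDm := hDc.measurable
  set F : ℝ × E → ℝ≥0∞ :=
    {p : ℝ × E | D p.2 ≤ 3 * |p.1|}.indicator (fun p => ‖f p.2‖ₑ ^ 2) with hF
  have hFm : Measurable F := Measurable.indicator (by fun_prop)
    (measurableSet_le (by fun_prop) (by fun_prop))
  have hFi : ∫⁻ p, F p ∂diffMeasure E s ≤ B * hardyInt s D f := hBf D f hDc hD0 hf
  set T : ℝ × E → ℝ≥0∞ := {p : ℝ × E | |p.1| < D p.2}.indicator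
        (fun p => ENNReal.ofReal ((|p.1| / D p.2) ^ 4) * ‖f p.2‖ₑ ^ 2) with hT
  have hTm : Measurable T := Measurable.indicator (by fun_prop)
    (measurableSet_lt (by fun_prop) (by fun_prop))
  have hTi : ∫⁻ p, T p ∂diffMeasure E s ≤ N * hardyInt s D f := hNf D f hDc hD0 hf
  set G : ℝ × E → ℝ≥0∞ := {p : ℝ × E | 2 * |p.1| < D p.2}.indicator (weightedDiff D f e) with hG
  have hGm : Measurable G := (measurable_weightedDiff hDm hf e).indicator
    (measurableSet_lt (by fun_prop) (by fun_prop))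
  have hGi : ∫⁻ p, G p ∂diffMeasure E s ≤ A * (gagliardo s e f + hardyInt s D f) :=
    hAf D f e hD hD0 hf hf2 he
  have hsm : Measurable fun p : ℝ × E => ‖sdiff f (p.1 • e) p.2‖ₑ ^ 2 :=
    (measurable_sdiff hf e).enorm.pow_const 2
  have hpt : ∀ p : ℝ × E, ‖sdiff (fun x => (θ x : ℂ) * f x) (p.1 • e) p.2‖ₑ ^ 2 ≤
      3 * ‖sdiff f (p.1 • e) p.2‖ₑ ^ 2 + (ENNReal.ofReal (3 * L ^ 2) * G p
      + (ENNReal.ofReal (3 * L ^ 2 * (3 / 2) ^ 4) * T (p.1, p.2 + p.1 • -e)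
      + 6 * (F (p.1, p.2 + p.1 • e) + (F p + F (p.1, p.2 + p.1 • -e))))) :=
    enorm_sdiff_mul_le hD hθ f he
  clear_value F T G
  refine (lintegral_mono hpt).trans ?_
  rw [lintegral_add_left (by fun_prop), lintegral_add_left (by fun_prop),
    lintegral_add_left (by fun_prop), lintegral_const_mul _ (by fun_prop),
    lintegral_const_mul _ (by fun_prop), lintegral_const_mul _ (by fun_prop),
    lintegral_const_mul _ (by fun_prop), lintegral_add_left (by fun_prop),
    lintegral_add_left (by fun_prop), lintegral_diffMeasure_shift s e hFm,
    lintegral_diffMeasure_shift s (-e) hFm, lintegral_diffMeasure_shift s (-e) hTm,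
    add_mul, add_mul, add_mul]
  have hle : hardyInt s D f ≤ gagliardo s e f + hardyInt s D f := le_add_self
  set R := gagliardo s e f + hardyInt s D f
  have hFi' : ∫⁻ p, F p ∂diffMeasure E s ≤ B * R := hFi.trans (mul_le_mul_right hle B)
  have hTi' : ∫⁻ p, T p ∂diffMeasure E s ≤ N * R := hTi.trans (mul_le_mul_right hle N)
  refine add_le_add (mul_le_mul_right le_self_add 3) (add_le_add ?_ (add_le_add ?_ ?_))
  · rw [mul_assoc]; exact mul_le_mul_right hGi _
  · exact (mul_le_mul_right hTi' _).trans_eq (mul_assoc _ _ _).symm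
  · rw [mul_assoc, add_mul, add_mul]
    exact mul_le_mul_right (add_le_add hFi' (add_le_add hFi' hFi')) _

lemma IsCutoff.mul {L₁ L₂ : ℝ} {D a b : E → ℝ} (ha : IsCutoff L₁ D a) (hb : IsCutoff L₂ D b) :
    IsCutoff (L₁ + L₂ + 2 * (L₁ * L₂)) D (fun x => a x * b x) := by
  refine ⟨fun x => ?_, fun x h hx => ?_, fun x h hx => ?_⟩
  · rw [abs_mul]; exact mul_le_one₀ (ha.abs_le_one x) (abs_nonneg _) (hb.abs_le_one x)
  · have h1 := ha.first x h hx
    have h2 := hb.first x h hx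
    have hD : 0 < D x := lt_of_le_of_lt (by positivity) hx
    set w := ‖h‖ / D x
    -- `IsCutoff` does not include `0 ≤ L`; the bounds force it as soon as `w > 0`.
    have hL : 0 ≤ (L₁ * L₂) * w := by
      by_cases hw : w = 0
      · simp [hw]
      have hw0 : 0 < w := lt_of_le_of_ne (by positivity) (Ne.symm hw)
      have i1 : 0 ≤ L₁ := nonneg_of_mul_nonneg_left ((abs_nonneg _).trans h1) hw0
      have i2 : 0 ≤ L₂ := nonneg_of_mul_nonneg_left ((abs_nonneg _).trans h2) hw0
      positivity
    calc |a (x + h) * b (x + h) - a x * b x|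
        = |(a (x + h) - a x) * b (x + h) + a x * (b (x + h) - b x)| := by congr 1; ring
      _ ≤ |a (x + h) - a x| * |b (x + h)| + |a x| * |b (x + h) - b x| := by
        rw [← abs_mul, ← abs_mul]; exact abs_add_le _ _
      _ ≤ L₁ * w * 1 + 1 * (L₂ * w) := add_le_add
        (mul_le_mul h1 (hb.abs_le_one _) (abs_nonneg _) ((abs_nonneg _).trans h1))
        (mul_le_mul (ha.abs_le_one _) h2 (abs_nonneg _) zero_le_one)
      _ ≤ _ := by linarith
  · have h1 := ha.first x h hx
    have h2 := hb.first x h hx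
    have h2' := hb.first x (-h) (by rwa [norm_neg])
    have h3 := ha.second x h hx
    have h4 := hb.second x h hx
    rw [norm_neg, ← sub_eq_add_neg] at h2'
    set w := ‖h‖ / D x
    have h5 : |b (x + h) - b (x - h)| ≤ 2 * (L₂ * w) := by
      rw [show b (x + h) - b (x - h) = (b (x + h) - b x) - (b (x - h) - b x) by ring]
      linarith [abs_sub (b (x + h) - b x) (b (x - h) - b x)]
    calc |a (x + h) * b (x + h) - 2 * (a x * b x) + a (x - h) * b (x - h)|
        = |a x * (b (x + h) - 2 * b x + b (x - h)) + (a (x + h) - a x) * (b (x + h) - b (x - h)) +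
          (a (x + h) - 2 * a x + a (x - h)) * b (x - h)| := by congr 1; ring
      _ ≤ |a x| * |b (x + h) - 2 * b x + b (x - h)| +
          |a (x + h) - a x| * |b (x + h) - b (x - h)| +
          |a (x + h) - 2 * a x + a (x - h)| * |b (x - h)| := by
        rw [← abs_mul, ← abs_mul, ← abs_mul]; exact abs_add_three _ _ _
      _ ≤ 1 * (L₂ * w ^ 2) + (L₁ * w) * (2 * (L₂ * w)) + (L₁ * w ^ 2) * 1 :=
        add_le_add (add_le_add (mul_le_mul (ha.abs_le_one _) h4 (abs_nonneg _) zero_le_one)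
          (mul_le_mul h1 h5 (abs_nonneg _) ((abs_nonneg _).trans h1)))
          (mul_le_mul h3 (hb.abs_le_one _) (abs_nonneg _) ((abs_nonneg _).trans h3))
      _ = _ := by ring

-- Despite its jump, the indicator of `Ω` does not change under steps shorter than `D`. So extension
-- by zero is itself multiplication by a cutoff, with constant `0`.
open Classical in
lemma isCutoff_indicator {D : E → ℝ} {Ω : Set E}
    (hΩ : ∀ x h, ‖h‖ < D x → (x + h ∈ Ω ↔ x ∈ Ω)) : IsCutoff 0 D (Ω.indicator 1) := by
  have h1 : ∀ x h, 2 * ‖h‖ < D x → Ω.indicator (1 : E → ℝ) (x + h) = Ω.indicator 1 x := by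
    intro x h hx
    have := hΩ x h (by linarith [norm_nonneg h])
    simp only [indicator_apply, this, Pi.one_apply]
  refine ⟨fun x => ?_, fun x h hx => ?_, fun x h hx => ?_⟩
  · by_cases hx : x ∈ Ω <;> simp [hx]
  · rw [h1 x h hx]; simp
  · have h2 := h1 x (-h) (by rwa [norm_neg])
    rw [← sub_eq_add_neg] at h2
    rw [h1 x h hx, h2]
    ring_nf
    simp

end
end TraceSpaces
end

/-! ### Construction of the cutoffs by averaging indicators. -/

noncomputable section
namespace TraceSpaces

open scoped FourierTransform RealInnerProductSpace

section
variable {E : Type*} [NormedAddCommGroup E] [InnerProductSpace ℝ E] [FiniteDimensional ℝ E]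
  [MeasurableSpace E] [BorelSpace E]

/-- An averaging kernel on the unit ball with `L¹` bounds for its first and second differences. -/
structure IsAveragingKernel (M : ℝ) (ρ : E → ℝ) : Prop where
  continuous : Continuous ρ
  nonneg : ∀ y, 0 ≤ ρ y
  eq_zero : ∀ y, 1 ≤ ‖y‖ → ρ y = 0
  hasCompactSupport : HasCompactSupport ρ
  integral_eq : ∫ y, ρ y = 1
  const_nonneg : 0 ≤ M
  first : ∀ k, ‖k‖ ≤ 4 → ∫ y, |ρ (y + k) - ρ y| ≤ M * ‖k‖
  second : ∀ k, ‖k‖ ≤ 4 → ∫ y, |ρ (y + k) - 2 * ρ y + ρ (y - k)| ≤ M * ‖k‖ ^ 2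

lemma integral_abs_le_of_ball {u : E → ℝ} {c r : ℝ} (h0 : ∀ y, r ≤ ‖y‖ → u y = 0)
    (hc : ∀ y, |u y| ≤ c) : ∫ y, |u y| ≤ c * volume.real (Metric.ball (0 : E) r) := by
  have h1 : (fun y => |u y|) = (Metric.ball (0 : E) r).indicator fun y => |u y| := by
    ext y
    by_cases hy : y ∈ Metric.ball (0 : E) r
    · rw [indicator_of_mem hy]
    · rw [indicator_of_notMem hy, h0 y (by simpa using hy), abs_zero]
  rw [h1, integral_indicator measurableSet_ball]
  refine (Real.le_norm_self _).trans ?_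
  exact norm_setIntegral_le_of_norm_le_const measure_ball_lt_top
    (fun y _ => by rw [Real.norm_eq_abs, abs_abs]; exact hc y)

-- A normalised bump function works: the `L¹` bounds follow from the Lipschitz constants of `ρ` and
-- of its derivative and from the bounded support.
variable (E) in
lemma exists_isAveragingKernel : ∃ (M : ℝ) (ρ : E → ℝ), IsAveragingKernel M ρ := by
  let b : ContDiffBump (0 : E) := ⟨1 / 2, 1, by norm_num, by norm_num⟩
  set ρ : E → ℝ := b.normed volume with hρ
  have hsm : ContDiff ℝ 2 ρ := b.contDiff_normed
  have hcs : HasCompactSupport ρ := b.hasCompactSupport_normed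
  have hz : ∀ y, 1 ≤ ‖y‖ → ρ y = 0 := fun y hy => by
    by_contra h
    have : y ∈ Function.support ρ := h
    rw [hρ, b.support_normed_eq] at this
    have : ‖y‖ < 1 := by simpa using this
    linarith
  obtain ⟨C₁, hC₁⟩ := hsm.lipschitzWith_of_hasCompactSupport hcs (by norm_num)
  have hd : ContDiff ℝ 1 (fderiv ℝ ρ) := hsm.fderiv_right (by norm_num)
  obtain ⟨C₂, hC₂⟩ := hd.lipschitzWith_of_hasCompactSupport (hcs.fderiv ℝ) (by norm_num)
  have hdiff : Differentiable ℝ ρ := hsm.differentiable (by norm_num)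
  -- Radius `5`: the support lies in the unit ball and the shifts have length at most `4`.
  set v := volume.real (Metric.ball (0 : E) 5)
  have hshift : ∀ y k : E, ‖k‖ ≤ 4 → 5 ≤ ‖y‖ → ρ (y + k) = 0 := fun y k hk hy => by
    refine hz _ ?_
    have := norm_sub_norm_le y (-k)
    rw [norm_neg, sub_neg_eq_add] at this
    linarith
  refine ⟨C₁ * v + C₂ * v, ρ, hsm.continuous, b.nonneg_normed, hz, hcs, b.integral_normed,
    by positivity, fun k hk => ?_, fun k hk => ?_⟩
  · refine (integral_abs_le_of_ball (c := C₁ * ‖k‖) (r := 5) (fun y hy => ?_) fun y => ?_).trans ?_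
    · rw [hshift y k hk hy, hz y (by linarith), sub_zero]
    · have := hC₁.dist_le_mul (y + k) y
      simpa [Real.dist_eq, dist_eq_norm] using this
    · have : 0 ≤ C₂ * v * ‖k‖ := by positivity
      linarith
  · refine (integral_abs_le_of_ball (c := C₂ * ‖k‖ ^ 2) (r := 5) (fun y hy => ?_)
      fun y => ?_).trans ?_
    · have := hshift y (-k) (by rwa [norm_neg]) hy
      rw [← sub_eq_add_neg] at this
      rw [hshift y k hk hy, hz y (by linarith), this]; simp
    · have hg : ∀ z, HasFDerivAt (fun z => ρ (z + k) - ρ z)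
          (fderiv ℝ ρ (z + k) - fderiv ℝ ρ z) z := fun z => by
        refine HasFDerivAt.sub ?_ (hdiff z).hasFDerivAt
        exact (hasFDerivAt_comp_add_right k).2 (hdiff (z + k)).hasFDerivAt
      have := convex_univ.norm_image_sub_le_of_norm_hasFDerivWithin_le (C := C₂ * ‖k‖)
        (fun z _ => (hg z).hasFDerivWithinAt) (fun z _ => by
          have := hC₂.dist_le_mul (z + k) z
          simpa [dist_eq_norm] using this) (mem_univ (y - k)) (mem_univ y)
      simp only [sub_add_cancel, sub_sub_cancel, Real.norm_eq_abs] at this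
      calc _ = |ρ (y + k) - ρ y - (ρ y - ρ (y - k))| := by congr 1; ring
        _ ≤ _ := this
        _ = _ := by ring
    · have : 0 ≤ C₁ * v * ‖k‖ ^ 2 := by positivity
      linarith

/-- The average of `g` at scale `ε`. -/
def average (ρ : E → ℝ) (ε : ℝ) (g : E → ℝ) (x : E) : ℝ := ∫ y, g (x - ε • y) * ρ y

namespace IsAveragingKernel

variable {M : ℝ} {ρ : E → ℝ} {g : E → ℝ}

lemma integrable_shift (hρ : IsAveragingKernel M ρ) (k : E) : Integrable fun y => ρ (y + k) :=
  (hρ.continuous.integrable_of_hasCompactSupport hρ.hasCompactSupport).comp_add_right k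

lemma integrable_mul {u : E → ℝ} (hu : Integrable u) (hg : Measurable g) (hg1 : ∀ z, |g z| ≤ 1)
    (ε : ℝ) (x : E) : Integrable fun y => g (x - ε • y) * u y :=
  hu.bdd_mul (c := 1)
    (hg.comp (by fun_prop : Measurable fun y => x - ε • y)).aestronglyMeasurable (ae_of_all _ fun y => by simpa using hg1 _)

/-- The shift is moved onto the kernel, so differences of the average are estimated for `g` merely
measurable and bounded. -/
lemma average_add {ε : ℝ} (hε : 0 < ε) (x h : E) :
    average ρ ε g (x + h) = ∫ y, g (x - ε • y) * ρ (y + ε⁻¹ • h) := by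
  rw [average, ← integral_add_right_eq_self _ (ε⁻¹ • h)]
  congr 1; ext y
  congr 2
  rw [smul_add, smul_smul, mul_inv_cancel₀ hε.ne', one_smul]; abel

lemma abs_integral_le {u : E → ℝ} (hu : Integrable u) (hg1 : ∀ z, |g z| ≤ 1) (ε : ℝ) (x : E) :
    |∫ y, g (x - ε • y) * u y| ≤ ∫ y, |u y| := by
  rw [← Real.norm_eq_abs]
  refine (norm_integral_le_integral_norm _).trans ?_
  refine integral_mono_of_nonneg (ae_of_all _ fun y => norm_nonneg _) hu.abs
    (ae_of_all _ fun y => ?_)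
  dsimp only
  rw [norm_mul]
  exact mul_le_of_le_one_left (norm_nonneg _) (hg1 _)

lemma abs_average_le (hρ : IsAveragingKernel M ρ) (hg1 : ∀ z, |g z| ≤ 1) (ε : ℝ) (x : E) : |average ρ ε g x| ≤ 1 := by
  refine (abs_integral_le (by simpa using hρ.integrable_shift 0) hg1 ε x).trans_eq ?_
  simp_rw [abs_of_nonneg (hρ.nonneg _)]
  exact hρ.integral_eq

lemma average_eq_const (hρ : IsAveragingKernel M ρ) {ε : ℝ} (hε : 0 < ε) {x : E} {c : ℝ} (h : ∀ z, ‖z - x‖ < ε → g z = c) :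
    average ρ ε g x = c := by
  have : ∀ y, g (x - ε • y) * ρ y = c * ρ y := fun y => by
    by_cases hy : 1 ≤ ‖y‖
    · rw [hρ.eq_zero y hy, mul_zero, mul_zero]
    · rw [h]
      rw [sub_sub_cancel_left, norm_neg, norm_smul, Real.norm_of_nonneg hε.le]
      nlinarith
  rw [average]
  simp_rw [this]
  rw [integral_const_mul, hρ.integral_eq, mul_one]

lemma abs_average_first_le (hρ : IsAveragingKernel M ρ) (hg : Measurable g) (hg1 : ∀ z, |g z| ≤ 1) {ε : ℝ} (hε : 0 < ε)
    (x : E) {h : E} (hh : ‖h‖ ≤ 4 * ε) :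
    |average ρ ε g (x + h) - average ρ ε g x| ≤ M * (‖h‖ / ε) := by
  have i1 := hρ.integrable_shift (ε⁻¹ • h)
  have i0 : Integrable ρ := by simpa using hρ.integrable_shift 0
  have hk : ‖ε⁻¹ • h‖ = ‖h‖ / ε := by
    rw [norm_smul, norm_inv, Real.norm_of_nonneg hε.le, div_eq_inv_mul]
  have : average ρ ε g (x + h) - average ρ ε g x =
      ∫ y, g (x - ε • y) * (ρ (y + ε⁻¹ • h) - ρ y) := by
    simp_rw [mul_sub]
    rw [average_add hε, average, integral_sub (integrable_mul i1 hg hg1 ε x)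
      (integrable_mul i0 hg hg1 ε x)]
  rw [this, ← hk]
  refine (abs_integral_le (i1.sub i0) hg1 ε x).trans (hρ.first _ ?_)
  rw [hk, div_le_iff₀ hε]; exact hh

lemma abs_average_second_le (hρ : IsAveragingKernel M ρ) (hg : Measurable g) (hg1 : ∀ z, |g z| ≤ 1) {ε : ℝ} (hε : 0 < ε)
    (x : E) {h : E} (hh : ‖h‖ ≤ 4 * ε) :
    |average ρ ε g (x + h) - 2 * average ρ ε g x + average ρ ε g (x - h)| ≤ M * (‖h‖ / ε) ^ 2 := by
  have i1 := hρ.integrable_shift (ε⁻¹ • h)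
  have i2 := hρ.integrable_shift (-(ε⁻¹ • h))
  have i0 : Integrable ρ := by simpa using hρ.integrable_shift 0
  have hk : ‖ε⁻¹ • h‖ = ‖h‖ / ε := by
    rw [norm_smul, norm_inv, Real.norm_of_nonneg hε.le, div_eq_inv_mul]
  simp_rw [← sub_eq_add_neg] at i2
  have h2 : average ρ ε g (x - h) = ∫ y, g (x - ε • y) * ρ (y - ε⁻¹ • h) := by
    rw [sub_eq_add_neg, average_add hε]
    simp_rw [smul_neg, ← sub_eq_add_neg]
  have : average ρ ε g (x + h) - 2 * average ρ ε g x + average ρ ε g (x - h) =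
      ∫ y, g (x - ε • y) * (ρ (y + ε⁻¹ • h) - 2 * ρ y + ρ (y - ε⁻¹ • h)) := by
    have e0 := integrable_mul i0 hg hg1 ε x
    have e1 := integrable_mul i1 hg hg1 ε x
    have e2 := integrable_mul i2 hg hg1 ε x
    have : ∀ y, g (x - ε • y) * (ρ (y + ε⁻¹ • h) - 2 * ρ y + ρ (y - ε⁻¹ • h)) =
      g (x - ε • y) * ρ (y + ε⁻¹ • h) - 2 * (g (x - ε • y) * ρ y) +
        g (x - ε • y) * ρ (y - ε⁻¹ • h) := fun y => by ring
    simp_rw [this]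
    rw [integral_add (by exact e1.sub (e0.const_mul 2)) e2, integral_sub e1 (e0.const_mul 2),
      integral_const_mul, average_add hε, average, h2]
  rw [this, ← hk]
  refine (abs_integral_le ((i1.sub (i0.const_mul 2)).add i2) hg1 ε x).trans (hρ.second _ ?_)
  rw [hk, div_le_iff₀ hε]; exact hh

lemma continuous_average (hρ : IsAveragingKernel M ρ) (hg : Measurable g) (hg1 : ∀ z, |g z| ≤ 1) {ε : ℝ} (hε : 0 < ε) :
    Continuous (average ρ ε g) := by
  rw [Metric.continuous_iff]
  intro x δ hδ
  have hM := hρ.const_nonneg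
  refine ⟨min (4 * ε) (δ * ε / (M + 1)), by positivity, fun z hz => ?_⟩
  have h1 := hρ.abs_average_first_le hg hg1 hε x (h := z - x)
    (by rw [← dist_eq_norm]; exact (hz.trans_le (min_le_left _ _)).le)
  rw [add_sub_cancel, ← dist_eq_norm] at h1
  rw [Real.dist_eq]
  refine h1.trans_lt ?_
  have h2 := hz.trans_le (min_le_right _ _)
  rw [lt_div_iff₀ (by positivity)] at h2
  rw [← mul_div_assoc, div_lt_iff₀ hε]
  nlinarith [dist_nonneg (x := z) (y := x)]

end IsAveragingKernel

variable (E) in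
/-- Cutoffs that vanish near `D = 0` and near infinity, with uniform constants. -/
lemma exists_isCutoff : ∃ L : ℝ, ∀ D : E → ℝ, LipschitzWith 1 D → (∀ x, D x ≤ 1) →
    ∀ ε > 0, ∀ R : ℝ, ∃ θ : E → ℝ, Continuous θ ∧ IsCutoff L D θ ∧ (∀ x, D x ≤ ε → θ x = 0) ∧
      (∀ x, R + 1 ≤ ‖x‖ → θ x = 0) ∧ ∀ x, 3 * ε ≤ D x → ‖x‖ ≤ R - 1 → θ x = 1 := by
  obtain ⟨M, ρ, hρ⟩ := exists_isAveragingKernel E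
  refine ⟨64 * M + 64 * M + 2 * ((64 * M) * (64 * M)), fun D hD hD1 ε hε R => ?_⟩
  have hM := hρ.const_nonneg
  -- The threshold `2ε` lies a full averaging radius `ε` from both levels `ε` and `3ε`, as `D` is
  -- `1`-Lipschitz.
  set g₁ : E → ℝ := {x | 2 * ε ≤ D x}.indicator 1 with hg₁
  set g₂ : E → ℝ := {x | ‖x‖ ≤ R}.indicator 1 with hg₂
  have m₁ : Measurable g₁ :=
    measurable_one.indicator (measurableSet_le measurable_const hD.continuous.measurable)
  have m₂ : Measurable g₂ :=
    measurable_one.indicator (measurableSet_le measurable_norm measurable_const)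
  have b₁ : ∀ z, |g₁ z| ≤ 1 := fun z => by
    by_cases hz : z ∈ {x | 2 * ε ≤ D x} <;> simp [hg₁, hz]
  have b₂ : ∀ z, |g₂ z| ≤ 1 := fun z => by
    by_cases hz : z ∈ {x | ‖x‖ ≤ R} <;> simp [hg₂, hz]
  have hLip : ∀ x z, |D z - D x| ≤ ‖z - x‖ := fun x z => by
    have := hD.dist_le_mul z x
    simpa [Real.dist_eq, dist_eq_norm] using this
  have one₁ : ∀ x, 3 * ε ≤ D x → average ρ ε g₁ x = 1 := fun x hx =>
    hρ.average_eq_const hε fun z hz => by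
      rw [hg₁, indicator_of_mem]; rfl
      have := abs_le.1 (hLip x z)
      change 2 * ε ≤ D z
      linarith
  have zero₁ : ∀ x, D x ≤ ε → average ρ ε g₁ x = 0 := fun x hx =>
    hρ.average_eq_const hε fun z hz => by
      rw [hg₁, indicator_of_notMem]
      have := abs_le.1 (hLip x z)
      change ¬ 2 * ε ≤ D z
      linarith
  have one₂ : ∀ x, ‖x‖ ≤ R - 1 → average ρ 1 g₂ x = 1 := fun x hx =>
    hρ.average_eq_const one_pos fun z hz => by
      rw [hg₂, indicator_of_mem]; rfl
      have := norm_sub_norm_le z x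
      change ‖z‖ ≤ R
      linarith
  have zero₂ : ∀ x, R + 1 ≤ ‖x‖ → average ρ 1 g₂ x = 0 := fun x hx =>
    hρ.average_eq_const one_pos fun z hz => by
      rw [hg₂, indicator_of_notMem]
      have := norm_sub_norm_le x z
      rw [norm_sub_rev] at this
      change ¬ ‖z‖ ≤ R
      linarith
  have c₁ : IsCutoff (64 * M) D (average ρ ε g₁) := by
    have hfar : ∀ x h, 2 * ‖h‖ < D x → 8 * ε < D x → average ρ ε g₁ (x + h) = 1 := by
      intro x h hh hx
      have := abs_le.1 (hLip x (x + h))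
      rw [add_sub_cancel_left] at this
      exact one₁ _ (by linarith)
    -- Beyond `D x = 8ε` the average is constant along such steps. Below it `‖h‖ ≤ 4ε`, where the
    -- kernel bounds hold, and `1/ε ≤ 8/D x`; squaring gives the constant `64`.
    have hw : ∀ x (h : E), 2 * ‖h‖ < D x → D x ≤ 8 * ε → ‖h‖ / ε ≤ 8 * (‖h‖ / D x) := by
      intro x h hh hx
      have : 0 < D x := lt_of_le_of_lt (by positivity) hh
      rw [← mul_div_assoc, div_le_div_iff₀ hε this]
      nlinarith [norm_nonneg h]
    refine ⟨hρ.abs_average_le b₁ ε, fun x h hh => ?_, fun x h hh => ?_⟩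
    all_goals
      have hDx : 0 < D x := lt_of_le_of_lt (by positivity) hh
      rcases le_or_gt (D x) (8 * ε) with hx | hx
    · refine (hρ.abs_average_first_le m₁ b₁ hε x (by linarith)).trans ?_
      have := hw x h hh hx
      have h0 : 0 ≤ ‖h‖ / D x := by positivity
      calc M * (‖h‖ / ε) ≤ M * (8 * (‖h‖ / D x)) := by gcongr
        _ ≤ 64 * M * (‖h‖ / D x) := by nlinarith [mul_nonneg hM h0]
    · rw [hfar x h hh hx, one₁ x (by linarith)]; simp; positivity
    · refine (hρ.abs_average_second_le m₁ b₁ hε x (by linarith)).trans ?_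
      have := hw x h hh hx
      calc M * (‖h‖ / ε) ^ 2 ≤ M * (8 * (‖h‖ / D x)) ^ 2 := by gcongr
        _ = _ := by ring
    · have := hfar x (-h) (by rwa [norm_neg]) hx
      rw [← sub_eq_add_neg] at this
      rw [hfar x h hh hx, one₁ x (by linarith), this]; norm_num; positivity
  have c₂ : IsCutoff (64 * M) D (average ρ 1 g₂) := by
    -- The cutoff at infinity varies at unit scale, which is admissible because `D ≤ 1`.
    have hw : ∀ x (h : E), 2 * ‖h‖ < D x → ‖h‖ / 1 ≤ ‖h‖ / D x := by
      intro x h hh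
      have : 0 < D x := lt_of_le_of_lt (by positivity) hh
      rw [div_le_div_iff₀ one_pos this]
      nlinarith [norm_nonneg h, hD1 x]
    refine ⟨hρ.abs_average_le b₂ 1, fun x h hh => ?_, fun x h hh => ?_⟩
    all_goals
      have hDx : 0 < D x := lt_of_le_of_lt (by positivity) hh
      have := hw x h hh
      have h0 : 0 ≤ ‖h‖ / D x := by positivity
    · refine (hρ.abs_average_first_le m₂ b₂ one_pos x (by linarith [hD1 x])).trans ?_
      calc M * (‖h‖ / 1) ≤ M * (‖h‖ / D x) := by gcongr
        _ ≤ 64 * M * (‖h‖ / D x) := by nlinarith [mul_nonneg hM h0]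
    · refine (hρ.abs_average_second_le m₂ b₂ one_pos x (by linarith [hD1 x])).trans ?_
      calc M * (‖h‖ / 1) ^ 2 ≤ M * (‖h‖ / D x) ^ 2 := by gcongr
        _ ≤ 64 * M * (‖h‖ / D x) ^ 2 := by nlinarith [mul_nonneg hM (sq_nonneg (‖h‖ / D x))]
  refine ⟨fun x => average ρ ε g₁ x * average ρ 1 g₂ x,
    (hρ.continuous_average m₁ b₁ hε).mul (hρ.continuous_average m₂ b₂ one_pos), c₁.mul c₂,
    fun x hx => ?_, fun x hx => ?_, fun x hx hx' => ?_⟩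
  · simp only [zero₁ x hx, zero_mul]
  · simp only [zero₂ x hx, mul_zero]
  · simp only [one₁ x hx, one₂ x hx', mul_one]

end
end TraceSpaces
end

/-! ### Extension by zero under a finite Hardy integral, and density of test functions. -/

noncomputable section
namespace TraceSpaces

open scoped FourierTransform RealInnerProductSpace

variable {n : ℕ} {s : ℝ}

lemma realToSchwartz_apply (Ω : Opens (Euc n)) (φ : 𝓓(Ω, ℝ)) (x : Euc n) :
    realToSchwartz Ω φ x = ((φ x : ℝ) : ℂ) := rfl

lemma restr_eq_of_forall {Ω : Opens (Euc n)} {U V : Sob n s}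
    (h : ∀ φ : 𝓓(Ω, ℝ), Sob.toDistribution n s U (realToSchwartz Ω φ) =
      Sob.toDistribution n s V (realToSchwartz Ω φ)) : restr Ω s U = restr Ω s V := by
  refine Subtype.ext ?_
  ext φ
  exact h φ

lemma enorm_indicator_mul_le {a : ℝ} (ha : |a| ≤ 1) (z : ℂ) : ‖(a : ℂ) * z‖ₑ ≤ ‖z‖ₑ := by
  rw [enorm_mul]
  refine mul_le_of_le_one_left' ?_
  rw [← ofReal_norm, Complex.norm_real]
  exact ENNReal.ofReal_le_one.2 ha

/-- Where `D ≥ ε`, membership in `Ω` is constant on balls of radius `ε`, so this part of the open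
set is also closed. -/
lemma isCompact_inter_le {Ω : Set (Euc n)} {D : Euc n → ℝ} (hD : Continuous D)
    (hΩD : ∀ x h, ‖h‖ < D x → (x + h ∈ Ω ↔ x ∈ Ω)) {ε : ℝ} (hε : 0 < ε) (R : ℝ) :
    IsCompact (Ω ∩ {x | ε ≤ D x} ∩ Metric.closedBall 0 R) := by
  have hc : IsClosed (Ω ∩ {x | ε ≤ D x}) := by
    refine isClosed_of_closure_subset fun x hx => ?_
    have h1 : ε ≤ D x := closure_minimal (t := {x | ε ≤ D x}) inter_subset_right
      (isClosed_le continuous_const hD) hx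
    obtain ⟨y, hy, hxy⟩ := Metric.mem_closure_iff.1 hx ε hε
    refine ⟨?_, h1⟩
    have := hΩD x (y - x) (by rw [← dist_eq_norm, dist_comm]; linarith)
    rw [add_sub_cancel] at this
    exact this.1 hy.1
  exact (isCompact_closedBall 0 R).inter_left hc

/-- If `U ∈ H^s(ℝⁿ)` has a finite Hardy integral with respect to the distance to the boundary of
`Ω`, then the zero extension of `U|_Ω` belongs to `H̃^s(Ω)`. -/
lemma Sob.exists_mem_HTilde (hs : 0 < s) (hs2 : s < 3 / 2) {Ω : Opens (Euc n)} (U : Sob n s)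
    {D : Euc n → ℝ} (hD : LipschitzWith 1 D) (hD0 : ∀ x, 0 ≤ D x) (hD1 : ∀ x, D x ≤ 1)
    (hΩD : ∀ x h, ‖h‖ < D x → (x + h ∈ Ω ↔ x ∈ Ω)) (hpos : ∀ x ∈ Ω, 0 < D x)
    (hH : hardyInt s D (toL2 hs.le U) ≠ ⊤) :
    ∃ V ∈ HTilde Ω s, restr Ω s V = restr Ω s U := by
  have hs2' : s < 2 := by linarith
  obtain ⟨L, hL⟩ := exists_isCutoff (Euc n)
  obtain ⟨C₁, hC₁, hmul⟩ := exists_gagliardo_mul_le (E := Euc n) hs hs2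
    (0 + L + 2 * (0 * L))
  obtain ⟨C₂, hC₂, hsob⟩ := exists_toL2_eq_of_gagliardo n hs hs2'
  set f := toL2 hs.le U with hf
  have hfm : Measurable f := (Lp.stronglyMeasurable f).measurable
  have hf2 : ∫⁻ x, ‖f x‖ₑ ^ 2 ≠ ⊤ := by rw [lintegral_enorm_sq]; simp
  choose θ hθc hθL hθD hθR hθ1 using fun k : ℕ => hL D hD hD1 (1 / ((k : ℝ) + 1)) (by positivity) k
  set χ : ℕ → Euc n → ℝ := fun k x => (Ω : Set (Euc n)).indicator 1 x * θ k x with hχ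
  have hχL : ∀ k, IsCutoff (0 + L + 2 * (0 * L)) D (χ k) := fun k =>
    (isCutoff_indicator hΩD).mul (hθL k)
  have hχm : ∀ k, Measurable (χ k) := fun k =>
    (measurable_one.indicator Ω.isOpen.measurableSet).mul (hθc k).measurable
  set g : ℕ → Euc n → ℂ := fun k x => (χ k x : ℂ) * f x with hg
  have hgm : ∀ k, Measurable (g k) := fun k => by
    have := hχm k
    exact (Complex.measurable_ofReal.comp this).mul hfm
  have hgf : ∀ k x, ‖g k x‖ₑ ≤ ‖f x‖ₑ := fun k x =>
    enorm_indicator_mul_le ((hχL k).abs_le_one x) _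
  have hgL : ∀ k, MemLp (g k) 2 := fun k =>
    MemLp.of_le_enorm (Lp.memLp f) (hgm k).aestronglyMeasurable (ae_of_all _ (hgf k))
  set G : ℕ → Lp ℂ 2 (volume : Measure (Euc n)) := fun k => (hgL k).toLp (g k) with hG
  have hGg : ∀ k, G k =ᵐ[volume] g k := fun k => (hgL k).coeFn_toLp
  set M : ℝ≥0∞ := ‖f‖ₑ ^ 2 +
    ∑ _i : Fin n, C₁ * (sdiffConst s * ‖U‖ₑ ^ 2 + hardyInt s D f) with hM
  have hMt : M ≠ ⊤ := by
    refine ENNReal.add_ne_top.2 ⟨by simp, ?_⟩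
    refine (ENNReal.sum_lt_top.2 fun i _ => ENNReal.mul_lt_top hC₁.lt_top ?_).ne
    exact ENNReal.add_lt_top.2 ⟨ENNReal.mul_lt_top (sdiffConst_ne_top hs hs2').lt_top (by simp),
      hH.lt_top⟩
  -- The bound uniform in `k`, and the only place where the finite Hardy integral is used.
  have hGM : ∀ k, ‖G k‖ₑ ^ 2 + ∑ i, gagliardo s (unitVec i) (G k) ≤ M := by
    intro k
    refine add_le_add ?_ (Finset.sum_le_sum fun i _ => ?_)
    · rw [← lintegral_enorm_sq, ← lintegral_enorm_sq]
      refine lintegral_mono_ae ?_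
      filter_upwards [hGg k] with x hx
      rw [hx]; gcongr; exact hgf k x
    · rw [gagliardo_congr (Lp.stronglyMeasurable _).measurable (hgm k) (hGg k)]
      refine (hmul D (χ k) f (unitVec i) hD hD0 (hχL k) hfm hf2 (norm_unitVec i)).trans ?_
      gcongr
      exact gagliardo_toL2_le hs U (norm_unitVec i).le
  choose V hVG hVn using fun k => hsob (G k) ((hGM k).trans_lt hMt.lt_top).ne
  have hVK : ∀ k, V k ∈ HTilde Ω s := by
    intro k
    have hk : (0 : ℝ) < 1 / ((k : ℝ) + 1) := by positivity
    refine mem_HTilde_of_compact hs hs2'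
      (isCompact_inter_le hD.continuous hΩD hk ((k : ℝ) + 1))
      (fun x hx => hx.1.1) (V k) ?_
    rw [hVG]
    filter_upwards [hGg k] with x hx hxK
    rw [hx]
    suffices χ k x = 0 by simp [hg, this]
    by_cases h1 : x ∈ (Ω : Set (Euc n))
    · by_cases h2 : 1 / ((k : ℝ) + 1) ≤ D x
      · have h3 : (k : ℝ) + 1 ≤ ‖x‖ := by
          by_contra h3
          refine hxK ⟨⟨h1, h2⟩, ?_⟩
          simp only [Metric.mem_closedBall, dist_zero_right]
          linarith
        simp only [hχ, hθR k x h3, mul_zero]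
      · simp only [hχ, hθD k x (by linarith), mul_zero]
    · simp only [hχ, indicator_of_notMem h1, zero_mul]
  obtain ⟨C, hC⟩ : ∃ C : ℝ, ∀ k, ‖V k‖ ≤ C := by
    refine ⟨Real.sqrt (C₂ * M).toReal, fun k => Real.le_sqrt_of_sq_le ?_⟩
    have : ‖V k‖ ^ 2 = (‖V k‖ₑ ^ 2).toReal := by rw [ENNReal.toReal_pow, toReal_enorm]
    rw [this]
    exact ENNReal.toReal_mono (ENNReal.mul_ne_top hC₂ hMt) ((hVn k).trans (by gcongr; exact hGM k))
  obtain ⟨W, hWK, hW⟩ := Sob.exists_weak_limit (HTilde Ω s)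
    (Submodule.isClosed_topologicalClosure _) V hVK C hC
  refine ⟨W, hWK, restr_eq_of_forall fun φ => hW _ _ ?_⟩
  -- Tested against a fixed `φ` in `𝓓(Ω)` the pairings are eventually constant: `χ k = 1` on the
  -- support of `φ` once `k ≥ 3/m` and `k ≥ R + 1`.
  refine tendsto_const_nhds.congr' ?_
  have hcpt : IsCompact (tsupport φ) := φ.hasCompactSupport
  obtain ⟨m, hm, hmD⟩ : ∃ m > 0, ∀ x ∈ tsupport φ, m ≤ D x := by
    rcases (tsupport φ).eq_empty_or_nonempty with he | hne
    · exact ⟨1, one_pos, fun x hx => by simp [he] at hx⟩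
    · obtain ⟨x₀, hx₀, hmin⟩ := hcpt.exists_isMinOn hne hD.continuous.continuousOn
      exact ⟨D x₀, hpos x₀ (φ.tsupport_subset hx₀), fun x hx => hmin hx⟩
  obtain ⟨R, hR⟩ := hcpt.isBounded.exists_norm_le
  obtain ⟨k₀, hk₀⟩ := exists_nat_ge (max (3 / m) (R + 1))
  filter_upwards [Filter.eventually_ge_atTop k₀] with k hk
  have hkr : (k₀ : ℝ) ≤ k := by exact_mod_cast hk
  rw [toDistribution_apply hs.le, toDistribution_apply hs.le, hVG]
  refine integral_congr_ae ?_
  filter_upwards [hGg k] with x hx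
  rw [hx, realToSchwartz_apply]
  by_cases hxs : x ∈ tsupport φ
  · have h1 : 3 * (1 / ((k : ℝ) + 1)) ≤ D x := by
      refine le_trans ?_ (hmD x hxs)
      have h3 : 3 / m ≤ k := (le_max_left _ _).trans (hk₀.trans hkr)
      rw [div_le_iff₀ hm] at h3
      rw [mul_one_div, div_le_iff₀ (by positivity)]
      nlinarith
    have h2 : ‖x‖ ≤ k - 1 := by
      have := (le_max_right _ _).trans (hk₀.trans hkr)
      have := hR x hxs
      linarith
    simp only [hg, hχ, hθ1 k x h1 h2,
      indicator_of_mem (show x ∈ (Ω : Set (Euc n)) from φ.tsupport_subset hxs), Pi.one_apply,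
      one_mul, Complex.ofReal_one, ← hf]
  · simp [image_eq_zero_of_notMem_tsupport hxs]

/-- Test functions are dense in `H^s(ℝⁿ)`. -/
lemma HTilde_top (hs : 0 < s) (hs2 : s < 3 / 2) : HTilde (⊤ : Opens (Euc n)) s = ⊤ := by
  refine eq_top_iff.2 fun U _ => ?_
  -- On the whole space `D = 1` is admissible, and the Hardy integral is the squared `L²` norm.
  obtain ⟨V, hV, hVU⟩ := Sob.exists_mem_HTilde (Ω := ⊤) hs hs2 U (D := fun _ => 1)
    (LipschitzWith.const 1 |>.weaken zero_le) (fun _ => zero_le_one) (fun _ => le_rfl)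
    (fun x h _ => by simp) (fun _ _ => one_pos) (by
      simp only [hardyInt, ENNReal.ofReal_one, ENNReal.one_rpow, mul_one]
      rw [lintegral_enorm_sq]; simp)
  suffices V = U by rwa [← this]
  have hker : Sob.toL2 hs.le V - Sob.toL2 hs.le U = 0 := by
    have hloc : LocallyIntegrable
        (Sob.toL2 hs.le V - Sob.toL2 hs.le U : Lp ℂ 2 (volume : Measure (Euc n))) :=
      (Lp.memLp _).locallyIntegrable (by norm_num)
    refine Lp.eq_zero_iff_ae_eq_zero.2 ?_
    refine ae_eq_zero_of_integral_contDiff_smul_eq_zero hloc fun ψ hψ hψc => ?_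
    let φ : 𝓓((⊤ : Opens (Euc n)), ℝ) := ⟨ψ, hψ, hψc, by simp⟩
    have h := DFunLike.congr_fun (congrArg Subtype.val hVU) φ
    change Sob.toDistribution n s V (realToSchwartz ⊤ φ) =
      Sob.toDistribution n s U (realToSchwartz ⊤ φ) at h
    rw [← sub_eq_zero, ← _root_.sub_apply, ← map_sub,
      Sob.toDistribution_apply hs.le, map_sub] at h
    simp only [realToSchwartz_apply] at h
    simp only [Complex.real_smul]
    exact h
  exact Sob.toL2_injective hs.le (sub_eq_zero.1 hker)

end TraceSpaces
end

/-! ### Hardy's inequality on the line. -/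

noncomputable section
namespace TraceSpaces

open scoped FourierTransform RealInnerProductSpace

lemma enorm_exp_sub_one_le (x : ℝ) :
    ‖Complex.exp ((2 * Real.pi * x : ℝ) * Complex.I) - 1‖ₑ ≤
      ENNReal.ofReal (2 * Real.pi) * ENNReal.ofReal (min 1 |x|) := by
  rw [← ENNReal.ofReal_mul (by positivity), ← ofReal_norm]
  refine ENNReal.ofReal_le_ofReal ?_
  rw [mul_comm _ Complex.I, mul_min_of_nonneg _ _ (by positivity)]
  refine le_min ?_ ?_
  · refine (norm_sub_le _ _).trans ?_
    rw [Complex.norm_exp_I_mul_ofReal, norm_one]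
    linarith [Real.pi_gt_three]
  · refine Real.norm_exp_I_mul_ofReal_sub_one_le.trans_eq ?_
    rw [Real.norm_eq_abs, abs_mul, abs_of_pos (by positivity)]

lemma enorm_sub_apply_zero_le (v : 𝓢(ℝ, ℂ)) (t : ℝ) :
    ‖v t - v 0‖ₑ ≤ ENNReal.ofReal (2 * Real.pi) *
      ∫⁻ ξ, ‖𝓕 v ξ‖ₑ * ENNReal.ofReal (min 1 |t * ξ|) := by
  have hv : ∀ t, v t = ∫ ξ, Complex.exp ((2 * Real.pi * (t * ξ) : ℝ) * Complex.I) • 𝓕 v ξ := by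
    intro t
    have h1 : v = 𝓕⁻ (𝓕 v) := (FourierTransform.fourierInv_fourier_eq v).symm
    conv_lhs => rw [h1, SchwartzMap.fourierInv_coe, Real.fourierInv_eq']
    refine integral_congr_ae (ae_of_all _ fun ξ => ?_)
    simp [mul_comm]
  have hi : ∀ t, Integrable fun ξ =>
      Complex.exp ((2 * Real.pi * (t * ξ) : ℝ) * Complex.I) • 𝓕 v ξ := by
    intro t
    refine (𝓕 v).integrable.bdd_smul
      (φ := fun ξ => Complex.exp ((2 * Real.pi * (t * ξ) : ℝ) * Complex.I)) 1
      (Continuous.aestronglyMeasurable (by fun_prop)) (ae_of_all _ fun ξ => ?_)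
    rw [Complex.norm_exp_ofReal_mul_I]
  rw [hv t, hv 0, ← integral_sub (hi t) (hi 0), ← lintegral_const_mul' _ _ ENNReal.ofReal_ne_top]
  refine (enorm_integral_le_lintegral_enorm _).trans (lintegral_mono fun ξ => ?_)
  dsimp only
  rw [← sub_smul, enorm_smul, zero_mul, mul_zero, Complex.ofReal_zero, zero_mul, Complex.exp_zero]
  calc _ ≤ ENNReal.ofReal (2 * Real.pi) * ENNReal.ofReal (min 1 |t * ξ|) * ‖𝓕 v ξ‖ₑ := by
        gcongr; exact enorm_exp_sub_one_le _
    _ = _ := by ring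

lemma lintegral_min_scale {p : ℝ} {a : ℝ} (ha : a ≠ 0) :
    ∫⁻ ξ, ENNReal.ofReal (min 1 |a * ξ|) ∂powMeasure p = ENNReal.ofReal (|a| ^ (-p - 1)) *
      ∫⁻ ξ, ENNReal.ofReal (min 1 |ξ|) ∂powMeasure p :=
  lintegral_powMeasure_comp_mul ha p fun ξ => ENNReal.ofReal (min 1 |ξ|)

lemma lintegral_min_abs_lt_top {p : ℝ} (hp : p < -1) (hp' : -2 < p) :
    ∫⁻ ξ, ENNReal.ofReal (min 1 |ξ|) ∂powMeasure p < ⊤ := by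
  have := lintegral_min_powMeasure_lt_top (k := 1) hp (by linarith)
  simpa using this

/-- Hardy's inequality on the line, with the right-hand side on the Fourier side. -/
lemma exists_hardy_fourier_le {s : ℝ} (hs : 1 / 2 < s) (hs2 : s < 3 / 2) :
    ∃ C : ℝ≥0∞, C ≠ ⊤ ∧ ∀ v : 𝓢(ℝ, ℂ), ∫⁻ t, ‖v t - v 0‖ₑ ^ 2 ∂powMeasure (-2 * s) ≤
      C * ∫⁻ ξ, ENNReal.ofReal (|ξ| ^ (2 * s)) * ‖𝓕 v ξ‖ₑ ^ 2 := by
  -- `1/2 < a < 1` makes `A` finite and `s - 1/2 < a < s` makes `B` finite; such an `a` exists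
  -- exactly when `1/2 < s < 3/2`.
  obtain ⟨a, ha1, ha2⟩ : ∃ a, max (1 / 2) (s - 1 / 2) < a ∧ a < min 1 s :=
    exists_between (max_lt (lt_min (by norm_num) hs) (lt_min (by linarith) (by linarith)))
  rw [max_lt_iff] at ha1
  rw [lt_min_iff] at ha2
  set m : ℝ → ℝ≥0∞ := fun x => ENNReal.ofReal (min 1 |x|) with hm
  have hmm : Measurable m := by fun_prop
  set A := ∫⁻ ξ, m ξ ∂powMeasure (-2 * a) with hA
  have hAt : A < ⊤ := lintegral_min_abs_lt_top (by linarith) (by linarith)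
  set B := ∫⁻ ξ, m ξ ∂powMeasure (-2 * s + 2 * a - 1) with hB
  have hBt : B < ⊤ := lintegral_min_abs_lt_top (by linarith) (by linarith)
  set c := ENNReal.ofReal (2 * Real.pi) with hc
  refine ⟨c ^ 2 * A * B, (ENNReal.mul_lt_top (ENNReal.mul_lt_top (ENNReal.pow_lt_top ENNReal.ofReal_lt_top) hAt) hBt).ne,
    fun v => ?_⟩
  have hwm : Measurable fun ξ => ‖𝓕 v ξ‖ₑ := (𝓕 v).continuous.measurable.enorm
  set w : ℝ → ℝ≥0∞ := fun ξ => ‖𝓕 v ξ‖ₑ with hw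
  have hne : ∀ᵐ ξ : ℝ, ξ ≠ 0 := by
    rw [ae_iff]; simp
  -- Schur's test: Cauchy–Schwarz for the product of `|ξ|^a w √m` and `|ξ|^{-a} √m`, with `m` taken
  -- at `tξ`. The second factor scales to `|t|^{2a-1} A`; integrating the first over `t` later
  -- produces `B |ξ|^{2s}`.
  have hCS : ∀ t : ℝ, t ≠ 0 → ‖v t - v 0‖ₑ ^ 2 ≤ c ^ 2 * A * (ENNReal.ofReal (|t| ^ (2 * a - 1)) *
      ∫⁻ ξ, ENNReal.ofReal (|ξ| ^ (2 * a)) * w ξ ^ 2 * m (t * ξ)) := by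
    intro t ht
    set r : ℝ → ℝ≥0∞ := fun ξ => ENNReal.ofReal (Real.sqrt (min 1 |t * ξ|)) with hr
    have hrr : ∀ ξ, r ξ * r ξ = m (t * ξ) := fun ξ => by
      rw [hr, hm]
      dsimp only
      rw [← ENNReal.ofReal_mul (by positivity), Real.mul_self_sqrt (by positivity)]
    have h1 := lintegral_mul_sq_le (volume : Measure ℝ)
      (f := fun ξ => ENNReal.ofReal (|ξ| ^ a) * w ξ * r ξ)
      (g := fun ξ => ENNReal.ofReal (|ξ| ^ (-a)) * r ξ) (by fun_prop) (by fun_prop)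
    have h2 : ∫⁻ ξ, w ξ * m (t * ξ) = ∫⁻ ξ, ENNReal.ofReal (|ξ| ^ a) * w ξ * r ξ *
        (ENNReal.ofReal (|ξ| ^ (-a)) * r ξ) := by
      refine lintegral_congr_ae (hne.mono fun ξ hξ => ?_)
      dsimp only
      have h3 : ENNReal.ofReal (|ξ| ^ a) * ENNReal.ofReal (|ξ| ^ (-a)) = 1 := by
        rw [← ENNReal.ofReal_mul (by positivity), ← Real.rpow_add (abs_pos.2 hξ), add_neg_cancel,
          Real.rpow_zero, ENNReal.ofReal_one]
      calc _ = 1 * (w ξ * (r ξ * r ξ)) := by rw [hrr, one_mul]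
        _ = _ := by rw [← h3]; ring
    have h4 : ∫⁻ ξ, (ENNReal.ofReal (|ξ| ^ (-a)) * r ξ) ^ 2 =
        ENNReal.ofReal (|t| ^ (2 * a - 1)) * A := by
      have := lintegral_min_scale (p := -2 * a) ht
      rw [show -(-2 * a) - 1 = 2 * a - 1 by ring] at this
      rw [hA, hm, ← this, lintegral_powMeasure]
      refine lintegral_congr fun ξ => ?_
      rw [mul_pow, pow_two (r ξ), hrr, ← ENNReal.ofReal_pow (by positivity),
        ← Real.rpow_mul_natCast (abs_nonneg _)]
      congr 3
      push_cast; ring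
    have h5 : ∫⁻ ξ, (ENNReal.ofReal (|ξ| ^ a) * w ξ * r ξ) ^ 2 =
        ∫⁻ ξ, ENNReal.ofReal (|ξ| ^ (2 * a)) * w ξ ^ 2 * m (t * ξ) := by
      refine lintegral_congr fun ξ => ?_
      rw [mul_pow, mul_pow, pow_two (r ξ), hrr, ← ENNReal.ofReal_pow (by positivity),
        ← Real.rpow_mul_natCast (abs_nonneg _)]
      congr 4
      push_cast; ring
    calc ‖v t - v 0‖ₑ ^ 2 ≤ (c * ∫⁻ ξ, w ξ * m (t * ξ)) ^ 2 := by
          gcongr; exact enorm_sub_apply_zero_le v t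
      _ ≤ c ^ 2 * ((∫⁻ ξ, ENNReal.ofReal (|ξ| ^ (2 * a)) * w ξ ^ 2 * m (t * ξ)) *
          (ENNReal.ofReal (|t| ^ (2 * a - 1)) * A)) := by
          rw [mul_pow, h2]; gcongr; exact h1.trans_eq (by rw [h4, h5])
      _ = _ := by ring
  calc ∫⁻ t, ‖v t - v 0‖ₑ ^ 2 ∂powMeasure (-2 * s)
      ≤ ∫⁻ t, c ^ 2 * A * (∫⁻ ξ, ENNReal.ofReal (|ξ| ^ (2 * a)) * w ξ ^ 2 * m (t * ξ))
          ∂powMeasure (-2 * s + 2 * a - 1) := by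
        rw [lintegral_powMeasure, lintegral_powMeasure]
        refine lintegral_mono_ae (hne.mono fun t ht => ?_)
        calc _ ≤ ENNReal.ofReal (|t| ^ (-2 * s)) * (c ^ 2 * A *
              (ENNReal.ofReal (|t| ^ (2 * a - 1)) *
              ∫⁻ ξ, ENNReal.ofReal (|ξ| ^ (2 * a)) * w ξ ^ 2 * m (t * ξ))) := by
              gcongr; exact hCS t ht
          _ = ENNReal.ofReal (|t| ^ (-2 * s)) * ENNReal.ofReal (|t| ^ (2 * a - 1)) * (c ^ 2 * A *
              ∫⁻ ξ, ENNReal.ofReal (|ξ| ^ (2 * a)) * w ξ ^ 2 * m (t * ξ)) := by ring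
          _ = _ := by
              rw [← ENNReal.ofReal_mul (by positivity), ← Real.rpow_add (abs_pos.2 ht)]
              rw [show -2 * s + (2 * a - 1) = -2 * s + 2 * a - 1 by ring]
    _ = c ^ 2 * A * ∫⁻ ξ, ENNReal.ofReal (|ξ| ^ (2 * a)) * w ξ ^ 2 *
          ∫⁻ t, m (t * ξ) ∂powMeasure (-2 * s + 2 * a - 1) := by
        rw [lintegral_const_mul _ (by fun_prop), lintegral_lintegral_swap (by fun_prop)]
        congr 1
        refine lintegral_congr fun ξ => ?_
        rw [lintegral_const_mul _ (by fun_prop)]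
    _ = c ^ 2 * A * ∫⁻ ξ, B * (ENNReal.ofReal (|ξ| ^ (2 * s)) * w ξ ^ 2) := by
        congr 1
        refine lintegral_congr_ae (hne.mono fun ξ hξ => ?_)
        dsimp only
        have := lintegral_min_scale (p := -2 * s + 2 * a - 1) hξ
        simp_rw [mul_comm ξ] at this
        rw [hm, this, ← hm, ← hB]
        have h6 : ENNReal.ofReal (|ξ| ^ (2 * a)) *
            ENNReal.ofReal (|ξ| ^ (-(-2 * s + 2 * a - 1) - 1)) = ENNReal.ofReal (|ξ| ^ (2 * s)) := by
          rw [← ENNReal.ofReal_mul (by positivity), ← Real.rpow_add (abs_pos.2 hξ)]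
          congr 2; ring
        rw [← h6]; ring
    _ = _ := by rw [lintegral_const_mul _ (by fun_prop)]; ring

/-- Hardy's inequality on the line. -/
lemma exists_hardy_le {s : ℝ} (hs : 1 / 2 < s) (hs2 : s < 3 / 2) :
    ∃ C : ℝ≥0∞, C ≠ ⊤ ∧ ∀ v : 𝓢(ℝ, ℂ), ∫⁻ t, ‖v t - v 0‖ₑ ^ 2 ∂powMeasure (-2 * s) ≤
      C * gagliardo s (1 : ℝ) v := by
  obtain ⟨C, hC, h⟩ := exists_hardy_fourier_le hs hs2
  have hs0 : 0 < s := by linarith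
  have hc0 := sdiffConst_ne_zero s
  have hct := sdiffConst_ne_top hs0 (by linarith)
  refine ⟨C * (sdiffConst s)⁻¹, ENNReal.mul_ne_top hC (ENNReal.inv_ne_top.2 hc0), fun v => ?_⟩
  have h1 : gagliardo s (1 : ℝ) v =
      sdiffConst s * ∫⁻ ξ, ENNReal.ofReal (|ξ| ^ (2 * s)) * ‖𝓕 v ξ‖ₑ ^ 2 := by
    rw [gagliardo_congr v.continuous.measurable (Lp.stronglyMeasurable _).measurable
      (v.coeFn_toLp 2 volume).symm, gagliardo_eq hs0]
    congr 1
    refine lintegral_congr_ae ?_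
    rw [FL2, SchwartzMap.toLp_fourier_eq]
    filter_upwards [(𝓕 v).coeFn_toLp 2 volume] with ξ hξ
    rw [hξ]; simp
  rw [h1, mul_assoc, ← mul_assoc (sdiffConst s)⁻¹, ENNReal.inv_mul_cancel hc0 hct, one_mul]
  exact h v

end TraceSpaces
end

/-! ### Graph coordinates and Hardy's inequality along vertical lines. -/

noncomputable section
namespace TraceSpaces

open scoped FourierTransform RealInnerProductSpace

section
variable {n : ℕ} (κ : Euc n ≃ᵢ GraphSpace n) (ζ : Euc (n - 1) → ℝ)

/-- The point at height `t` above the graph of `ζ` over `y`, in the chart `κ`. -/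
def graphMap (p : Euc (n - 1) × ℝ) : Euc n := κ.symm (WithLp.toLp 2 (p.1, ζ p.1 + p.2))

/-- The vertical component of the distance to the graph of `ζ`, with sign. -/
def graphHeight (x : Euc n) : ℝ := (κ x).snd - ζ (κ x).fst

/-- The vertical direction in the chart `κ`. -/
def graphAxis : Euc n := κ.symm.toRealAffineIsometryEquiv.linearIsometryEquiv (WithLp.toLp 2 (0, 1))

lemma norm_graphAxis : ‖graphAxis κ‖ = 1 := by
  rw [graphAxis, LinearIsometryEquiv.norm_map, WithLp.norm_toLp_snd, norm_one]

/-- A surjective isometry is affine (Mazur–Ulam), so vertical shifts in the chart become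
translations along a fixed unit vector. -/
lemma chart_symm_add (z w : GraphSpace n) : κ.symm (z + w) =
    κ.symm z + κ.symm.toRealAffineIsometryEquiv.linearIsometryEquiv w := by
  have := κ.symm.toRealAffineIsometryEquiv.map_vadd z w
  rw [vadd_eq_add, vadd_eq_add, add_comm w z, IsometryEquiv.coeFn_toRealAffineIsometryEquiv] at this
  rw [this, add_comm]

lemma graphMap_add (y : Euc (n - 1)) (t τ : ℝ) :
    graphMap κ ζ (y, t + τ) = graphMap κ ζ (y, t) + τ • graphAxis κ := by
  have : (WithLp.toLp 2 (y, ζ y + (t + τ)) : GraphSpace n) =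
      WithLp.toLp 2 (y, ζ y + t) + τ • WithLp.toLp 2 (0, 1) := by
    rw [← WithLp.toLp_smul, ← WithLp.toLp_add]
    simp [add_assoc]
  rw [graphMap, graphMap, this, chart_symm_add, map_smul, graphAxis]

lemma graphMap_eq (y : Euc (n - 1)) (t : ℝ) :
    graphMap κ ζ (y, t) = graphMap κ ζ (y, 0) + t • graphAxis κ := by
  rw [← graphMap_add, zero_add]

lemma fst_graphMap (p : Euc (n - 1) × ℝ) : (κ (graphMap κ ζ p)).fst = p.1 := by
  simp [graphMap]

lemma graphHeight_graphMap (p : Euc (n - 1) × ℝ) : graphHeight κ ζ (graphMap κ ζ p) = p.2 := by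
  simp [graphHeight, graphMap]

lemma graphMap_graphHeight (x : Euc n) : graphMap κ ζ ((κ x).fst, graphHeight κ ζ x) = x := by
  simp only [graphMap, graphHeight, add_sub_cancel]
  exact κ.symm_apply_apply x

lemma lipschitzWith_chart_fst : LipschitzWith 1 (fun x : Euc n => (κ x).fst) := by
  refine LipschitzWith.of_dist_le_mul fun x y => ?_
  rw [NNReal.coe_one, one_mul, ← κ.isometry.dist_eq x y, dist_eq_norm, dist_eq_norm,
    ← WithLp.sub_fst]
  exact WithLp.norm_fst_le _ _

lemma lipschitzWith_chart_snd : LipschitzWith 1 (fun x : Euc n => (κ x).snd) := by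
  refine LipschitzWith.of_dist_le_mul fun x y => ?_
  rw [NNReal.coe_one, one_mul, ← κ.isometry.dist_eq x y, dist_eq_norm, dist_eq_norm,
    ← WithLp.sub_snd]
  exact WithLp.norm_snd_le _ _

variable {ζ} {K : ℝ≥0}

lemma lipschitzWith_graphHeight (hζ : LipschitzWith K ζ) :
    LipschitzWith (1 + K) (graphHeight κ ζ) := by
  have h := hζ.comp (lipschitzWith_chart_fst κ)
  rw [mul_one] at h
  exact (lipschitzWith_chart_snd κ).sub h

lemma exists_lipschitzWith_graph (hζ : LipschitzWith K ζ) :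
    ∃ L : ℝ≥0, LipschitzWith L fun y => graphMap κ ζ (y, 0) := by
  refine ⟨_, κ.symm.isometry.lipschitz.comp
    ((WithLp.prod_lipschitzWith_toLp 2 _ _).comp (LipschitzWith.id.prodMk (hζ.add
      (LipschitzWith.const 0))))⟩

lemma continuous_graphMap (hζ : Continuous ζ) : Continuous (graphMap κ ζ) := by
  have := κ.symm.continuous
  unfold graphMap
  exact this.comp ((WithLp.prod_continuous_toLp 2 _ _).comp (by fun_prop))

/-- A shear preserves Lebesgue measure by translation invariance in the last variable, and an
isometry does too. No Jacobian appears. -/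
lemma measurePreserving_graphMap (hζ : Continuous ζ) :
    MeasurePreserving (graphMap κ ζ) (volume.prod volume) volume := by
  have h1 : MeasurePreserving (fun p : Euc (n - 1) × ℝ => (p.1, ζ p.1 + p.2))
      (volume.prod volume) (volume.prod volume) :=
    MeasurePreserving.skew_product (g := fun y t => ζ y + t) (MeasurePreserving.id _)
      (by unfold Function.uncurry; fun_prop) (ae_of_all _ fun y => map_add_left_eq_self _ _)
  have h2 : MeasurePreserving (WithLp.toLp 2 : Euc (n - 1) × ℝ → GraphSpace n)
      (volume.prod volume) volume := WithLp.volume_preserving_toLp _ _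
  have h3 : MeasurePreserving κ.symm := by
    have h4 := (measurePreserving_add_right (volume : Measure (Euc n)) (κ.symm 0)).comp
      (κ.symm.toRealAffineIsometryEquiv.linearIsometryEquiv.measurePreserving)
    have h5 : ⇑κ.symm = (fun x => x + κ.symm 0) ∘
        κ.symm.toRealAffineIsometryEquiv.linearIsometryEquiv := by
      funext z
      have := chart_symm_add κ 0 z
      rwa [zero_add, add_comm] at this
    rw [h5]
    exact h4
  exact h3.comp (h2.comp h1)

end

section
variable {n : ℕ} {s : ℝ} {κ : Euc n ≃ᵢ GraphSpace n} {ζ : Euc (n - 1) → ℝ}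

lemma lintegral_comp_graphMap (hζ : Continuous ζ) {G : Euc n → ℝ≥0∞} (hG : Measurable G) :
    ∫⁻ y, ∫⁻ t, G (graphMap κ ζ (y, t)) = ∫⁻ x, G x := by
  have h := measurePreserving_graphMap κ hζ
  rw [← h.lintegral_comp hG, lintegral_prod]
  exact (hG.comp h.measurable).aemeasurable

lemma enorm_sq_le_two_mul (a b : ℂ) : ‖b‖ₑ ^ 2 ≤ 2 * ‖a‖ₑ ^ 2 + 2 * ‖a - b‖ₑ ^ 2 := by
  simp only [enorm_sq_eq_ofReal]
  rw [← mul_add, ← ENNReal.ofReal_add (by positivity) (by positivity),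
    show (2 : ℝ≥0∞) = ENNReal.ofReal 2 by simp, ← ENNReal.ofReal_mul (by positivity)]
  refine ENNReal.ofReal_le_ofReal ?_
  have := norm_sub_le a (a - b)
  rw [sub_sub_cancel] at this
  refine (pow_le_pow_left₀ (norm_nonneg _) this 2).trans ?_
  nlinarith [sq_nonneg (‖a‖ - ‖a - b‖)]

lemma continuous_test {Ω : Opens (Euc n)} (φ : 𝓓(Ω, ℂ)) : Continuous φ := φ.contDiff.continuous

/-- The restriction of a test function to a line. -/
lemma exists_slice (φ : 𝓓((⊤ : Opens (Euc n)), ℂ)) (x : Euc n) {e : Euc n} (he : ‖e‖ = 1) :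
    ∃ v : 𝓢(ℝ, ℂ), ∀ t, v t = φ (x + t • e) := by
  have hiso : Isometry fun t : ℝ => x + t • e := by
    refine Isometry.of_dist_eq fun a b => ?_
    rw [dist_add_left, dist_eq_norm, ← sub_smul, norm_smul, he, mul_one, Real.dist_eq,
      Real.norm_eq_abs]
  have hc : HasCompactSupport (φ ∘ fun t : ℝ => x + t • e) :=
    φ.hasCompactSupport.comp_isClosedEmbedding hiso.isClosedEmbedding
  exact ⟨hc.toSchwartzMap (φ.contDiff.comp (by fun_prop)), fun t => rfl⟩

/-- This passes from one-dimensional inequalities to `ℝⁿ`: every slice runs along the same axis, so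
Tonelli reassembles the directional seminorm. -/
lemma lintegral_gagliardo_slice (hζ : Continuous ζ) {f : Euc n → ℂ} (hf : Measurable f) :
    ∫⁻ y, gagliardo s (1 : ℝ) (fun t => f (graphMap κ ζ (y, t))) =
      gagliardo s (graphAxis κ) f := by
  have hΦ := (continuous_graphMap κ hζ).measurable
  have h1 : ∀ y, gagliardo s (1 : ℝ) (fun t => f (graphMap κ ζ (y, t))) =
      ∫⁻ τ, (∫⁻ t, ‖sdiff f (τ • graphAxis κ) (graphMap κ ζ (y, t))‖ₑ ^ 2)
        ∂powMeasure (-1 - 2 * s) := by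
    intro y
    have hm : Measurable fun t => f (graphMap κ ζ (y, t)) := by fun_prop
    rw [gagliardo, lintegral_diffMeasure s ((measurable_sdiff hm 1).enorm.pow_const 2)]
    refine lintegral_congr fun τ => lintegral_congr fun t => ?_
    simp only [sdiff, smul_eq_mul, mul_one, sub_eq_add_neg]
    rw [graphMap_add, graphMap_add, neg_smul]
  simp_rw [h1]
  have hms : Measurable fun p : ℝ × Euc n => ‖sdiff f (p.1 • graphAxis κ) p.2‖ₑ ^ 2 :=
    (measurable_sdiff hf (graphAxis κ)).enorm.pow_const 2
  have hms' : Measurable fun q : (Euc (n - 1) × ℝ) × ℝ =>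
      ‖sdiff f (q.1.2 • graphAxis κ) (graphMap κ ζ (q.1.1, q.2))‖ₑ ^ 2 :=
    hms.comp (g := fun p : ℝ × Euc n => ‖sdiff f (p.1 • graphAxis κ) p.2‖ₑ ^ 2)
      (f := fun q : (Euc (n - 1) × ℝ) × ℝ => (q.1.2, graphMap κ ζ (q.1.1, q.2))) (by fun_prop)
  have hswap := lintegral_lintegral_swap (μ := (volume : Measure (Euc (n - 1))))
    (ν := powMeasure (-1 - 2 * s))
    (f := fun y τ => ∫⁻ t, ‖sdiff f (τ • graphAxis κ) (graphMap κ ζ (y, t))‖ₑ ^ 2)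
    hms'.lintegral_prod_right'.aemeasurable
  refine hswap.trans ?_
  rw [gagliardo, lintegral_diffMeasure s hms]
  refine lintegral_congr fun τ => ?_
  exact lintegral_comp_graphMap hζ (G := fun x => ‖sdiff f (τ • graphAxis κ) x‖ₑ ^ 2)
    (by unfold sdiff; fun_prop)

lemma gagliardo_ofTest_le (hs : 0 < s) (φ : 𝓓((⊤ : Opens (Euc n)), ℂ)) {e : Euc n}
    (he : ‖e‖ ≤ 1) : gagliardo s e φ ≤ sdiffConst s * ‖Sob.ofTest ⊤ s φ‖ₑ ^ 2 := by
  rw [gagliardo_congr (continuous_test φ).measurable (Lp.stronglyMeasurable _).measurable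
    (Sob.toL2_ofTest hs.le ⊤ φ).symm]
  exact Sob.gagliardo_toL2_le hs _ he

lemma lintegral_ofTest_le (hs : 0 ≤ s) (φ : 𝓓((⊤ : Opens (Euc n)), ℂ)) :
    ∫⁻ x, ‖φ x‖ₑ ^ 2 ≤ ‖Sob.ofTest ⊤ s φ‖ₑ ^ 2 := by
  have : ∫⁻ x, ‖φ x‖ₑ ^ 2 = ∫⁻ x, ‖Sob.toL2 hs (Sob.ofTest ⊤ s φ) x‖ₑ ^ 2 :=
    lintegral_congr_ae ((Sob.toL2_ofTest hs ⊤ φ).mono fun x hx => by simp only [hx])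
  rw [this, lintegral_enorm_sq]
  gcongr
  exact Sob.enorm_toL2_le hs _

/-- Hardy's inequality for test functions, relative to the graph of `ζ`. -/
lemma exists_hardy_graph_le (n : ℕ) (hs : 1 / 2 < s) (hs2 : s < 3 / 2) :
    ∃ C : ℝ≥0∞, C ≠ ⊤ ∧ ∀ (κ : Euc n ≃ᵢ GraphSpace n) (ζ : Euc (n - 1) → ℝ), Continuous ζ →
      ∀ φ : 𝓓((⊤ : Opens (Euc n)), ℂ),
      ∫⁻ y, (∫⁻ t, ‖φ (graphMap κ ζ (y, t)) - φ (graphMap κ ζ (y, 0))‖ₑ ^ 2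
        ∂powMeasure (-2 * s)) ≤ C * ‖Sob.ofTest ⊤ s φ‖ₑ ^ 2 := by
  obtain ⟨C, hC, h⟩ := exists_hardy_le hs hs2
  have hs0 : 0 < s := by linarith
  refine ⟨C * sdiffConst s, ENNReal.mul_ne_top hC (sdiffConst_ne_top hs0 (by linarith)),
    fun κ ζ hζ φ => ?_⟩
  have h1 : ∀ y, ∫⁻ t, ‖φ (graphMap κ ζ (y, t)) - φ (graphMap κ ζ (y, 0))‖ₑ ^ 2
      ∂powMeasure (-2 * s) ≤ C * gagliardo s (1 : ℝ) (fun t => φ (graphMap κ ζ (y, t))) := by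
    intro y
    obtain ⟨v, hv⟩ := exists_slice φ (graphMap κ ζ (y, 0)) (norm_graphAxis κ)
    have hv' : ∀ t, φ (graphMap κ ζ (y, t)) = v t := fun t => by rw [hv, ← graphMap_eq]
    simp only [hv']
    exact h v
  refine (lintegral_mono h1).trans ?_
  rw [lintegral_const_mul' _ _ hC, lintegral_gagliardo_slice hζ (continuous_test φ).measurable,
    mul_assoc]
  gcongr
  exact gagliardo_ofTest_le hs0 φ (norm_graphAxis κ).le

/-- The `L²` norm over the graph of `ζ` is bounded by the `H^s` norm. -/
lemma exists_graph_le (n : ℕ) (hs : 1 / 2 < s) (hs2 : s < 3 / 2) :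
    ∃ C : ℝ≥0∞, C ≠ ⊤ ∧ ∀ (κ : Euc n ≃ᵢ GraphSpace n) (ζ : Euc (n - 1) → ℝ), Continuous ζ →
      ∀ φ : 𝓓((⊤ : Opens (Euc n)), ℂ),
      ∫⁻ y, ‖φ (graphMap κ ζ (y, 0))‖ₑ ^ 2 ≤ C * ‖Sob.ofTest ⊤ s φ‖ₑ ^ 2 := by
  obtain ⟨C, hC, h⟩ := exists_hardy_graph_le n hs hs2
  set b : ℝ≥0∞ := ENNReal.ofReal (2 ^ (2 * s))
  refine ⟨2 + 2 * b * C, by simp [ENNReal.mul_eq_top, hC, b], fun κ ζ hζ φ => ?_⟩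
  have hφ := (continuous_test φ).measurable
  have hΦ := (continuous_graphMap κ hζ).measurable
  have hpt : ∀ y, ‖φ (graphMap κ ζ (y, 0))‖ₑ ^ 2 ≤
      2 * (∫⁻ t, ‖φ (graphMap κ ζ (y, t))‖ₑ ^ 2) + 2 * b *
      (∫⁻ t, ‖φ (graphMap κ ζ (y, t)) - φ (graphMap κ ζ (y, 0))‖ₑ ^ 2 ∂powMeasure (-2 * s)) := by
    intro y
    rw [lintegral_powMeasure]
    have e1 : ‖φ (graphMap κ ζ (y, 0))‖ₑ ^ 2 =
        ∫⁻ _ in Icc (1 : ℝ) 2, ‖φ (graphMap κ ζ (y, 0))‖ₑ ^ 2 := by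
      rw [setLIntegral_const, Real.volume_Icc]; norm_num
    -- The value on the graph is averaged over the heights `1 ≤ t ≤ 2`, an interval of length one on
    -- which `b = 2^{2s}` compensates the Hardy weight `t^{-2s}`.
    have e2 : ∀ t ∈ Icc (1 : ℝ) 2, ‖φ (graphMap κ ζ (y, 0))‖ₑ ^ 2 ≤
        2 * ‖φ (graphMap κ ζ (y, t))‖ₑ ^ 2 + 2 * b * (ENNReal.ofReal (|t| ^ (-2 * s)) *
          ‖φ (graphMap κ ζ (y, t)) - φ (graphMap κ ζ (y, 0))‖ₑ ^ 2) := by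
      intro t ht
      have ht0 : 0 < |t| := abs_pos.2 (by linarith [ht.1])
      have e3 : 1 ≤ b * ENNReal.ofReal (|t| ^ (-2 * s)) := by
        rw [← ENNReal.ofReal_mul (by positivity), ENNReal.one_le_ofReal, neg_mul,
          Real.rpow_neg ht0.le, ← div_eq_mul_inv, one_le_div (by positivity)]
        refine Real.rpow_le_rpow ht0.le ?_ (by linarith)
        rw [abs_of_nonneg (by linarith [ht.1])]; exact ht.2
      rw [← mul_assoc, mul_assoc 2 b]
      calc _ ≤ 2 * ‖φ (graphMap κ ζ (y, t))‖ₑ ^ 2 + 2 * 1 *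
            ‖φ (graphMap κ ζ (y, t)) - φ (graphMap κ ζ (y, 0))‖ₑ ^ 2 := by
            rw [mul_one]; exact enorm_sq_le_two_mul _ _
        _ ≤ _ := by gcongr
    rw [e1]
    refine (setLIntegral_mono' measurableSet_Icc e2).trans ((setLIntegral_le_lintegral _ _).trans ?_)
    rw [lintegral_add_left (by fun_prop), lintegral_const_mul _ (by fun_prop),
      lintegral_const_mul _ (by fun_prop)]
  refine (lintegral_mono hpt).trans ?_
  have hmeas : Measurable fun y => ∫⁻ t, ‖φ (graphMap κ ζ (y, t))‖ₑ ^ 2 := by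
    have : Measurable fun p : Euc (n - 1) × ℝ => ‖φ (graphMap κ ζ p)‖ₑ ^ 2 := by fun_prop
    exact this.lintegral_prod_right'
  rw [lintegral_add_left (by fun_prop), lintegral_const_mul _ hmeas,
    lintegral_const_mul' _ _ (by simp [ENNReal.mul_eq_top, b]),
    lintegral_comp_graphMap hζ (G := fun x => ‖φ x‖ₑ ^ 2) (by fun_prop), add_mul, mul_assoc _ C]
  have hs0 : 0 ≤ s := by linarith
  exact add_le_add (mul_le_mul_right (lintegral_ofTest_le hs0 φ) _)
    (mul_le_mul_right (h κ ζ hζ φ) _)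

end
end TraceSpaces
end

/-! ### Boundary charts, surface measure and the trace on `H^s(ℝⁿ)`. -/

noncomputable section
namespace TraceSpaces

open scoped FourierTransform RealInnerProductSpace

/-- Inside the open set `W`, the open set `Ω` is the region above the graph of `ζ`. -/
structure IsGraphChart {n : ℕ} (Ω : Opens (Euc n)) (W : Set (Euc n)) (κ : Euc n ≃ᵢ GraphSpace n)
    (ζ : Euc (n - 1) → ℝ) (K : ℝ≥0) : Prop where
  isOpen : IsOpen W
  lipschitz : LipschitzWith K ζ
  mem_iff : ∀ x ∈ W, x ∈ Ω ↔ 0 < graphHeight κ ζ x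

lemma IsLipschitzDomain.exists_charts {n : ℕ} {Ω : Opens (Euc n)} (hΩ : IsLipschitzDomain Ω) :
    ∃ (J : ℕ) (W : Fin J → Set (Euc n)) (κ : Fin J → Euc n ≃ᵢ GraphSpace n)
      (ζ : Fin J → Euc (n - 1) → ℝ) (K : Fin J → ℝ≥0),
      (∀ j, IsGraphChart Ω (W j) (κ j) (ζ j) (K j)) ∧
      frontier (Ω : Set (Euc n)) ⊆ ⋃ j, W j := by
  obtain ⟨-, J, W, H, hW, hH, hcov, heq⟩ := hΩ
  choose κ ζ K hK hHj using hH
  refine ⟨J, W, κ, ζ, K, fun j => ⟨hW j, hK j, fun x hx => ?_⟩, hcov⟩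
  have h1 : x ∈ W j ∩ (Ω : Set (Euc n)) ↔ x ∈ W j ∩ H j := by rw [heq j]
  have h2 : x ∈ H j ↔ 0 < graphHeight (κ j) (ζ j) x := by
    rw [hHj j, graphHeight, sub_pos]; rfl
  rw [← h2]
  exact ⟨fun h => (h1.1 ⟨hx, h⟩).2, fun h => (h1.2 ⟨hx, h⟩).2⟩

lemma graphHeight_add {n : ℕ} (κ : Euc n ≃ᵢ GraphSpace n) (ζ : Euc (n - 1) → ℝ) (x : Euc n)
    (t : ℝ) : graphHeight κ ζ (x + t • graphAxis κ) = graphHeight κ ζ x + t := by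
  conv_lhs => rw [← graphMap_graphHeight κ ζ x, ← graphMap_add]
  rw [graphHeight_graphMap]

namespace IsGraphChart

variable {n : ℕ} {Ω : Opens (Euc n)} {W : Set (Euc n)} {κ : Euc n ≃ᵢ GraphSpace n}
  {ζ : Euc (n - 1) → ℝ} {K : ℝ≥0}

lemma continuous (h : IsGraphChart Ω W κ ζ K) : Continuous ζ := h.lipschitz.continuous

lemma continuous_graphHeight (h : IsGraphChart Ω W κ ζ K) : Continuous (graphHeight κ ζ) :=
  (lipschitzWith_graphHeight κ h.lipschitz).continuous

lemma eventually_mem (h : IsGraphChart Ω W κ ζ K) {x : Euc n} (hx : x ∈ W) :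
    ∃ δ > 0, ∀ t : ℝ, |t| < δ → x + t • graphAxis κ ∈ W := by
  obtain ⟨δ, hδ, hb⟩ := Metric.isOpen_iff.1 h.isOpen x hx
  refine ⟨δ, hδ, fun t ht => hb ?_⟩
  rw [Metric.mem_ball, dist_eq_norm, add_sub_cancel_left, norm_smul, norm_graphAxis, mul_one]
  exact ht

lemma mem_frontier_iff (h : IsGraphChart Ω W κ ζ K) {x : Euc n} (hx : x ∈ W) :
    x ∈ frontier (Ω : Set (Euc n)) ↔ graphHeight κ ζ x = 0 := by
  rw [Ω.isOpen.frontier_eq, mem_sdiff]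
  constructor
  · rintro ⟨hc, hn⟩
    refine le_antisymm (not_lt.1 fun h0 => hn ((h.mem_iff x hx).2 h0)) (not_lt.1 fun h0 => ?_)
    obtain ⟨y, ⟨hyW, hy0⟩, hyΩ⟩ := mem_closure_iff.1 hc (W ∩ {y | graphHeight κ ζ y < 0})
      (h.isOpen.inter (isOpen_lt h.continuous_graphHeight continuous_const)) ⟨hx, h0⟩
    exact lt_asymm hy0 ((h.mem_iff y hyW).1 hyΩ)
  · intro h0
    refine ⟨?_, fun hΩ => ((h.mem_iff x hx).1 hΩ).ne' h0⟩
    obtain ⟨δ, hδ, hW⟩ := h.eventually_mem hx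
    have ht : Filter.Tendsto (fun t : ℝ => x + t • graphAxis κ) (nhdsWithin 0 (Ioi 0))
        (nhds x) := by
      have : Continuous fun t : ℝ => x + t • graphAxis κ := by fun_prop
      have := (this.tendsto 0).mono_left (nhdsWithin_le_nhds (s := Ioi (0 : ℝ)))
      simpa using this
    refine mem_closure_of_tendsto ht ?_
    filter_upwards [Ioo_mem_nhdsGT hδ] with t ht
    refine (h.mem_iff _ (hW t (by rw [abs_of_pos ht.1]; exact ht.2))).2 ?_
    rw [graphHeight_add, h0, zero_add]
    exact ht.1

lemma graphMap_fst (h : IsGraphChart Ω W κ ζ K) {x : Euc n} (hx : x ∈ W)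
    (hf : x ∈ frontier (Ω : Set (Euc n))) : graphMap κ ζ ((κ x).fst, 0) = x := by
  rw [← (h.mem_frontier_iff hx).1 hf, graphMap_graphHeight]

end IsGraphChart

/-- The points of `ℝⁿ⁻¹` over which the graph of `ζ` lies on the boundary of `Ω`, inside `W`. -/
def chartBase {n : ℕ} (Ω : Opens (Euc n)) (W : Set (Euc n)) (κ : Euc n ≃ᵢ GraphSpace n)
    (ζ : Euc (n - 1) → ℝ) : Set (Euc (n - 1)) :=
  {y | graphMap κ ζ (y, 0) ∈ frontier (Ω : Set (Euc n)) ∩ W}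

lemma exists_hausdorff_eq_smul (d : ℕ) :
    ∃ c : ℝ≥0, Measure.hausdorffMeasure (d : ℝ) = c • (volume : Measure (Euc d)) := by
  have h : Measure.IsAddHaarMeasure (Measure.hausdorffMeasure (d : ℝ) : Measure (Euc d)) := by
    simpa using MeasureTheory.isAddHaarMeasure_hausdorffMeasure (E := Euc d)
  exact ⟨_, Measure.isAddLeftInvariant_eq_smul _ _⟩

lemma volume_absolutelyContinuous_hausdorff (d : ℕ) :
    (volume : Measure (Euc d)) ≪ Measure.hausdorffMeasure (d : ℝ) := by
  have h : Measure.IsAddHaarMeasure (Measure.hausdorffMeasure (d : ℝ) : Measure (Euc d)) := by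
    simpa using MeasureTheory.isAddHaarMeasure_hausdorffMeasure (E := Euc d)
  have := Measure.isAddLeftInvariant_eq_smul (volume : Measure (Euc d))
    (Measure.hausdorffMeasure (d : ℝ))
  rw [this]
  exact Measure.AbsolutelyContinuous.rfl.smul_left _

namespace IsGraphChart

variable {n : ℕ} {Ω : Opens (Euc n)} {W : Set (Euc n)} {κ : Euc n ≃ᵢ GraphSpace n}
  {ζ : Euc (n - 1) → ℝ} {K : ℝ≥0}

lemma measurableSet_chartBase (h : IsGraphChart Ω W κ ζ K) :
    MeasurableSet (chartBase Ω W κ ζ) := by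
  have : Measurable fun y => graphMap κ ζ (y, 0) :=
    ((continuous_graphMap κ h.continuous).comp (by fun_prop)).measurable
  exact this (isClosed_frontier.measurableSet.inter h.isOpen.measurableSet)

/-- A Lipschitz map increases Hausdorff measure by at most a constant factor, and on `ℝⁿ⁻¹`
Hausdorff measure is a multiple of Lebesgue measure. This one-sided bound replaces the area formula.
-/
lemma exists_surfaceMeasure_le (h : IsGraphChart Ω W κ ζ K) : ∃ C : ℝ≥0∞, C ≠ ⊤ ∧
    (surfaceMeasure Ω).restrict W ≤
      C • ((volume : Measure (Euc (n - 1))).restrict (chartBase Ω W κ ζ)).map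
        fun y => graphMap κ ζ (y, 0) := by
  obtain ⟨L, hL⟩ := exists_lipschitzWith_graph κ h.lipschitz
  obtain ⟨c, hc⟩ := exists_hausdorff_eq_smul (n - 1)
  refine ⟨(L : ℝ≥0∞) ^ ((n - 1 : ℕ) : ℝ) * c, ENNReal.mul_ne_top
    (ENNReal.rpow_ne_top_of_nonneg (by positivity) ENNReal.coe_ne_top) ENNReal.coe_ne_top,
    Measure.le_iff.2 fun S hS => ?_⟩
  rw [Measure.restrict_apply hS, surfaceMeasure,
    Measure.restrict_apply (hS.inter h.isOpen.measurableSet), Measure.smul_apply,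
    Measure.map_apply hL.continuous.measurable hS, smul_eq_mul,
    Measure.restrict_apply (hL.continuous.measurable hS)]
  set A := (fun y => graphMap κ ζ (y, 0)) ⁻¹' S ∩ chartBase Ω W κ ζ
  have hsub : S ∩ W ∩ frontier (Ω : Set (Euc n)) ⊆ (fun y => graphMap κ ζ (y, 0)) '' A := by
    rintro x ⟨⟨hxS, hxW⟩, hxf⟩
    have := h.graphMap_fst hxW hxf
    refine ⟨(κ x).fst, ⟨?_, ?_⟩, this⟩
    · rw [mem_preimage, this]; exact hxS
    · have hm : graphMap κ ζ ((κ x).fst, 0) ∈ frontier (Ω : Set (Euc n)) ∩ W := by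
        rw [this]; exact ⟨hxf, hxW⟩
      exact hm
  refine (measure_mono hsub).trans ((hL.hausdorffMeasure_image_le (by positivity) A).trans_eq ?_)
  rw [hc, mul_assoc]
  rfl

/-- The reverse comparison, for null sets only: the chart projection is `1`-Lipschitz. -/
lemma ae_chartBase (h : IsGraphChart Ω W κ ζ K) {p : Euc n → Prop}
    (hp : ∀ᵐ x ∂surfaceMeasure Ω, p x) :
    ∀ᵐ y ∂(volume : Measure (Euc (n - 1))).restrict (chartBase Ω W κ ζ),
      p (graphMap κ ζ (y, 0)) := by
  rw [ae_restrict_iff' h.measurableSet_chartBase]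
  rw [ae_iff] at hp ⊢
  rw [surfaceMeasure, Measure.restrict_apply' isClosed_frontier.measurableSet] at hp
  refine volume_absolutelyContinuous_hausdorff (n - 1) ?_
  refine measure_mono_null (t := (fun x : Euc n => (κ x).fst) ''
    ({x | ¬ p x} ∩ frontier (Ω : Set (Euc n)))) (fun y hy => ?_) ?_
  · change ¬ (y ∈ chartBase Ω W κ ζ → _) at hy
    push Not at hy
    exact ⟨_, ⟨hy.2, hy.1.1⟩, fst_graphMap κ ζ (y, 0)⟩
  · have := (lipschitzWith_chart_fst κ).hausdorffMeasure_image_le (d := ((n - 1 : ℕ) : ℝ))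
      (by positivity) ({x | ¬ p x} ∩ frontier (Ω : Set (Euc n)))
    rw [hp, mul_zero] at this
    exact nonpos_iff_eq_zero.1 this

end IsGraphChart

section
variable {n : ℕ} {Ω : Opens (Euc n)} {s : ℝ}

lemma lintegral_surfaceMeasure_le {J : ℕ} {W : Fin J → Set (Euc n)}
    (hcov : frontier (Ω : Set (Euc n)) ⊆ ⋃ j, W j) (G : Euc n → ℝ≥0∞) :
    ∫⁻ x, G x ∂surfaceMeasure Ω ≤ ∑ j, ∫⁻ x in W j, G x ∂surfaceMeasure Ω := by
  have h1 : (surfaceMeasure Ω).restrict (⋃ j, W j) = surfaceMeasure Ω := by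
    refine Measure.restrict_eq_self_of_ae_mem ?_
    filter_upwards [ae_restrict_mem (μ := Measure.hausdorffMeasure ((n - 1 : ℕ) : ℝ))
      (isClosed_frontier (s := (Ω : Set (Euc n)))).measurableSet] with x hx
    exact hcov hx
  conv_lhs => rw [← h1]
  refine (lintegral_iUnion_le _ _).trans_eq ?_
  rw [tsum_fintype]

/-- Together with the density of test functions, this identifies the extension by continuity on test
functions. -/
lemma exists_boundaryValue_le (hΩ : IsLipschitzDomain Ω) (hs : 1 / 2 < s) (hs2 : s < 3 / 2) :
    ∃ C : ℝ, ∀ φ, ‖boundaryValue hΩ φ‖ ≤ C * ‖Sob.ofTest ⊤ s φ‖ := by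
  obtain ⟨J, W, κ, ζ, K, hch, hcov⟩ := hΩ.exists_charts
  obtain ⟨C, hC, hCφ⟩ := exists_graph_le n hs hs2
  choose B hB hBle using fun j => (hch j).exists_surfaceMeasure_le
  set M : ℝ≥0∞ := (∑ j, B j * C) with hM
  have hMt : M ≠ ⊤ := (ENNReal.sum_lt_top.2 fun j _ => ENNReal.mul_lt_top (hB j).lt_top hC.lt_top).ne
  have key : ∀ φ, ‖boundaryValue hΩ φ‖ₑ ^ 2 ≤ M * ‖Sob.ofTest ⊤ s φ‖ₑ ^ 2 := by
    intro φ
    have hφ : Measurable φ := (continuous_test φ).measurable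
    have e1 : ‖boundaryValue hΩ φ‖ₑ ^ 2 = ∫⁻ x, ‖φ x‖ₑ ^ 2 ∂surfaceMeasure Ω := by
      rw [← lintegral_enorm_sq]
      refine lintegral_congr_ae ?_
      filter_upwards [(memLp_boundary hΩ φ).coeFn_toLp] with x hx
      rw [← hx]; rfl
    rw [e1, hM, Finset.sum_mul]
    refine (lintegral_surfaceMeasure_le hcov _).trans (Finset.sum_le_sum fun j _ => ?_)
    have hg : Measurable fun y => graphMap (κ j) (ζ j) (y, 0) :=
      ((continuous_graphMap (κ j) (hch j).continuous).comp (by fun_prop)).measurable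
    refine (lintegral_mono' (hBle j) le_rfl).trans ?_
    rw [lintegral_smul_measure, lintegral_map (by fun_prop) hg, smul_eq_mul, mul_assoc]
    gcongr
    exact (setLIntegral_le_lintegral _ _).trans (hCφ (κ j) (ζ j) (hch j).continuous φ)
  refine ⟨Real.sqrt M.toReal, fun φ => ?_⟩
  have h1 : ‖boundaryValue hΩ φ‖ ^ 2 ≤ M.toReal * ‖Sob.ofTest ⊤ s φ‖ ^ 2 := by
    have := ENNReal.toReal_mono (ENNReal.mul_ne_top hMt (by simp)) (key φ)
    simpa [ENNReal.toReal_mul, ENNReal.toReal_pow] using this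
  refine le_of_sq_le_sq (h1.trans_eq ?_) (by positivity)
  rw [mul_pow, Real.sq_sqrt ENNReal.toReal_nonneg]

lemma denseRange_ofTest (hs : 0 < s) (hs2 : s < 3 / 2) :
    DenseRange (Sob.ofTest (⊤ : Opens (Euc n)) s) := by
  intro U
  have h : U ∈ HTilde (⊤ : Opens (Euc n)) s := by rw [HTilde_top hs hs2]; trivial
  exact h

/-- The trace operator on `H^s(ℝⁿ)`. -/
def Sob.boundaryTrace (hΩ : IsLipschitzDomain Ω) (s : ℝ) : Sob n s →L[ℂ] BoundaryL2 Ω :=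
  (boundaryValue hΩ).extendOfNorm (Sob.ofTest ⊤ s)

lemma Sob.boundaryTrace_ofTest (hΩ : IsLipschitzDomain Ω) (hs : 1 / 2 < s) (hs2 : s < 3 / 2)
    (φ : 𝓓((⊤ : Opens (Euc n)), ℂ)) :
    Sob.boundaryTrace hΩ s (Sob.ofTest ⊤ s φ) = boundaryValue hΩ φ :=
  LinearMap.extendOfNorm_eq (denseRange_ofTest (by linarith) hs2)
    (exists_boundaryValue_le hΩ hs hs2) φ

/-- Elements of `H^s(ℝⁿ)` are limits of test functions, together with their traces. -/
lemma Sob.exists_approx (hΩ : IsLipschitzDomain Ω) (hs : 1 / 2 < s) (hs2 : s < 3 / 2) (h0 : 0 ≤ s)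
    (U : Sob n s) : ∃ φ : ℕ → 𝓓((⊤ : Opens (Euc n)), ℂ),
      Filter.Tendsto (fun k => Sob.ofTest ⊤ s (φ k)) Filter.atTop (nhds U) ∧
      (∀ᵐ x, Filter.Tendsto (fun k => φ k x) Filter.atTop (nhds (Sob.toL2 h0 U x))) ∧
      ∀ᵐ x ∂surfaceMeasure Ω, Filter.Tendsto (fun k => φ k x) Filter.atTop
        (nhds (Sob.boundaryTrace hΩ s U x)) := by
  obtain ⟨x, hx, hxU⟩ := mem_closure_iff_seq_limit.1
    ((denseRange_ofTest (by linarith) hs2).closure_range ▸ mem_univ U)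
  choose φ hφ using hx
  have h1 : Filter.Tendsto (fun k => Sob.ofTest ⊤ s (φ k)) Filter.atTop (nhds U) := by
    simpa only [hφ] using hxU
  obtain ⟨a, ha, ha'⟩ := (tendstoInMeasure_of_tendsto_Lp
    (((Sob.continuous_toL2 h0).tendsto U).comp h1)).exists_seq_tendsto_ae
  have h2 := h1.comp ha.tendsto_atTop
  -- A further subsequence, so that convergence holds almost everywhere for Lebesgue and surface
  -- measure simultaneously.
  obtain ⟨b, hb, hb'⟩ := (tendstoInMeasure_of_tendsto_Lp
    (((Sob.boundaryTrace hΩ s).continuous.tendsto U).comp h2)).exists_seq_tendsto_ae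
  refine ⟨fun k => φ (a (b k)), h2.comp hb.tendsto_atTop, ?_, ?_⟩
  · filter_upwards [ha', ae_all_iff.2 fun k => Sob.toL2_ofTest h0 ⊤ (φ (a (b k)))] with x hx hx'
    refine (hx.comp hb.tendsto_atTop).congr fun k => ?_
    exact hx' k
  · filter_upwards [hb', ae_all_iff.2 fun k =>
      (memLp_boundary hΩ (φ (a (b k)))).coeFn_toLp] with x hx hx'
    refine hx.congr fun k => ?_
    rw [← hx' k]
    simp only [Function.comp_apply]
    rw [Sob.boundaryTrace_ofTest hΩ hs hs2]
    rfl

/-- Hardy's inequality passes from test functions to `U` by Fatou's lemma along the approximating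
sequence. -/
lemma IsGraphChart.lintegral_sub_trace_ne_top (hΩ : IsLipschitzDomain Ω) {W : Set (Euc n)}
    {κ : Euc n ≃ᵢ GraphSpace n} {ζ : Euc (n - 1) → ℝ} {K : ℝ≥0} (h : IsGraphChart Ω W κ ζ K)
    (hs : 1 / 2 < s) (hs2 : s < 3 / 2) (h0 : 0 ≤ s) (U : Sob n s) :
    ∫⁻ y in chartBase Ω W κ ζ, (∫⁻ t, ‖Sob.toL2 h0 U (graphMap κ ζ (y, t)) -
      Sob.boundaryTrace hΩ s U (graphMap κ ζ (y, 0))‖ₑ ^ 2 ∂powMeasure (-2 * s)) ≠ ⊤ := by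
  obtain ⟨C, hC, hCφ⟩ := exists_hardy_graph_le n hs hs2
  obtain ⟨φ, hφU, hφ1, hφ2⟩ := Sob.exists_approx hΩ hs hs2 h0 U
  set A := chartBase Ω W κ ζ
  set μ := ((volume : Measure (Euc (n - 1))).restrict A).prod (powMeasure (-2 * s)) with hμ
  have hΦ := (continuous_graphMap κ h.continuous).measurable
  have hfm : Measurable (Sob.toL2 h0 U) := (Lp.stronglyMeasurable _).measurable
  have hγm : Measurable (Sob.boundaryTrace hΩ s U) := (Lp.stronglyMeasurable _).measurable
  set f : Euc n → ℂ := ⇑(Sob.toL2 h0 U)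
  set g : Euc n → ℂ := ⇑(Sob.boundaryTrace hΩ s U)
  have hμac : μ ≪ (volume : Measure (Euc (n - 1))).prod volume :=
    Measure.AbsolutelyContinuous.prod Measure.restrict_le_self.absolutelyContinuous
      (withDensity_absolutelyContinuous _ _)
  have h1 : ∀ᵐ p ∂μ, Filter.Tendsto (fun k => φ k (graphMap κ ζ p)) Filter.atTop
      (nhds (f (graphMap κ ζ p))) :=
    hμac.ae_le ((measurePreserving_graphMap κ
      h.continuous).quasiMeasurePreserving.tendsto_ae.eventually hφ1)
  have h2 : ∀ᵐ p ∂μ, Filter.Tendsto (fun k => φ k (graphMap κ ζ (p.1, 0))) Filter.atTop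
      (nhds (g (graphMap κ ζ (p.1, 0)))) :=
    Measure.quasiMeasurePreserving_fst.tendsto_ae.eventually (h.ae_chartBase hφ2)
  have hle : ∫⁻ p, ‖f (graphMap κ ζ p) - g (graphMap κ ζ (p.1, 0))‖ₑ ^ 2 ∂μ ≤
      C * ‖U‖ₑ ^ 2 := by
    set F : ℕ → Euc (n - 1) × ℝ → ℝ≥0∞ := fun k p =>
      ‖φ k (graphMap κ ζ p) - φ k (graphMap κ ζ (p.1, 0))‖ₑ ^ 2 with hF
    have hφm : ∀ k, Measurable (φ k) := fun k => (continuous_test (φ k)).measurable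
    have hFm : ∀ k, Measurable (F k) := fun k => by
      have := hφm k
      fun_prop
    calc _ = ∫⁻ p, Filter.liminf (fun k => F k p) Filter.atTop ∂μ := by
          refine lintegral_congr_ae ?_
          filter_upwards [h1, h2] with p hp1 hp2
          refine (Filter.Tendsto.liminf_eq ?_).symm
          exact ((ENNReal.continuous_pow 2).tendsto _).comp (hp1.sub hp2).enorm
      _ ≤ Filter.liminf (fun k => ∫⁻ p, F k p ∂μ) Filter.atTop := lintegral_liminf_le hFm
      _ ≤ Filter.liminf (fun k => C * ‖Sob.ofTest ⊤ s (φ k)‖ₑ ^ 2) Filter.atTop := by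
          refine Filter.liminf_le_liminf (Filter.Eventually.of_forall fun k => ?_)
          rw [hμ, lintegral_prod _ (hFm k).aemeasurable]
          exact (setLIntegral_le_lintegral _ _).trans (hCφ κ ζ h.continuous (φ k))
      _ = C * ‖U‖ₑ ^ 2 := by
          refine Filter.Tendsto.liminf_eq ?_
          exact ENNReal.Tendsto.const_mul
            (((ENNReal.continuous_pow 2).tendsto _).comp hφU.enorm) (Or.inr hC)
  rw [hμ, lintegral_prod] at hle
  · exact ne_top_of_le_ne_top (ENNReal.mul_ne_top hC (by simp)) hle
  · refine Measurable.aemeasurable ?_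
    fun_prop

end
end TraceSpaces
end

/-! ### Locality of the trace, and zero trace gives a finite Hardy integral. -/

noncomputable section
namespace TraceSpaces

open scoped FourierTransform RealInnerProductSpace

lemma powMeasure_Ioo_eq_top {p δ : ℝ} (hp : p ≤ -1) (hδ : 0 < δ) : powMeasure p (Ioo 0 δ) = ⊤ := by
  by_contra h
  have h1 : IntegrableOn (fun t : ℝ => t ^ p) (Ioo 0 δ) := by
    refine ⟨(by fun_prop : Measurable fun t : ℝ => t ^ p).aestronglyMeasurable, ?_⟩
    refine lt_of_eq_of_lt ?_ (Ne.lt_top h)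
    rw [powMeasure, withDensity_apply _ measurableSet_Ioo]
    refine setLIntegral_congr_fun measurableSet_Ioo fun t ht => ?_
    dsimp only
    rw [← ofReal_norm, Real.norm_of_nonneg (Real.rpow_nonneg ht.1.le _), abs_of_pos ht.1]
  rw [intervalIntegral.integrableOn_Ioo_rpow_iff hδ] at h1
  linarith

section
variable {n : ℕ} {Ω : Opens (Euc n)} {s : ℝ}

lemma toL2_ae_eq_zero_of_restr (hs : 0 ≤ s) {U : Sob n s} (hU : restr Ω s U = 0) :
    ∀ᵐ x, x ∈ (Ω : Set (Euc n)) → Sob.toL2 hs U x = 0 := by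
  have hloc : LocallyIntegrable (Sob.toL2 hs U) :=
    (Lp.memLp (Sob.toL2 hs U)).locallyIntegrable (by norm_num)
  refine Ω.isOpen.ae_eq_zero_of_integral_contDiff_smul_eq_zero (hloc.locallyIntegrableOn _)
    fun ψ hψ hψc hψΩ => ?_
  let φ : 𝓓(Ω, ℝ) := ⟨ψ, hψ, hψc, hψΩ⟩
  have h := DFunLike.congr_fun (congrArg Subtype.val hU) φ
  change Sob.toDistribution n s U (realToSchwartz Ω φ) = 0 at h
  rw [Sob.toDistribution_apply hs] at h
  simp only [realToSchwartz_apply] at h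
  simp only [Complex.real_smul]
  exact h

/-- Just above a boundary point `U` vanishes, so the integrand there is `|γU|² t^{-2s}`. As `2s ≥ 1`
this diverges at `0` unless `γU = 0`. -/
lemma IsGraphChart.trace_ae_eq_zero (hΩ : IsLipschitzDomain Ω) {W : Set (Euc n)}
    {κ : Euc n ≃ᵢ GraphSpace n} {ζ : Euc (n - 1) → ℝ} {K : ℝ≥0} (h : IsGraphChart Ω W κ ζ K)
    (hs : 1 / 2 < s) (hs2 : s < 3 / 2) {U : Sob n s} (hU : restr Ω s U = 0) :
    ∀ᵐ y ∂(volume : Measure (Euc (n - 1))).restrict (chartBase Ω W κ ζ),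
      Sob.boundaryTrace hΩ s U (graphMap κ ζ (y, 0)) = 0 := by
  have h0 : 0 ≤ s := by linarith
  have hfin := h.lintegral_sub_trace_ne_top hΩ hs hs2 h0 U
  have hΦ := (continuous_graphMap κ h.continuous).measurable
  have hfm : Measurable (Sob.toL2 h0 U) := (Lp.stronglyMeasurable _).measurable
  have hγm : Measurable (Sob.boundaryTrace hΩ s U) := (Lp.stronglyMeasurable _).measurable
  have hzero := toL2_ae_eq_zero_of_restr h0 hU
  set f : Euc n → ℂ := ⇑(Sob.toL2 h0 U)
  set g : Euc n → ℂ := ⇑(Sob.boundaryTrace hΩ s U)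
  have hm : Measurable fun y => ∫⁻ t, ‖f (graphMap κ ζ (y, t)) - g (graphMap κ ζ (y, 0))‖ₑ ^ 2
      ∂powMeasure (-2 * s) := by
    have : Measurable fun p : Euc (n - 1) × ℝ =>
        ‖f (graphMap κ ζ p) - g (graphMap κ ζ (p.1, 0))‖ₑ ^ 2 := by fun_prop
    exact this.lintegral_prod_right'
  have hz : ∀ᵐ y, ∀ᵐ t, graphMap κ ζ (y, t) ∈ (Ω : Set (Euc n)) → f (graphMap κ ζ (y, t)) = 0 :=
    Measure.ae_ae_of_ae_prod ((measurePreserving_graphMap κ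
      h.continuous).quasiMeasurePreserving.tendsto_ae.eventually hzero)
  filter_upwards [ae_lt_top hm hfin, ae_restrict_of_ae hz,
    ae_restrict_mem h.measurableSet_chartBase] with y hy hyz hyA
  by_contra hne
  refine hy.ne (top_unique ?_)
  obtain ⟨δ, hδ, hW⟩ := h.eventually_mem hyA.2
  calc ⊤ = ∫⁻ _ in Ioo 0 δ, ‖g (graphMap κ ζ (y, 0))‖ₑ ^ 2 ∂powMeasure (-2 * s) := by
        rw [setLIntegral_const, powMeasure_Ioo_eq_top (by linarith) hδ, ENNReal.mul_top]
        simpa using hne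
    _ ≤ ∫⁻ t in Ioo 0 δ, ‖f (graphMap κ ζ (y, t)) - g (graphMap κ ζ (y, 0))‖ₑ ^ 2
          ∂powMeasure (-2 * s) := by
        refine lintegral_mono_ae ?_
        have hac : powMeasure (-2 * s) ≪ volume := withDensity_absolutelyContinuous _ _
        filter_upwards [ae_restrict_of_ae (hac.ae_le hyz), ae_restrict_mem measurableSet_Ioo]
          with t ht htδ
        rw [ht, zero_sub, enorm_neg]
        have hx := hW t (by rw [abs_of_pos htδ.1]; exact htδ.2)
        rw [← graphMap_eq] at hx
        refine (h.mem_iff _ hx).2 ?_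
        rw [graphHeight_graphMap]
        exact htδ.1
    _ ≤ _ := setLIntegral_le_lintegral _ _

/-- The trace depends only on the restriction to `Ω`. -/
lemma boundaryTrace_eq_zero_of_restr (hΩ : IsLipschitzDomain Ω) (hs : 1 / 2 < s) (hs2 : s < 3 / 2)
    {U : Sob n s} (hU : restr Ω s U = 0) : Sob.boundaryTrace hΩ s U = 0 := by
  obtain ⟨J, W, κ, ζ, K, hch, hcov⟩ := hΩ.exists_charts
  have hγm : Measurable (Sob.boundaryTrace hΩ s U) := (Lp.stronglyMeasurable _).measurable
  have h1 : ‖Sob.boundaryTrace hΩ s U‖ₑ ^ 2 = 0 := by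
    rw [← lintegral_enorm_sq]
    refine nonpos_iff_eq_zero.1 ((lintegral_surfaceMeasure_le hcov _).trans_eq ?_)
    refine Finset.sum_eq_zero fun j _ => nonpos_iff_eq_zero.1 ?_
    obtain ⟨B, -, hB⟩ := (hch j).exists_surfaceMeasure_le
    have hg : Measurable fun y => graphMap (κ j) (ζ j) (y, 0) :=
      ((continuous_graphMap (κ j) (hch j).continuous).comp (by fun_prop)).measurable
    refine (lintegral_mono' hB le_rfl).trans_eq ?_
    rw [lintegral_smul_measure, lintegral_map (by fun_prop) hg]
    have : ∫⁻ y in chartBase Ω (W j) (κ j) (ζ j),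
        ‖Sob.boundaryTrace hΩ s U (graphMap (κ j) (ζ j) (y, 0))‖ₑ ^ 2 = 0 := by
      rw [lintegral_eq_zero_iff (by fun_prop)]
      filter_upwards [(hch j).trace_ae_eq_zero hΩ hs hs2 hU] with y hy
      rw [hy]; simp
    rw [this, smul_zero]
  simpa using h1

open Classical in
/-- The distance to the boundary of `Ω`, truncated at `1`. -/
def boundaryDist (Ω : Opens (Euc n)) (x : Euc n) : ℝ :=
  if (frontier (Ω : Set (Euc n))).Nonempty then min 1 (Metric.infDist x (frontier (Ω : Set (Euc n))))
  -- `Metric.infDist` to the empty set is `0`, which would destroy positivity on `Ω`.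
  else 1

lemma boundaryDist_of_nonempty (h : (frontier (Ω : Set (Euc n))).Nonempty) (x : Euc n) :
    boundaryDist Ω x = min 1 (Metric.infDist x (frontier (Ω : Set (Euc n)))) := if_pos h

lemma boundaryDist_of_empty (h : ¬ (frontier (Ω : Set (Euc n))).Nonempty) (x : Euc n) :
    boundaryDist Ω x = 1 := if_neg h

lemma boundaryDist_le_one (x : Euc n) : boundaryDist Ω x ≤ 1 := by
  by_cases h : (frontier (Ω : Set (Euc n))).Nonempty
  · rw [boundaryDist_of_nonempty h]; exact min_le_left _ _
  · rw [boundaryDist_of_empty h]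

lemma boundaryDist_nonneg (x : Euc n) : 0 ≤ boundaryDist Ω x := by
  by_cases h : (frontier (Ω : Set (Euc n))).Nonempty
  · rw [boundaryDist_of_nonempty h]; exact le_min zero_le_one Metric.infDist_nonneg
  · rw [boundaryDist_of_empty h]; exact zero_le_one

lemma lipschitzWith_boundaryDist : LipschitzWith 1 (boundaryDist Ω) := by
  by_cases h : (frontier (Ω : Set (Euc n))).Nonempty
  · rw [show boundaryDist Ω = fun x => min 1 (Metric.infDist x (frontier (Ω : Set (Euc n)))) from
      funext (boundaryDist_of_nonempty h)]
    exact (Metric.lipschitz_infDist_pt _).const_min 1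
  · rw [show boundaryDist Ω = fun _ => 1 from funext (boundaryDist_of_empty h)]
    exact (LipschitzWith.const 1).weaken zero_le

lemma boundaryDist_pos {x : Euc n} (hx : x ∈ Ω) : 0 < boundaryDist Ω x := by
  by_cases h : (frontier (Ω : Set (Euc n))).Nonempty
  · rw [boundaryDist_of_nonempty h]
    refine lt_min one_pos ((isClosed_frontier.notMem_iff_infDist_pos h).1 fun hf => ?_)
    rw [Ω.isOpen.frontier_eq] at hf
    exact hf.2 hx
  · rw [boundaryDist_of_empty h]; exact one_pos

/-- The segment from `x` to `x + h` is connected and misses the boundary, so it lies in `Ω` or in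
the exterior. -/
lemma mem_iff_of_norm_lt_boundaryDist (x h : Euc n) (hx : ‖h‖ < boundaryDist Ω x) :
    x + h ∈ Ω ↔ x ∈ Ω := by
  have hseg : ∀ z ∈ segment ℝ x (x + h), z ∉ frontier (Ω : Set (Euc n)) := by
    intro z hz hzf
    have h1 : dist x z ≤ ‖h‖ := by
      have := norm_sub_le_of_mem_segment hz
      rw [add_sub_cancel_left] at this
      rwa [dist_comm, dist_eq_norm]
    rw [boundaryDist_of_nonempty ⟨z, hzf⟩] at hx
    have h2 := Metric.infDist_le_dist_of_mem (x := x) hzf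
    have h3 := hx.trans_le (min_le_right _ _)
    linarith
  have hconn : IsPreconnected (segment ℝ x (x + h)) := (convex_segment _ _).isPreconnected
  by_contra hne
  have hne' : (segment ℝ x (x + h) ∩ (Ω : Set (Euc n))).Nonempty ∧
      (segment ℝ x (x + h) ∩ (Ω : Set (Euc n))ᶜ).Nonempty := by
    by_cases hxΩ : x ∈ Ω
    · exact ⟨⟨x, left_mem_segment _ _ _, hxΩ⟩, ⟨x + h, right_mem_segment _ _ _, fun hh =>
        hne ⟨fun _ => hxΩ, fun _ => hh⟩⟩⟩
    · exact ⟨⟨x + h, right_mem_segment _ _ _, by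
        by_contra hh; exact hne ⟨fun h' => (hh h').elim, fun h' => (hxΩ h').elim⟩⟩,
        ⟨x, left_mem_segment _ _ _, hxΩ⟩⟩
  have hout : ∀ z ∈ segment ℝ x (x + h), z ∉ (Ω : Set (Euc n)) →
      z ∈ (closure (Ω : Set (Euc n)))ᶜ := fun z hz hzΩ hzc =>
    hseg z hz (by rw [Ω.isOpen.frontier_eq]; exact ⟨hzc, hzΩ⟩)
  obtain ⟨z, -, hz1, hz2⟩ := hconn Ω (closure (Ω : Set (Euc n)))ᶜ Ω.isOpen
    isClosed_closure.isOpen_compl (fun z hz => by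
      by_cases hzΩ : z ∈ (Ω : Set (Euc n))
      · exact Or.inl hzΩ
      · exact Or.inr (hout z hz hzΩ)) hne'.1 (by
      obtain ⟨z, hz, hzΩ⟩ := hne'.2
      exact ⟨z, hz, hout z hz hzΩ⟩)
  exact hz2 (subset_closure hz1)

lemma rpow_neg_le_of_le_mul {a b c : ℝ≥0∞} {r : ℝ} (hr : 0 ≤ r) (hc : c ≠ 0) (hct : c ≠ ⊤)
    (h : b ≤ c * a) : a ^ (-r) ≤ c ^ r * b ^ (-r) := by
  have h1 : b ^ r ≤ c ^ r * a ^ r := by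
    rw [← ENNReal.mul_rpow_of_nonneg _ _ hr]; gcongr
  have hc0 : c ^ r ≠ 0 := (ENNReal.rpow_pos (pos_iff_ne_zero.2 hc) hct).ne'
  have hc1 : c ^ r ≠ ⊤ := ENNReal.rpow_ne_top_of_nonneg hr hct
  rw [ENNReal.rpow_neg, ENNReal.rpow_neg]
  calc (a ^ r)⁻¹ = c ^ r * (c ^ r * a ^ r)⁻¹ := by
        rw [ENNReal.mul_inv (Or.inl hc0) (Or.inl hc1), ← mul_assoc, ENNReal.mul_inv_cancel hc0 hc1,
          one_mul]
    _ ≤ _ := by gcongr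

/-- Near the boundary, the distance to it is comparable to the height in a suitable chart. -/
lemma exists_rpow_boundaryDist_le (hΩ : IsLipschitzDomain Ω) {J : ℕ} {W : Fin J → Set (Euc n)}
    {κ : Fin J → Euc n ≃ᵢ GraphSpace n} {ζ : Fin J → Euc (n - 1) → ℝ} {K : Fin J → ℝ≥0}
    (hch : ∀ j, IsGraphChart Ω (W j) (κ j) (ζ j) (K j))
    (hcov : frontier (Ω : Set (Euc n)) ⊆ ⋃ j, W j) {r : ℝ} (hr : 0 ≤ r) :
    ∃ B C : ℝ≥0∞, B ≠ ⊤ ∧ C ≠ ⊤ ∧ ∀ x, ENNReal.ofReal (boundaryDist Ω x) ^ (-r) ≤ B +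
      ∑ j, C * ((fun x => (κ j x).fst) ⁻¹' chartBase Ω (W j) (κ j) (ζ j)).indicator
        (fun x => ENNReal.ofReal |graphHeight (κ j) (ζ j) x| ^ (-r)) x := by
  set M : ℝ := ∑ j, (K j : ℝ) with hM
  have hM0 : 0 ≤ M := Finset.sum_nonneg fun j _ => (K j).2
  have hKM : ∀ j, (K j : ℝ) ≤ M := fun j =>
    Finset.single_le_sum (f := fun j => (K j : ℝ)) (fun i _ => (K i).2) (Finset.mem_univ j)
  obtain ⟨δ, hδ, hball⟩ := lebesgue_number_lemma_of_metric hΩ.1 (fun j => (hch j).isOpen) hcov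
  -- `δ` is a Lebesgue number of the cover. If `z` is a nearest boundary point at distance below
  -- `δ/(2+M)`, the foot of `x` in the chart is within `(1+M)·dist x z` of `x`, hence within `δ` of
  -- `z`, and so stays in the chart.
  set η : ℝ := min 1 (δ / (2 + M)) with hη
  have hη0 : 0 < η := by positivity
  refine ⟨ENNReal.ofReal η ^ (-r), ENNReal.ofReal (1 + M) ^ r,
    ?_, ENNReal.rpow_ne_top_of_nonneg hr ENNReal.ofReal_ne_top, fun x => ?_⟩
  · rw [ENNReal.ofReal_rpow_of_pos hη0]; exact ENNReal.ofReal_ne_top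
  rcases le_or_gt η (boundaryDist Ω x) with hx | hx
  · refine le_trans ?_ le_self_add
    rw [ENNReal.rpow_neg, ENNReal.rpow_neg]
    gcongr
  · refine le_trans ?_ le_add_self
    have hne : (frontier (Ω : Set (Euc n))).Nonempty := by
      by_contra hne
      rw [boundaryDist_of_empty hne] at hx
      exact absurd hx (not_lt.2 (min_le_left _ _))
    obtain ⟨z, hz, hzd⟩ := hΩ.1.exists_infDist_eq_dist hne x
    have hD : boundaryDist Ω x = dist x z := by
      rw [boundaryDist_of_nonempty hne] at hx ⊢
      rw [← hzd]
      refine min_eq_right (le_of_lt ?_)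
      by_contra hc
      rw [min_eq_left (not_lt.1 hc)] at hx
      exact absurd hx (not_lt.2 (min_le_left _ _))
    obtain ⟨j, hj⟩ := hball z hz
    have hzW : z ∈ W j := hj (Metric.mem_ball_self hδ)
    have hF : |graphHeight (κ j) (ζ j) x| ≤ (1 + M) * dist x z := by
      have h1 := (lipschitzWith_graphHeight (κ j) (hch j).lipschitz).dist_le_mul x z
      rw [((hch j).mem_frontier_iff hzW).1 hz, Real.dist_eq, sub_zero] at h1
      refine h1.trans ?_
      push_cast
      gcongr
      exact hKM j
    set w := graphMap (κ j) (ζ j) ((κ j x).fst, 0) with hw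
    have hxw : x = w + graphHeight (κ j) (ζ j) x • graphAxis (κ j) := by
      rw [hw, ← graphMap_eq, graphMap_graphHeight]
    have hwW : w ∈ W j := by
      refine hj ?_
      rw [Metric.mem_ball]
      have h2 : dist w x ≤ (1 + M) * dist x z := by
        conv_lhs => rw [hxw]
        rw [dist_comm, dist_eq_norm, add_sub_cancel_left, norm_smul, norm_graphAxis, mul_one]
        exact hF
      have h3 : dist x z < δ / (2 + M) := by
        rw [← hD]; exact hx.trans_le (min_le_right _ _)
      rw [lt_div_iff₀ (by positivity)] at h3
      linarith [dist_triangle w x z]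
    have hmem : (κ j x).fst ∈ chartBase Ω (W j) (κ j) (ζ j) := by
      refine ⟨((hch j).mem_frontier_iff hwW).2 ?_, hwW⟩
      rw [hw, graphHeight_graphMap]
    refine le_trans ?_ (Finset.single_le_sum (f := fun j => ENNReal.ofReal (1 + M) ^ r *
      ((fun x => (κ j x).fst) ⁻¹' chartBase Ω (W j) (κ j) (ζ j)).indicator
        (fun x => ENNReal.ofReal |graphHeight (κ j) (ζ j) x| ^ (-r)) x)
      (fun i _ => zero_le) (Finset.mem_univ j))
    rw [indicator_of_mem (by exact hmem)]
    refine rpow_neg_le_of_le_mul hr (by simp; positivity) ENNReal.ofReal_ne_top ?_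
    rw [← ENNReal.ofReal_mul (by positivity), hD]
    exact ENNReal.ofReal_le_ofReal hF

/-- With `γU = 0` the integral of `|U - γU|² |t|^{-2s}` is this one, since `t` is the height in
graph coordinates. -/
lemma IsGraphChart.lintegral_height_ne_top (hΩ : IsLipschitzDomain Ω) {W : Set (Euc n)}
    {κ : Euc n ≃ᵢ GraphSpace n} {ζ : Euc (n - 1) → ℝ} {K : ℝ≥0} (h : IsGraphChart Ω W κ ζ K)
    (hs : 1 / 2 < s) (hs2 : s < 3 / 2) (h0 : 0 ≤ s) {U : Sob n s}
    (hU : Sob.boundaryTrace hΩ s U = 0) :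
    ∫⁻ x, ‖Sob.toL2 h0 U x‖ₑ ^ 2 * ((fun x => (κ x).fst) ⁻¹' chartBase Ω W κ ζ).indicator
        (fun x => ENNReal.ofReal |graphHeight κ ζ x| ^ (-(2 * s))) x ≠ ⊤ := by
  have hfin := h.lintegral_sub_trace_ne_top hΩ hs hs2 h0 U
  have hγ : ∀ᵐ x ∂surfaceMeasure Ω, Sob.boundaryTrace hΩ s U x = 0 := by
    rw [hU]; exact Lp.coeFn_zero _ _ _
  have hγ' := h.ae_chartBase hγ
  have hfm : Measurable (Sob.toL2 h0 U) := (Lp.stronglyMeasurable _).measurable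
  set f : Euc n → ℂ := ⇑(Sob.toL2 h0 U)
  have hm1 : Measurable fun x : Euc n => (κ x).fst := (lipschitzWith_chart_fst κ).continuous.measurable
  have hm2 := h.continuous_graphHeight.measurable
  have hG : Measurable fun x => ‖f x‖ₑ ^ 2 * ((fun x => (κ x).fst) ⁻¹' chartBase Ω W κ ζ).indicator
        (fun x => ENNReal.ofReal |graphHeight κ ζ x| ^ (-(2 * s))) x := by
    refine Measurable.mul (by fun_prop) (Measurable.indicator ?_ (hm1 h.measurableSet_chartBase))
    fun_prop
  rw [← lintegral_comp_graphMap (κ := κ) h.continuous hG]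
  refine ne_top_of_le_ne_top hfin ?_
  rw [← lintegral_indicator h.measurableSet_chartBase]
  rw [ae_restrict_iff' h.measurableSet_chartBase] at hγ'
  refine lintegral_mono_ae ?_
  filter_upwards [hγ'] with y hy
  by_cases hyA : y ∈ chartBase Ω W κ ζ
  · rw [indicator_of_mem hyA, lintegral_powMeasure]
    -- At `t = 0` the two weights differ: the extended power is `⊤`, the real power is `0`.
    have hne : ∀ᵐ t : ℝ, t ≠ 0 := by rw [ae_iff]; simp
    refine lintegral_mono_ae (hne.mono fun t ht => le_of_eq ?_)
    rw [indicator_of_mem (by rw [mem_preimage, fst_graphMap]; exact hyA), hy hyA, sub_zero,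
      graphHeight_graphMap, ENNReal.ofReal_rpow_of_pos (abs_pos.2 ht), mul_comm, neg_mul]
  · refine le_of_eq_of_le ?_ zero_le
    have : ∀ t, graphMap κ ζ (y, t) ∉ (fun x => (κ x).fst) ⁻¹' chartBase Ω W κ ζ := fun t => by
      rw [mem_preimage, fst_graphMap]; exact hyA
    simp only [indicator_of_notMem (this _), mul_zero, lintegral_zero]

/-- Functions with vanishing trace have a finite Hardy integral. -/
lemma hardyInt_boundaryDist_ne_top (hΩ : IsLipschitzDomain Ω) (hs : 1 / 2 < s) (hs2 : s < 3 / 2)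
    (h0 : 0 ≤ s) {U : Sob n s} (hU : Sob.boundaryTrace hΩ s U = 0) :
    hardyInt s (boundaryDist Ω) (Sob.toL2 h0 U) ≠ ⊤ := by
  obtain ⟨J, W, κ, ζ, K, hch, hcov⟩ := hΩ.exists_charts
  obtain ⟨B, C, hB, hC, hle⟩ := exists_rpow_boundaryDist_le hΩ hch hcov
    (r := 2 * s) (by linarith)
  have hfm : Measurable (Sob.toL2 h0 U) := (Lp.stronglyMeasurable _).measurable
  have hf2 : ∫⁻ x, ‖Sob.toL2 h0 U x‖ₑ ^ 2 ≠ ⊤ := by rw [lintegral_enorm_sq]; simp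
  have hjfin := fun j => (hch j).lintegral_height_ne_top hΩ hs hs2 h0 hU
  set f : Euc n → ℂ := ⇑(Sob.toL2 h0 U)
  set I : Fin J → Euc n → ℝ≥0∞ := fun j =>
    ((fun x => (κ j x).fst) ⁻¹' chartBase Ω (W j) (κ j) (ζ j)).indicator
        (fun x => ENNReal.ofReal |graphHeight (κ j) (ζ j) x| ^ (-(2 * s))) with hI
  have hIm : ∀ j, Measurable (I j) := fun j => by
    have hm1 : Measurable fun x : Euc n => (κ j x).fst :=
      (lipschitzWith_chart_fst (κ j)).continuous.measurable
    have hm2 := (hch j).continuous_graphHeight.measurable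
    refine Measurable.indicator ?_ (hm1 (hch j).measurableSet_chartBase)
    fun_prop
  have hbound : hardyInt s (boundaryDist Ω) f ≤ B * (∫⁻ x, ‖f x‖ₑ ^ 2) +
      ∑ j, C * ∫⁻ x, ‖f x‖ₑ ^ 2 * I j x := by
    calc hardyInt s (boundaryDist Ω) f
        ≤ ∫⁻ x, (B * ‖f x‖ₑ ^ 2 + ∑ j, C * (‖f x‖ₑ ^ 2 * I j x)) := by
          refine lintegral_mono fun x => ?_
          rw [neg_mul]
          refine (mul_le_mul_right (hle x) _).trans_eq ?_
          rw [mul_add, Finset.mul_sum, mul_comm _ B]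
          congr 1
          exact Finset.sum_congr rfl fun j _ => by rw [mul_left_comm]
      _ = _ := by
          rw [lintegral_add_left (by fun_prop), lintegral_const_mul _ (by fun_prop),
            lintegral_finsetSum _ (fun j _ => by have := hIm j; fun_prop)]
          congr 1
          refine Finset.sum_congr rfl fun j _ => ?_
          have := hIm j
          rw [lintegral_const_mul _ (by fun_prop)]
  refine ne_top_of_le_ne_top (ENNReal.add_ne_top.2 ⟨ENNReal.mul_ne_top hB hf2, ?_⟩) hbound
  exact (ENNReal.sum_lt_top.2 fun j _ => ENNReal.mul_lt_top hC.lt_top (hjfin j).lt_top).ne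

end
end TraceSpaces
end

/-! ### The trace on `H^s(Ω)` and the three inclusions. -/

noncomputable section
namespace TraceSpaces

open scoped FourierTransform RealInnerProductSpace

variable {n : ℕ} {Ω : Opens (Euc n)} {s : ℝ}

lemma restr_surjective : Function.Surjective (restr Ω s) :=
  (restrictMap Ω s).surjective_rangeRestrict

lemma equivQuot_restr (U : Sob n s) :
    SobOn.equivQuot Ω s (restr Ω s U) = Submodule.Quotient.mk U :=
  (restrictMap Ω s).quotKerEquivRange_symm_apply_image U _

lemma norm_restr_le (U : Sob n s) : ‖restr Ω s U‖ ≤ ‖U‖ := by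
  change ‖SobOn.equivQuot Ω s (restr Ω s U)‖ ≤ ‖U‖
  rw [equivQuot_restr]
  exact Submodule.Quotient.norm_mk_le _ U

lemma continuous_restr : Continuous (restr Ω s) :=
  AddMonoidHomClass.continuous_of_bound (restr Ω s) 1 fun U => by
    rw [one_mul]; exact norm_restr_le U

lemma exists_restr_eq_norm_lt (u : SobOn Ω s) {ε : ℝ} (hε : 0 < ε) :
    ∃ V : Sob n s, restr Ω s V = u ∧ ‖V‖ < ‖u‖ + ε := by
  obtain ⟨V, hV, hn⟩ := Submodule.Quotient.norm_mk_lt (SobOn.equivQuot Ω s u) hε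
  refine ⟨V, (SobOn.equivQuot Ω s).injective ?_, hn⟩
  rw [equivQuot_restr, hV]

/-- By locality every `V` with the same restriction as `φ` has the same trace, so the bound on `ℝⁿ`
may be minimised over `V`, which gives the quotient norm. -/
lemma exists_boundaryValue_le_restr (hΩ : IsLipschitzDomain Ω) (hs : 1 / 2 < s)
    (hs2 : s < 3 / 2) :
    ∃ C : ℝ, ∀ φ, ‖boundaryValue hΩ φ‖ ≤ C * ‖(restr Ω s ∘ₗ Sob.ofTest ⊤ s) φ‖ := by
  refine ⟨‖Sob.boundaryTrace hΩ s‖, fun φ => ?_⟩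
  refine le_of_forall_pos_lt_add fun ε hε => ?_
  have hC : 0 < ‖Sob.boundaryTrace hΩ s‖ + 1 := by positivity
  obtain ⟨V, hV, hVn⟩ := exists_restr_eq_norm_lt (restr Ω s (Sob.ofTest ⊤ s φ))
    (div_pos hε hC)
  have h1 : Sob.boundaryTrace hΩ s V = boundaryValue hΩ φ := by
    rw [← Sob.boundaryTrace_ofTest hΩ hs hs2, ← sub_eq_zero, ← map_sub]
    exact boundaryTrace_eq_zero_of_restr hΩ hs hs2 (by rw [map_sub, hV, sub_self])
  rw [← h1]
  have h2 := (Sob.boundaryTrace hΩ s).le_opNorm V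
  have h3 : ‖Sob.boundaryTrace hΩ s‖ * (ε / (‖Sob.boundaryTrace hΩ s‖ + 1)) < ε := by
    rw [← mul_div_assoc, div_lt_iff₀ hC]
    nlinarith
  have h4 := mul_le_mul_of_nonneg_left hVn.le (norm_nonneg (Sob.boundaryTrace hΩ s))
  rw [mul_add] at h4
  rw [LinearMap.comp_apply]
  linarith

lemma denseRange_restr_ofTest (hs : 0 < s) (hs2 : s < 3 / 2) :
    DenseRange (restr Ω s ∘ₗ Sob.ofTest ⊤ s) :=
  restr_surjective.denseRange.comp (denseRange_ofTest hs hs2) continuous_restr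

/-- The trace on `H^s(Ω)` of a restriction is the trace on `H^s(ℝⁿ)`. -/
lemma trace_restr (hΩ : IsLipschitzDomain Ω) (hs : 1 / 2 < s) (hs2 : s < 3 / 2) (U : Sob n s) :
    trace hΩ s (restr Ω s U) = Sob.boundaryTrace hΩ s U := by
  have h := (denseRange_ofTest (n := n) (s := s) (by linarith) hs2).equalizer
    ((trace hΩ s).continuous.comp continuous_restr) (Sob.boundaryTrace hΩ s).continuous
    (funext fun φ => by
      simp only [Function.comp_apply]
      rw [Sob.boundaryTrace_ofTest hΩ hs hs2]
      exact LinearMap.extendOfNorm_eq (denseRange_restr_ofTest (by linarith) hs2)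
        (exists_boundaryValue_le_restr hΩ hs hs2) φ)
  exact congrFun h U

/-- Almost everywhere limits of test functions on `Ω` vanish off `Ω`, the boundary included.
Injectivity of restriction therefore does not need `∂Ω` to be a null set. -/
lemma toL2_ae_eq_zero_of_mem_HTilde (hs : 0 ≤ s) {U : Sob n s} (hU : U ∈ HTilde Ω s) :
    ∀ᵐ x, x ∉ (Ω : Set (Euc n)) → Sob.toL2 hs U x = 0 := by
  obtain ⟨x, hx, hxU⟩ := mem_closure_iff_seq_limit.1 hU
  choose φ hφ using hx
  have h1 : Filter.Tendsto (fun k => Sob.ofTest Ω s (φ k)) Filter.atTop (nhds U) := by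
    simpa only [hφ] using hxU
  obtain ⟨a, -, ha⟩ := (tendstoInMeasure_of_tendsto_Lp
    (((Sob.continuous_toL2 hs).tendsto U).comp h1)).exists_seq_tendsto_ae
  filter_upwards [ha, ae_all_iff.2 fun k => Sob.toL2_ofTest hs Ω (φ (a k))] with y hy hy' hyΩ
  refine tendsto_nhds_unique hy ?_
  refine tendsto_const_nhds.congr fun k => ?_
  simp only [Function.comp_apply]
  rw [hy' k]
  exact (image_eq_zero_of_notMem_tsupport fun h => hyΩ ((φ (a k)).tsupport_subset h)).symm

lemma injOn_restr_HTilde (hs : 0 ≤ s) : InjOn (restr Ω s) (HTilde Ω s) := by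
  intro U hU V hV hUV
  have h1 : restr Ω s (U - V) = 0 := by rw [map_sub, hUV, sub_self]
  have h2 : Sob.toL2 hs (U - V) = 0 := by
    rw [Lp.eq_zero_iff_ae_eq_zero]
    filter_upwards [toL2_ae_eq_zero_of_restr hs h1,
      toL2_ae_eq_zero_of_mem_HTilde hs ((HTilde Ω s).sub_mem hU hV)] with x hx1 hx2
    by_cases hx : x ∈ (Ω : Set (Euc n))
    · exact hx1 hx
    · exact hx2 hx
  exact sub_eq_zero.1 (Sob.toL2_injective hs (by rw [h2, map_zero]))

lemma map_restr_HTilde_le : (HTilde Ω s).map (restr Ω s) ≤ HZero Ω s := by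
  rintro _ ⟨U, hU, rfl⟩
  refine map_mem_closure continuous_restr hU ?_
  rintro _ ⟨φ, rfl⟩
  exact ⟨φ, rfl⟩

lemma HZero_le_ker_trace (hΩ : IsLipschitzDomain Ω) (hs : 1 / 2 < s) (hs2 : s < 3 / 2) :
    HZero Ω s ≤ LinearMap.ker (trace hΩ s).toLinearMap := by
  refine Submodule.topologicalClosure_minimal _ ?_ (trace hΩ s).isClosed_ker
  rintro _ ⟨φ, rfl⟩
  rw [LinearMap.mem_ker]
  change trace hΩ s (restr Ω s (Sob.ofTest Ω s φ)) = 0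
  let ψ : 𝓓((⊤ : Opens (Euc n)), ℂ) := ⟨φ, φ.contDiff, φ.hasCompactSupport, by simp⟩
  have h1 : Sob.ofTest Ω s φ = Sob.ofTest ⊤ s ψ := rfl
  rw [trace_restr hΩ hs hs2, h1, Sob.boundaryTrace_ofTest hΩ hs hs2, Lp.eq_zero_iff_ae_eq_zero]
  have h2 : ∀ᵐ x ∂surfaceMeasure Ω, x ∈ frontier (Ω : Set (Euc n)) :=
    ae_restrict_mem isClosed_frontier.measurableSet
  filter_upwards [(memLp_boundary hΩ ψ).coeFn_toLp, h2] with x hx hxf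
  refine hx.trans ?_
  rw [Ω.isOpen.frontier_eq] at hxf
  exact image_eq_zero_of_notMem_tsupport fun h => hxf.2 (φ.tsupport_subset h)

lemma ker_trace_le (hΩ : IsLipschitzDomain Ω) (hs : 1 / 2 < s) (hs2 : s < 3 / 2) :
    LinearMap.ker (trace hΩ s).toLinearMap ≤ (HTilde Ω s).map (restr Ω s) := by
  intro u hu
  obtain ⟨U, rfl⟩ := restr_surjective u
  have hs0 : 0 < s := by linarith
  have hU : Sob.boundaryTrace hΩ s U = 0 := by rw [← trace_restr hΩ hs hs2]; exact hu
  obtain ⟨V, hV, hVU⟩ := Sob.exists_mem_HTilde hs0 hs2 U lipschitzWith_boundaryDist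
    boundaryDist_nonneg boundaryDist_le_one mem_iff_of_norm_lt_boundaryDist
    (fun x hx => boundaryDist_pos hx) (hardyInt_boundaryDist_ne_top hΩ hs hs2 hs0.le hU)
  exact ⟨V, hV, hVU⟩

end TraceSpaces
end

theorem mainTheorem3 {n : ℕ} (hn : 1 ≤ n) {Ω : Opens (TraceSpaces.Euc n)}
    (hΩ : TraceSpaces.IsLipschitzDomain Ω) {s : ℝ} (hs : 1 / 2 < s) (hs' : s < 3 / 2) :
    Set.InjOn (TraceSpaces.restr Ω s) (TraceSpaces.HTilde Ω s) ∧
      TraceSpaces.HZero Ω s = (TraceSpaces.HTilde Ω s).map (TraceSpaces.restr Ω s) ∧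
      (TraceSpaces.HTilde Ω s).map (TraceSpaces.restr Ω s) =
        LinearMap.ker (TraceSpaces.trace hΩ s).toLinearMap := by
  have h1 := TraceSpaces.map_restr_HTilde_le (Ω := Ω) (s := s)
  have h2 := TraceSpaces.HZero_le_ker_trace hΩ hs hs'
  have h3 := TraceSpaces.ker_trace_le hΩ hs hs'
  exact ⟨TraceSpaces.injOn_restr_HTilde (by linarith),
    le_antisymm (h2.trans h3) h1, le_antisymm (h1.trans h2) h3⟩
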